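/- Let $n\in\mathbb N$ and let $H_1,H_2:\mathbb R^n\times\mathbb R^n\to\mathbb R$, $(\xi,p)\mapsto H_i(\xi,p)$, be continuous functions such that for $i=1,2$: (A1) $\lim_{r\to\infty}\inf\{H_i(\xi,p) : \xi\in\mathbb R^n,\ |p|\ge r\}=\infty$; (A2) $H_i(\xi+z,p)=H_i(\xi,p)$ for all $\xi,p\in\mathbb R^n$ and $z\in\mathbb Z^n$; (A3) there is a constant $C_H>0$ with $|H_i(\xi,p)-H_i(\xi,q)|\le C_H|p-q|$ for all $\xi,p,q\in\mathbb R^n$. Let $f_1,f_2\in C^1(\mathbb R^n)$ have bounded gradients. Throughout, solutions are continuous viscosity solutions, and $\{i,j\}=\{1,2\}$. For $P\in\mathbb R^n$ let $\overline H(P)$ denote the effective Hamiltonian, i.e. the unique constant for which the cell problem \[ H_i(\xi,P+Dv_i(\xi))+v_i(\xi)-v_j(\xi)=\overline H(P)\quad\text{in }\mathbb R^n,\qquad i=1,2, \] has a $\mathbb Z^n$-periodic solution $(v_1,v_2)\in C(\mathbb R^n)^2$. Then for each $T>0$ there exists a constant $C=C(T)>0$ (depending also on $n$, $H_1,H_2,f_1,f_2$,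 but not on $\varepsilon$) with the following property. Let $u$ be the solution of \[ u_t+\overline H(Du)=0\ \text{ in }\mathbb R^n\times(0,T),\qquad u(\cdot,0)=\frac{f_1+f_2}{2}\ \text{ on }\mathbb R^n, \] and, for $\varepsilon>0$, let $(u_1^\varepsilon,u_2^\varepsilon)$ be the solution of \[ (u_i^\varepsilon)_t+H_i\Big(\frac x\varepsilon,Du_i^\varepsilon\Big)+\frac1\varepsilon(u_i^\varepsilon-u_j^\varepsilon)=0\ \text{ in }\mathbb R^n\times(0,T),\qquad u_i^\varepsilon(\cdot,0)=f_i\ \text{ on }\mathbb R^n,\qquad i=1,2. \] Then, for every $\varepsilon>0$ and $i=1,2$, \[ \sup_{\mathbb R^n\times[0,T]}|u_i^\varepsilon-m_i^\varepsilon|\le C\,\varepsilon^{1/3}, \qquad\text{where}\qquad m_i^\varepsilon(x,t):=u(x,t)+\frac{f_i(x)-f_j(x)}{2}\,e^{-2t/\varepsilon}. \] -/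

import Mathlib

noncomputable section

namespace WeaklyCoupledHJ

/-- `ℝⁿ` with its Euclidean norm. -/
abbrev E (n : ℕ) : Type := EuclideanSpace ℝ (Fin n)

/-- The vector of `ℝⁿ` with the integer coordinates `z`. -/
def intVec {n : ℕ} (z : Fin n → ℤ) : E n := WithLp.toLp 2 (fun k => (z k : ℝ))

/-! ### Conditions on Hamiltonians `H (ξ, p)` -/

/-- `lim_{r → ∞} inf {H(ξ, p) | ξ ∈ ℝⁿ, |p| ≥ r} = ∞`. -/
def UniformlyCoercive {n : ℕ} (H : E n → E n → ℝ) : Prop :=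
  ∀ M : ℝ, ∃ r : ℝ, ∀ ξ p : E n, r ≤ ‖p‖ → M ≤ H ξ p

/-- `ξ ↦ H(ξ, p)` is `ℤⁿ`-periodic for every `p`. -/
def PeriodicHamiltonian {n : ℕ} (H : E n → E n → ℝ) : Prop :=
  ∀ (ξ p : E n) (z : Fin n → ℤ), H (ξ + intVec z) p = H ξ p

/-- `H` is Lipschitz continuous in `p`, uniformly in `ξ`. -/
def UniformlyLipschitzInP {n : ℕ} (H : E n → E n → ℝ) : Prop :=
  ∃ L : ℝ, 0 < L ∧ ∀ ξ p q : E n, |H ξ p - H ξ q| ≤ L * ‖p - q‖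

/-! ### Viscosity solutions

Test functions are `C¹` near the touching point; this is equivalent to testing with `C¹` functions
on the whole domain, as only the germ of the test function matters. The unknown functions
themselves are continuous in all the notions of solution below. -/

/-- `v` is a viscosity subsolution of `F(ξ, Dv) = 0` in `ℝⁿ`. -/
def IsViscSub {n : ℕ} (F : E n → E n → ℝ) (v : E n → ℝ) : Prop :=
  ∀ (φ : E n → ℝ) (ξ : E n), ContDiffAt ℝ 1 φ ξ →
    IsLocalMax (fun η => v η - φ η) ξ → F ξ (gradient φ ξ) ≤ 0

/-- `v` is a viscosity supersolution of `F(ξ, Dv) = 0` in `ℝⁿ`. -/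
def IsViscSuper {n : ℕ} (F : E n → E n → ℝ) (v : E n → ℝ) : Prop :=
  ∀ (φ : E n → ℝ) (ξ : E n), ContDiffAt ℝ 1 φ ξ →
    IsLocalMin (fun η => v η - φ η) ξ → 0 ≤ F ξ (gradient φ ξ)

/-- `u` is a viscosity subsolution of `u_t + F(x, t, Du) = 0` in `ℝⁿ × (0, T)`. -/
def IsEvolViscSub {n : ℕ} (T : ℝ) (F : E n → ℝ → E n → ℝ) (u : E n → ℝ → ℝ) : Prop :=
  ∀ (φ : E n × ℝ → ℝ) (x : E n) (t : ℝ), 0 < t → t < T → ContDiffAt ℝ 1 φ (x, t) →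
    IsLocalMax (fun z : E n × ℝ => u z.1 z.2 - φ z) (x, t) →
    deriv (fun s => φ (x, s)) t + F x t (gradient (fun y => φ (y, t)) x) ≤ 0

/-- `u` is a viscosity supersolution of `u_t + F(x, t, Du) = 0` in `ℝⁿ × (0, T)`. -/
def IsEvolViscSuper {n : ℕ} (T : ℝ) (F : E n → ℝ → E n → ℝ) (u : E n → ℝ → ℝ) : Prop :=
  ∀ (φ : E n × ℝ → ℝ) (x : E n) (t : ℝ), 0 < t → t < T → ContDiffAt ℝ 1 φ (x, t) →
    IsLocalMin (fun z : E n × ℝ => u z.1 z.2 - φ z) (x, t) →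
    0 ≤ deriv (fun s => φ (x, s)) t + F x t (gradient (fun y => φ (y, t)) x)

/-! ### The system with fast switching -/

/-- `(u₁, u₂)` is a continuous viscosity solution on `ℝⁿ × [0, T]` of
`(u_i)_t + H_i(x/ε, Du_i) + (u_i - u_j)/ε = 0` in `ℝⁿ × (0, T)`, `u_i(·, 0) = f_i`, for
`{i, j} = {1, 2}` (here the two indices are the elements of `Fin 2`). In the viscosity
inequality for `u_i`, the coupling term is evaluated at the touching point. -/
structure IsSystemSolution {n : ℕ} (H : Fin 2 → E n → E n → ℝ) (f : Fin 2 → E n → ℝ)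
    (T ε : ℝ) (u : Fin 2 → E n → ℝ → ℝ) : Prop where
  continuousOn : ∀ i, ContinuousOn (fun z : E n × ℝ => u i z.1 z.2)
    (Set.univ ×ˢ Set.Icc 0 T)
  sub : ∀ i j, i ≠ j → IsEvolViscSub T
    (fun x t p => H i (ε⁻¹ • x) p + (u i x t - u j x t) / ε) (u i)
  super : ∀ i j, i ≠ j → IsEvolViscSuper T
    (fun x t p => H i (ε⁻¹ • x) p + (u i x t - u j x t) / ε) (u i)
  initial : ∀ i x, u i x 0 = f i x

/-! ### The cell problem and the effective Hamiltonian -/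

/-- `(v₁, v₂)` is a continuous `ℤⁿ`-periodic viscosity solution of the cell problem
`H_i(ξ, P + Dv_i) + v_i - v_j = c` in `ℝⁿ`, for `{i, j} = {1, 2}`. -/
structure IsCellSolution {n : ℕ} (H : Fin 2 → E n → E n → ℝ) (P : E n) (c : ℝ)
    (v : Fin 2 → E n → ℝ) : Prop where
  continuous : ∀ i, Continuous (v i)
  periodic : ∀ i (ξ : E n) (z : Fin n → ℤ), v i (ξ + intVec z) = v i ξ
  sub : ∀ i j, i ≠ j → IsViscSub (fun ξ p => H i ξ (P + p) + v i ξ - v j ξ - c) (v i)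
  super : ∀ i j, i ≠ j → IsViscSuper (fun ξ p => H i ξ (P + p) + v i ξ - v j ξ - c) (v i)

/-- The effective Hamiltonian: `H̄(P)` is the constant `c` for which the cell problem at `P`
has a solution. -/
def effectiveHamiltonian {n : ℕ} (H : Fin 2 → E n → E n → ℝ) (P : E n) : ℝ :=
  Classical.epsilon (fun c : ℝ => ∃ v : Fin 2 → E n → ℝ, IsCellSolution H P c v)

/-! ### The limit equation and the matched functions -/

/-- `u` is a continuous viscosity solution on `ℝⁿ × [0, T]` of `u_t + G(Du) = 0` in
`ℝⁿ × (0, T)`, `u(·, 0) = g`. -/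
structure IsCauchySolution {n : ℕ} (G : E n → ℝ) (g : E n → ℝ) (T : ℝ)
    (u : E n → ℝ → ℝ) : Prop where
  continuousOn : ContinuousOn (fun z : E n × ℝ => u z.1 z.2) (Set.univ ×ˢ Set.Icc 0 T)
  sub : IsEvolViscSub T (fun _ _ p => G p) u
  super : IsEvolViscSuper T (fun _ _ p => G p) u
  initial : ∀ x, u x 0 = g x

/-- `m_i^ε(x, t) = u(x, t) + ((f_i - f_j)(x) / 2) e^{-2t/ε}`. -/
def matched {n : ℕ} (f : Fin 2 → E n → ℝ) (ε : ℝ) (u : E n → ℝ → ℝ) (i j : Fin 2)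
    (x : E n) (t : ℝ) : ℝ :=
  u x t + (f i x - f j x) / 2 * Real.exp (-(2 * t / ε))

end WeaklyCoupledHJ

end

open Filter Topology Set

namespace WeaklyCoupledHJ

/-! ### Gradients -/

section Gradients

variable {n : ℕ}

/-! The proof combines perturbed test functions with a doubling of variables. The two components of
the system start from different data, so the layer `q_i e^{-2t/ε}` with `q_i = (f_i - f_j)/2` is
removed first. Since `q_j = -q_i`, the layer is exactly absorbed by the coupling. Its gradient
disturbs `H_i` by at most `C_H L e^{-2t/ε}`, whose time integral is `O(ε)` (`systemSub_sub_layer`).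
What remains is a subsolution `w` of the same system, both components starting from `g = (f₁ +
f₂)/2`.

Formally `w_i ≈ u + ε v_i(x/ε)` with `v` a corrector at `P = Du`. Exact correctors come with no
control of their dependence on `P`. They are replaced by solutions `v^λ` of `H_i(ξ, P + Dv_i) + λ
v_i + v_i - v_j = 0`, for which `λ v^λ` is bounded, `|λ v^λ + H̄(P)| ≤ D λ`, and `v^λ` is
`C_H/λ`-Lipschitz in `P`. In `systemSub_sub_effectiveSuper_le` one maximises `w_i(x,t) - u(y,s) - ε
v_i^λ(P, ξ)` minus penalties, over the index `i` as well, where `P` is the gradient of `A √(η² +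
|x-y|²)`. Linear growth of this penalty keeps `|P| ≤ A`, so neither `u` nor `u^ε` has to be
Lipschitz. Maximality in `i` turns the coupling of the correctors into the coupling of `w`. The
errors are `Aη` (penalty on the diagonal), `ε/λ` (size of the corrector), `λ` (discount) and
`ε/(λη)` (variation of the corrector with `P`). The choice `λ = η = ε^{1/3}` makes them all
`O(ε^{1/3})` for `ε ≤ 1`; for `ε ≥ 1` the distance of both solutions to `g` suffices.

The functions `v^λ` come from Perron's method. Coercivity makes bounded subsolutions equi-Lipschitz,
so their supremum is continuous without a comparison principle, and its maximality gives periodicity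
and the dependence on `P`. The oscillation of `v^λ` is bounded independently of `λ`, so `v^λ` almost
solves the cell problem. `ergodic_le` then compares `-λ v^λ` with `H̄(P)`, and `λ → 0` gives
solutions of the cell problem.

The lower bound is the upper bound for the dual Hamiltonian `-H(ξ, -p)`. The dual is not coercive,
which is why `exists_rate_upper` assumes the existence of correctors (`HasSuperCorrectors`) in place
of coercivity. The correctors of the dual are the negatives of the original ones. -/

theorem hasGradientAt_iff_innerSL {f : E n → ℝ} {p x : E n} :
    HasGradientAt f p x ↔ HasFDerivAt f (innerSL ℝ p) x :=
  hasGradientAt_iff_hasFDerivAt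

theorem hasGradientAt_add {f g : E n → ℝ} {p q x : E n} (hf : HasGradientAt f p x)
    (hg : HasGradientAt g q x) : HasGradientAt (fun y => f y + g y) (p + q) x := by
  rw [hasGradientAt_iff_innerSL] at *
  rw [map_add]
  exact hf.add hg

theorem hasGradientAt_neg {f : E n → ℝ} {p x : E n} (hf : HasGradientAt f p x) :
    HasGradientAt (fun y => -f y) (-p) x := by
  rw [hasGradientAt_iff_innerSL] at *
  rw [map_neg]
  exact hf.neg

theorem hasGradientAt_sub {f g : E n → ℝ} {p q x : E n} (hf : HasGradientAt f p x)
    (hg : HasGradientAt g q x) : HasGradientAt (fun y => f y - g y) (p - q) x := by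
  simpa [sub_eq_add_neg] using hasGradientAt_add hf (hasGradientAt_neg hg)

theorem hasGradientAt_const_mul {f : E n → ℝ} {p x : E n} (c : ℝ) (hf : HasGradientAt f p x) :
    HasGradientAt (fun y => c * f y) (c • p) x := by
  rw [hasGradientAt_iff_innerSL] at *
  simpa using hf.const_mul c

theorem HasDerivAt.comp_hasGradientAt' {h : ℝ → ℝ} {h' : ℝ} {f : E n → ℝ} {p x : E n}
    (hh : HasDerivAt h h' (f x)) (hf : HasGradientAt f p x) :
    HasGradientAt (fun y => h (f y)) (h' • p) x := by
  rw [hasGradientAt_iff_innerSL] at *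
  simpa [Function.comp_def] using hh.comp_hasFDerivAt x hf

theorem hasGradientAt_norm_sub_sq (a x : E n) :
    HasGradientAt (fun y => ‖y - a‖ ^ 2) ((2 : ℝ) • (x - a)) x := by
  rw [hasGradientAt_iff_innerSL]
  have h := ((hasStrictFDerivAt_norm_sq (x - a)).hasFDerivAt).comp x
    ((hasFDerivAt_id x).sub_const a)
  have e : (2 • innerSL ℝ (x - a)).comp (ContinuousLinearMap.id ℝ (E n))
      = innerSL ℝ ((2 : ℝ) • (x - a)) := by
    ext y; simp [two_smul]
  rw [e] at h
  exact h

theorem contDiff_norm_sub_sq (a : E n) : ContDiff ℝ 1 (fun y : E n => ‖y - a‖ ^ 2) :=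
  (contDiff_norm_sq ℝ).comp (contDiff_id.sub contDiff_const)

/-- The gradient of a scaled half square of the distance. -/
theorem hasGradientAt_half_sq (c : ℝ) (a x : E n) :
    HasGradientAt (fun y => ‖y - a‖ ^ 2 / (2 * c)) (c⁻¹ • (x - a)) x := by
  have h := hasGradientAt_const_mul (2 * c)⁻¹ (hasGradientAt_norm_sub_sq a x)
  convert h using 1
  · ext y; ring
  · rw [smul_smul]; congr 1; field_simp

theorem contDiff_half_sq (c : ℝ) (a : E n) :
    ContDiff ℝ 1 (fun y : E n => ‖y - a‖ ^ 2 / (2 * c)) :=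
  (contDiff_norm_sub_sq a).div_const _

/-- A smooth approximation of the distance to `a`. -/
noncomputable def smoothDist (η : ℝ) (a x : E n) : ℝ := √(η ^ 2 + ‖x - a‖ ^ 2)

theorem smoothDist_pos {η : ℝ} (hη : 0 < η) (a x : E n) : 0 < smoothDist η a x := by
  unfold smoothDist; positivity

theorem le_smoothDist (η : ℝ) (a x : E n) : η ≤ smoothDist η a x :=
  Real.le_sqrt_of_sq_le (by nlinarith [sq_nonneg ‖x - a‖])

theorem norm_sub_le_smoothDist (η : ℝ) (a x : E n) : ‖x - a‖ ≤ smoothDist η a x :=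
  Real.le_sqrt_of_sq_le (by nlinarith [sq_nonneg η])

theorem smoothDist_self {η : ℝ} (hη : 0 < η) (a : E n) : smoothDist η a a = η := by
  simp [smoothDist, Real.sqrt_sq hη.le]

theorem smoothDist_comm (η : ℝ) (a x : E n) : smoothDist η a x = smoothDist η x a := by
  simp [smoothDist, norm_sub_rev]

theorem contDiff_smoothDist {η : ℝ} (hη : 0 < η) (a : E n) :
    ContDiff ℝ 1 (smoothDist η a) :=
  (contDiff_const.add (contDiff_norm_sub_sq a)).sqrt (fun x => by positivity)

theorem hasGradientAt_smoothDist {η : ℝ} (hη : 0 < η) (a x : E n) :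
    HasGradientAt (smoothDist η a) ((smoothDist η a x)⁻¹ • (x - a)) x := by
  have h1 : HasGradientAt (fun y => η ^ 2 + ‖y - a‖ ^ 2) ((2 : ℝ) • (x - a)) x := by
    simpa using hasGradientAt_add (hasGradientAt_const (F := E n) x (η ^ 2)) (hasGradientAt_norm_sub_sq a x)
  have h0 : HasDerivAt Real.sqrt (1 / (2 * √(η ^ 2 + ‖x - a‖ ^ 2))) (η ^ 2 + ‖x - a‖ ^ 2) :=
    Real.hasDerivAt_sqrt (by positivity)
  have h2 := HasDerivAt.comp_hasGradientAt' h0 h1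
  have e : (1 / (2 * √(η ^ 2 + ‖x - a‖ ^ 2))) • (2 : ℝ) • (x - a)
      = (smoothDist η a x)⁻¹ • (x - a) := by
    rw [smul_smul]; congr 1
    unfold smoothDist
    field_simp
  rw [e] at h2
  exact h2

theorem norm_inv_smoothDist_smul_le {η : ℝ} (hη : 0 < η) (a x : E n) :
    ‖(smoothDist η a x)⁻¹ • (x - a)‖ ≤ 1 := by
  have h := smoothDist_pos hη a x
  rw [norm_smul, norm_inv, Real.norm_of_nonneg h.le, inv_mul_le_iff₀ h, mul_one]
  exact norm_sub_le_smoothDist η a x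

theorem abs_smoothDist_sub_le {η : ℝ} (hη : 0 < η) (d e : E n) :
    |smoothDist η 0 d - smoothDist η 0 e| ≤ ‖d - e‖ := by
  have hd := smoothDist_pos hη 0 d
  have he := smoothDist_pos hη 0 e
  have hd2 : smoothDist η 0 d ^ 2 = η ^ 2 + ‖d‖ ^ 2 := by
    simp only [smoothDist, sub_zero]; exact Real.sq_sqrt (by positivity)
  have he2 : smoothDist η 0 e ^ 2 = η ^ 2 + ‖e‖ ^ 2 := by
    simp only [smoothDist, sub_zero]; exact Real.sq_sqrt (by positivity)
  have h1 : ‖d‖ ≤ smoothDist η 0 d := by simpa using norm_sub_le_smoothDist η 0 d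
  have h2 : ‖e‖ ≤ smoothDist η 0 e := by simpa using norm_sub_le_smoothDist η 0 e
  have h3 : |‖d‖ - ‖e‖| ≤ ‖d - e‖ := abs_norm_sub_norm_le d e
  have h4 : |smoothDist η 0 d - smoothDist η 0 e| * (smoothDist η 0 d + smoothDist η 0 e)
      = |‖d‖ - ‖e‖| * (‖d‖ + ‖e‖) := by
    have e1 := abs_mul (smoothDist η 0 d - smoothDist η 0 e) (smoothDist η 0 d + smoothDist η 0 e)
    have e2 := abs_mul (‖d‖ - ‖e‖) (‖d‖ + ‖e‖)
    rw [abs_of_pos (add_pos hd he)] at e1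
    rw [abs_of_nonneg (add_nonneg (norm_nonneg d) (norm_nonneg e))] at e2
    rw [← e1, ← e2]
    congr 1
    linarith [hd2, he2]
  have h5 : |‖d‖ - ‖e‖| * (‖d‖ + ‖e‖) ≤ ‖d - e‖ * (smoothDist η 0 d + smoothDist η 0 e) := by
    gcongr
  rw [← h4] at h5
  exact le_of_mul_le_mul_right h5 (add_pos hd he)

/-- The gradient of `smoothDist η 0`, at the slope `A`. -/
noncomputable def slope (A η : ℝ) (d : E n) : E n := A • ((smoothDist η 0 d)⁻¹ • d)

theorem norm_slope_le {A η : ℝ} (hA : 0 ≤ A) (hη : 0 < η) (d : E n) : ‖slope A η d‖ ≤ A := by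
  have h := norm_inv_smoothDist_smul_le hη 0 d
  rw [sub_zero] at h
  rw [slope, norm_smul, Real.norm_of_nonneg hA]
  exact mul_le_of_le_one_right hA h

/-- With `S = smoothDist η 0`, the difference `d/S(d) - e/S(e)` equals `S(d)⁻¹ ((d - e) + (S(e) -
S(d)) e/S(e))`. As `S ≥ η`, `S` is 1-Lipschitz and `|e| ≤ S(e)`, each of the two terms contributes
`|d - e|/η`. -/
theorem norm_slope_sub_le {A η : ℝ} (hA : 0 ≤ A) (hη : 0 < η) (d e : E n) :
    ‖slope A η d - slope A η e‖ ≤ 2 * A / η * ‖d - e‖ := by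
  have hd := smoothDist_pos hη 0 d
  have he := smoothDist_pos hη 0 e
  have hdη := le_smoothDist η 0 d
  have hunit := norm_inv_smoothDist_smul_le hη 0 e
  rw [sub_zero] at hunit
  have key : (smoothDist η 0 d)⁻¹ • d - (smoothDist η 0 e)⁻¹ • e
      = (smoothDist η 0 d)⁻¹ • ((d - e)
        + (smoothDist η 0 e - smoothDist η 0 d) • ((smoothDist η 0 e)⁻¹ • e)) := by
    have e3 : (smoothDist η 0 d)⁻¹ * (smoothDist η 0 e - smoothDist η 0 d) * (smoothDist η 0 e)⁻¹
        = (smoothDist η 0 d)⁻¹ - (smoothDist η 0 e)⁻¹ := by field_simp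
    rw [smul_add, smul_sub, smul_smul, smul_smul, e3, sub_smul]
    abel
  have h2 : ‖(d - e) + (smoothDist η 0 e - smoothDist η 0 d) • ((smoothDist η 0 e)⁻¹ • e)‖
      ≤ 2 * ‖d - e‖ := by
    refine (norm_add_le _ _).trans ?_
    rw [norm_smul, Real.norm_eq_abs]
    have h3 := abs_smoothDist_sub_le hη e d
    rw [norm_sub_rev] at h3
    have := mul_le_mul h3 hunit (norm_nonneg _) (norm_nonneg _)
    linarith
  rw [slope, slope, ← smul_sub, key, norm_smul, norm_smul, Real.norm_of_nonneg hA, norm_inv,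
    Real.norm_of_nonneg hd.le]
  calc A * ((smoothDist η 0 d)⁻¹ * _) ≤ A * (η⁻¹ * (2 * ‖d - e‖)) := by gcongr
    _ = 2 * A / η * ‖d - e‖ := by field_simp

theorem continuousAt_gradient {φ : E n → ℝ} {x : E n} (h : ContDiffAt ℝ 1 φ x) :
    ContinuousAt (gradient φ) x := by
  have h1 : ContinuousAt (fderiv ℝ φ) x := h.continuousAt_fderiv one_ne_zero
  exact (InnerProductSpace.toDual ℝ (E n)).symm.continuous.continuousAt.comp h1

theorem hasGradientAt_of_contDiffAt {φ : E n → ℝ} {x : E n} (h : ContDiffAt ℝ 1 φ x) :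
    HasGradientAt φ (gradient φ x) x :=
  (h.differentiableAt one_ne_zero).hasGradientAt

theorem gradient_eq_zero_of_isLocalMax {φ : E n → ℝ} {x p : E n} (h : IsLocalMax φ x)
    (hp : HasGradientAt φ p x) : p = 0 := by
  have h1 := h.fderiv_eq_zero
  have h2 := hp.hasFDerivAt.fderiv
  rw [h1] at h2
  simpa using h2.symm

end Gradients

/-! ### Viscosity inequalities -/

section Viscosity

variable {n : ℕ}

theorem IsViscSub.le {F : E n → E n → ℝ} {v φ : E n → ℝ} {ξ p : E n} (h : IsViscSub F v)
    (hφ : ContDiffAt ℝ 1 φ ξ) (hp : HasGradientAt φ p ξ)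
    (hmax : IsLocalMax (fun η => v η - φ η) ξ) : F ξ p ≤ 0 := by
  have := h φ ξ hφ hmax
  rwa [hp.gradient] at this

theorem IsViscSuper.le {F : E n → E n → ℝ} {v φ : E n → ℝ} {ξ p : E n} (h : IsViscSuper F v)
    (hφ : ContDiffAt ℝ 1 φ ξ) (hp : HasGradientAt φ p ξ)
    (hmin : IsLocalMin (fun η => v η - φ η) ξ) : 0 ≤ F ξ p := by
  have := h φ ξ hφ hmin
  rwa [hp.gradient] at this

theorem IsEvolViscSub.le {T : ℝ} {F : E n → ℝ → E n → ℝ} {u : E n → ℝ → ℝ} {φ : E n × ℝ → ℝ}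
    {x p : E n} {t b : ℝ} (h : IsEvolViscSub T F u) (ht : 0 < t) (htT : t < T)
    (hφ : ContDiffAt ℝ 1 φ (x, t)) (hp : HasGradientAt (fun y => φ (y, t)) p x)
    (hb : HasDerivAt (fun s => φ (x, s)) b t)
    (hmax : IsLocalMax (fun z : E n × ℝ => u z.1 z.2 - φ z) (x, t)) : b + F x t p ≤ 0 := by
  have := h φ x t ht htT hφ hmax
  rwa [hp.gradient, hb.deriv] at this

theorem IsEvolViscSuper.le {T : ℝ} {F : E n → ℝ → E n → ℝ} {u : E n → ℝ → ℝ}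
    {φ : E n × ℝ → ℝ} {x p : E n} {t b : ℝ} (h : IsEvolViscSuper T F u) (ht : 0 < t)
    (htT : t < T) (hφ : ContDiffAt ℝ 1 φ (x, t))
    (hp : HasGradientAt (fun y => φ (y, t)) p x) (hb : HasDerivAt (fun s => φ (x, s)) b t)
    (hmin : IsLocalMin (fun z : E n × ℝ => u z.1 z.2 - φ z) (x, t)) : 0 ≤ b + F x t p := by
  have := h φ x t ht htT hφ hmin
  rwa [hp.gradient, hb.deriv] at this

theorem gradient_neg' (φ : E n → ℝ) (x : E n) :
    gradient (fun y => -φ y) x = -gradient φ x := by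
  simp only [gradient]
  rw [show (fun y => -φ y) = -φ from rfl, fderiv_neg, map_neg]

/-- The sign changes here and below exchange sub- and supersolutions. They reduce stability to the
case of subsolutions and the lower estimate to the upper one. -/
theorem IsViscSub.neg {F : E n → E n → ℝ} {v : E n → ℝ} (h : IsViscSub F v) :
    IsViscSuper (fun ξ p => -F ξ (-p)) (fun ξ => -v ξ) := by
  intro φ ξ hφ hmin
  have h1 := h (fun y => -φ y) ξ hφ.neg (by
    have := hmin.neg
    refine this.congr (Eventually.of_forall fun y => ?_)
    simp only; ring)
  rw [gradient_neg'] at h1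
  simpa using h1

theorem IsViscSuper.neg {F : E n → E n → ℝ} {v : E n → ℝ} (h : IsViscSuper F v) :
    IsViscSub (fun ξ p => -F ξ (-p)) (fun ξ => -v ξ) := by
  intro φ ξ hφ hmax
  have h1 := h (fun y => -φ y) ξ hφ.neg (by
    have := hmax.neg
    refine this.congr (Eventually.of_forall fun y => ?_)
    simp only; ring)
  rw [gradient_neg'] at h1
  simpa using h1

theorem IsEvolViscSub.neg {T : ℝ} {F : E n → ℝ → E n → ℝ} {u : E n → ℝ → ℝ}
    (h : IsEvolViscSub T F u) :
    IsEvolViscSuper T (fun x t p => -F x t (-p)) (fun x t => -u x t) := by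
  intro φ x t ht htT hφ hmin
  have h1 := h (fun y => -φ y) x t ht htT hφ.neg (by
    have := hmin.neg
    refine this.congr (Eventually.of_forall fun y => ?_)
    simp only; ring)
  rw [gradient_neg', show (fun s => -φ (x, s)) = -(fun s => φ (x, s)) from rfl, deriv.neg] at h1
  linarith

theorem IsEvolViscSuper.neg {T : ℝ} {F : E n → ℝ → E n → ℝ} {u : E n → ℝ → ℝ}
    (h : IsEvolViscSuper T F u) :
    IsEvolViscSub T (fun x t p => -F x t (-p)) (fun x t => -u x t) := by
  intro φ x t ht htT hφ hmax
  have h1 := h (fun y => -φ y) x t ht htT hφ.neg (by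
    have := hmax.neg
    refine this.congr (Eventually.of_forall fun y => ?_)
    simp only; ring)
  rw [gradient_neg', show (fun s => -φ (x, s)) = -(fun s => φ (x, s)) from rfl, deriv.neg] at h1
  linarith

end Viscosity

/-! ### Periodic functions -/

section Periodic

variable {n : ℕ}

/-- Subtracting integer parts moves any point into the unit cube, which lies in the ball of radius
`√n`. -/
theorem exists_norm_add_intVec_le (ξ : E n) : ∃ z : Fin n → ℤ, ‖ξ + intVec z‖ ≤ √n := by
  refine ⟨fun k => -⌊ξ k⌋, ?_⟩
  rw [EuclideanSpace.norm_eq]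
  apply Real.sqrt_le_sqrt
  have h : ∀ k ∈ (Finset.univ : Finset (Fin n)), ‖(ξ + intVec fun k => -⌊ξ k⌋) k‖ ^ 2 ≤ 1 := by
    intro k _
    have e : (ξ + intVec fun k => -⌊ξ k⌋) k = Int.fract (ξ k) := by
      simp [intVec, Int.fract, sub_eq_add_neg]
    rw [e, Real.norm_of_nonneg (Int.fract_nonneg _)]
    have h1 := Int.fract_nonneg (ξ k)
    have h2 := Int.fract_lt_one (ξ k)
    nlinarith
  simpa using Finset.sum_le_sum h

theorem exists_bound_of_periodic {H : E n → E n → ℝ}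
    (hc : Continuous (fun z : E n × E n => H z.1 z.2)) (hp : PeriodicHamiltonian H) (R : ℝ) :
    ∃ M, 0 < M ∧ ∀ ξ p, ‖p‖ ≤ R → |H ξ p| ≤ M := by
  obtain ⟨M, hM⟩ := ((isCompact_closedBall (0 : E n) √n).prod
    (isCompact_closedBall (0 : E n) R)).exists_bound_of_continuousOn hc.continuousOn
  refine ⟨max M 1, by positivity, fun ξ p hpR => le_max_of_le_left ?_⟩
  obtain ⟨z, hz⟩ := exists_norm_add_intVec_le ξ
  have := hM (ξ + intVec z, p) ⟨by simpa using hz, by simpa using hpR⟩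
  simpa [hp ξ p z] using this

/-- Continuity of `H ξ p` in `ξ`, uniformly for bounded `p`. -/
def UniformContInX (H : E n → E n → ℝ) : Prop :=
  ∀ R τ : ℝ, 0 < τ → ∃ δ, 0 < δ ∧ ∀ ξ η p : E n, ‖p‖ ≤ R → ‖ξ - η‖ < δ → |H ξ p - H η p| < τ

theorem uniformContInX_of_periodic {H : E n → E n → ℝ}
    (hc : Continuous (fun z : E n × E n => H z.1 z.2)) (hp : PeriodicHamiltonian H) :
    UniformContInX H := by
  intro R τ hτ
  -- The extra 1 in the radius leaves room for the translate of `η`, which is within distance 1 of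
  -- that of `ξ`.
  have hu := ((isCompact_closedBall (0 : E n) (√n + 1)).prod
    (isCompact_closedBall (0 : E n) R)).uniformContinuousOn_of_continuous hc.continuousOn
  obtain ⟨δ, hδ, h⟩ := Metric.uniformContinuousOn_iff.1 hu τ hτ
  refine ⟨min δ 1, by positivity, fun ξ η p hpR hξη => ?_⟩
  obtain ⟨z, hz⟩ := exists_norm_add_intVec_le ξ
  have h1 : ‖ξ - η‖ < δ := hξη.trans_le (min_le_left _ _)
  have h2 : ‖ξ - η‖ < 1 := hξη.trans_le (min_le_right _ _)
  have h3 : ‖η + intVec z‖ ≤ √n + 1 := by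
    have : η + intVec z = (ξ + intVec z) - (ξ - η) := by abel
    rw [this]
    exact (norm_sub_le _ _).trans (by linarith)
  have := h (ξ + intVec z, p) ⟨by simpa using hz.trans (by linarith), by simpa using hpR⟩
    (η + intVec z, p) ⟨by simpa using h3, by simpa using hpR⟩ (by
      rw [Prod.dist_eq, dist_self, dist_eq_norm]
      simpa using h1)
  simpa [hp ξ p z, hp η p z, Real.dist_eq] using this

theorem exists_bound_of_periodic_fun {v : E n → ℝ} (hc : Continuous v)
    (hp : ∀ ξ (z : Fin n → ℤ), v (ξ + intVec z) = v ξ) : ∃ M, 0 < M ∧ ∀ ξ, |v ξ| ≤ M := by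
  obtain ⟨M, hM0, hM⟩ := exists_bound_of_periodic (H := fun ξ _ => v ξ)
    (hc.comp continuous_fst) (fun ξ _ z => hp ξ z) 0
  exact ⟨M, hM0, fun ξ => hM ξ 0 (by simp)⟩

end Periodic

/-! ### Attained maxima -/

/-- Maximising over the index as well as the point is what makes a weakly coupled system behave like
a scalar equation. At the maximum, comparison with another index at the same point controls the
coupling term. -/
theorem exists_family_max {ι X : Type*} [Finite ι] [Nonempty ι] [PseudoMetricSpace X]
    [ProperSpace X] {f : ι → X → ℝ} {S : Set X} (hS : IsClosed S)
    (hf : ∀ i, ContinuousOn (f i) S) {i₀ : ι} {x₀ : X} (hx₀ : x₀ ∈ S) (c : X) (R : ℝ)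
    (h : ∀ i, ∀ x ∈ S, f i₀ x₀ ≤ f i x → dist x c ≤ R) :
    ∃ i, ∃ m ∈ S, ∀ j, ∀ x ∈ S, f j x ≤ f i m := by
  have hK : IsCompact (S ∩ Metric.closedBall c R) := (isCompact_closedBall c R).inter_left hS
  have hx₀K : x₀ ∈ S ∩ Metric.closedBall c R := ⟨hx₀, h i₀ x₀ hx₀ le_rfl⟩
  have hmax : ∀ i, ∃ m ∈ S ∩ Metric.closedBall c R,
      ∀ x ∈ S ∩ Metric.closedBall c R, f i x ≤ f i m := fun i =>
    hK.exists_isMaxOn ⟨x₀, hx₀K⟩ ((hf i).mono inter_subset_left)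
  choose m hm hmm using hmax
  obtain ⟨i, hi⟩ := Finite.exists_max (fun i => f i (m i))
  refine ⟨i, m i, (hm i).1, fun j x hx => ?_⟩
  by_cases hle : f i₀ x₀ ≤ f j x
  · exact (hmm j x ⟨hx, h j x hx hle⟩).trans (hi j)
  · exact (not_le.1 hle).le.trans ((hmm i₀ x₀ hx₀K).trans (hi i₀))

theorem exists_max_of_superlevel {X : Type*} [PseudoMetricSpace X] [ProperSpace X] {f : X → ℝ}
    {S : Set X} (hS : IsClosed S) (hf : ContinuousOn f S) {x₀ : X} (hx₀ : x₀ ∈ S) (c : X) (R : ℝ)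
    (h : ∀ x ∈ S, f x₀ ≤ f x → dist x c ≤ R) : ∃ m ∈ S, ∀ x ∈ S, f x ≤ f m := by
  obtain ⟨_, m, hm, hmm⟩ := exists_family_max (ι := Unit) (f := fun _ => f) hS (fun _ => hf)
    (i₀ := ()) hx₀ c R (fun _ => h)
  exact ⟨m, hm, hmm ()⟩

/-! ### Touching from above -/

section Touching

variable {n : ℕ}

/-- If `φ` touches `a` from above at `ξ₀`, then any `b` close to `a` is touched from above nearby
with almost the same gradient. Only an upper bound on `b` is needed away from `ξ₀`. -/
theorem exists_touching_nearby {a φ : E n → ℝ} {ξ₀ : E n} (hφ : ContDiffAt ℝ 1 φ ξ₀)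
    (hmax : IsLocalMax (fun η => a η - φ η) ξ₀) {r : ℝ} (hr : 0 < r) :
    ∃ ε > 0, ∃ ρ > 0, ∀ b : E n → ℝ, Continuous b → a ξ₀ - ε ≤ b ξ₀ →
      (∀ η ∈ Metric.closedBall ξ₀ ρ, b η ≤ a η + ε) →
      ∃ (ξ : E n) (ψ : E n → ℝ) (p : E n), ContDiffAt ℝ 1 ψ ξ ∧ HasGradientAt ψ p ξ ∧
        IsLocalMax (fun η => b η - ψ η) ξ ∧ ‖ξ - ξ₀‖ < r ∧ ‖p - gradient φ ξ₀‖ < r ∧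
        a ξ₀ - r ≤ b ξ := by
  have e1 : ∀ᶠ η in 𝓝 ξ₀, ContDiffAt ℝ 1 φ η := hφ.eventually (by simp)
  have e2 : ∀ᶠ η in 𝓝 ξ₀, ‖gradient φ η - gradient φ ξ₀‖ < r / 2 := by
    have := (continuousAt_gradient hφ) (Metric.ball_mem_nhds _ (half_pos hr))
    filter_upwards [this] with η hη
    simpa [dist_eq_norm] using hη
  have e3 : ∀ᶠ η in 𝓝 ξ₀, |φ η - φ ξ₀| < r / 2 := by
    have := hφ.continuousAt (Metric.ball_mem_nhds _ (half_pos hr))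
    filter_upwards [this] with η hη
    simpa [Real.dist_eq] using hη
  obtain ⟨ρ₀, hρ₀, hball⟩ := Metric.eventually_nhds_iff_ball.1
    (e1.and (e2.and (e3.and hmax)))
  set ρ := min (ρ₀ / 2) (r / 8) with hρdef
  have hρ : 0 < ρ := by positivity
  have hρr : ρ ≤ r / 8 := min_le_right _ _
  have hin : ∀ η ∈ Metric.closedBall ξ₀ ρ, η ∈ Metric.ball ξ₀ ρ₀ := fun η hη =>
    Metric.closedBall_subset_ball (by have := min_le_left (ρ₀ / 2) (r / 8); linarith) hη
  -- Maximising `b - φ - |η - ξ₀|²` over the ball gives `|ξ - ξ₀|² ≤ 2ε ≤ ρ²/2`, so the maximum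
  -- point is interior. The bound by `r / 4` keeps the value of `b` there close to `a ξ₀`.
  set ε := min (ρ ^ 2 / 4) (r / 4) with hεdef
  have hε : 0 < ε := by positivity
  have hε1 : ε ≤ ρ ^ 2 / 4 := min_le_left _ _
  have hε2 : ε ≤ r / 4 := min_le_right _ _
  refine ⟨ε, hε, ρ, hρ, fun b hb hb0 hba => ?_⟩
  have hφc : ContinuousOn φ (Metric.closedBall ξ₀ ρ) := fun η hη =>
    (hball η (hin η hη)).1.continuousAt.continuousWithinAt
  obtain ⟨ξ, hξ, hξmax⟩ := (isCompact_closedBall ξ₀ ρ).exists_isMaxOn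
    (f := fun η => b η - (φ η + ‖η - ξ₀‖ ^ 2)) ⟨ξ₀, Metric.mem_closedBall_self hρ.le⟩
    (hb.continuousOn.sub (hφc.add (by fun_prop)))
  have h0 := hξmax (Metric.mem_closedBall_self hρ.le)
  simp only [mem_ofPred_eq, sub_self, norm_zero] at h0
  obtain ⟨c1, c2, c3, c4⟩ := hball ξ (hin ξ hξ)
  have hb1 := hba ξ hξ
  have hsq : ‖ξ - ξ₀‖ ^ 2 < ρ ^ 2 := by nlinarith
  have hlt : ‖ξ - ξ₀‖ < ρ := lt_of_pow_lt_pow_left₀ 2 hρ.le hsq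
  refine ⟨ξ, fun η => φ η + ‖η - ξ₀‖ ^ 2, gradient φ ξ + (2 : ℝ) • (ξ - ξ₀),
    c1.add (contDiff_norm_sub_sq ξ₀).contDiffAt,
    hasGradientAt_add (hasGradientAt_of_contDiffAt c1) (hasGradientAt_norm_sub_sq ξ₀ ξ), ?_,
    by linarith, ?_, ?_⟩
  · have : Metric.closedBall ξ₀ ρ ∈ 𝓝 ξ :=
      mem_of_superset (Metric.isOpen_ball.mem_nhds (by simpa [dist_eq_norm] using hlt))
        Metric.ball_subset_closedBall
    exact hξmax.isLocalMax this
  · have : gradient φ ξ + (2 : ℝ) • (ξ - ξ₀) - gradient φ ξ₀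
        = (gradient φ ξ - gradient φ ξ₀) + (2 : ℝ) • (ξ - ξ₀) := by abel
    rw [this]
    refine (norm_add_le _ _).trans_lt ?_
    rw [norm_smul]
    norm_num
    linarith
  · have := abs_lt.1 c3
    nlinarith [sq_nonneg ‖ξ - ξ₀‖]

/-! ### Global bounds from information at touching points -/

theorem hasGradientAt_norm_sub {a x : E n} (h : x ≠ a) :
    HasGradientAt (fun y => ‖y - a‖) (‖x - a‖⁻¹ • (x - a)) x := by
  have hpos : 0 < ‖x - a‖ := norm_pos_iff.2 (sub_ne_zero.2 h)
  have h0 : HasDerivAt Real.sqrt (1 / (2 * √(‖x - a‖ ^ 2))) (‖x - a‖ ^ 2) :=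
    Real.hasDerivAt_sqrt (by positivity)
  have h2 := HasDerivAt.comp_hasGradientAt' h0 (hasGradientAt_norm_sub_sq a x)
  have e : (1 / (2 * √(‖x - a‖ ^ 2))) • (2 : ℝ) • (x - a) = ‖x - a‖⁻¹ • (x - a) := by
    rw [smul_smul, Real.sqrt_sq hpos.le]; congr 1; field_simp
  rw [e] at h2
  simpa [Real.sqrt_sq] using h2

/-- If the bound failed, a cone of slope greater than `Λ` would touch `v` from above away from its
vertex, with a gradient of norm greater than `Λ`. Boundedness of `v` ensures that the touching point
exists. -/
theorem lipschitz_of_touching {v : E n → ℝ} (hc : Continuous v) {B : ℝ} (hB : ∀ ξ, |v ξ| ≤ B)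
    {Λ : ℝ} (hΛ : 0 ≤ Λ)
    (h : ∀ (φ : E n → ℝ) (ξ p : E n), ContDiffAt ℝ 1 φ ξ → HasGradientAt φ p ξ →
      IsLocalMax (fun η => v η - φ η) ξ → ‖p‖ ≤ Λ) (x y : E n) :
    |v x - v y| ≤ Λ * ‖x - y‖ := by
  have key : ∀ x y : E n, v x - v y ≤ Λ * ‖x - y‖ := by
    intro y x₀
    by_contra! hcon
    have hne : y ≠ x₀ := by rintro rfl; simp at hcon
    have hpos : 0 < ‖y - x₀‖ := norm_pos_iff.2 (sub_ne_zero.2 hne)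
    obtain ⟨Λ', h1, h2⟩ : ∃ Λ', Λ < Λ' ∧ Λ' * ‖y - x₀‖ < v y - v x₀ := by
      obtain ⟨Λ', h1, h2⟩ := exists_between ((lt_div_iff₀ hpos).2 hcon)
      exact ⟨Λ', h1, (lt_div_iff₀ hpos).1 h2⟩
    have hΛ' : 0 < Λ' := hΛ.trans_lt h1
    obtain ⟨m, -, hm⟩ := exists_max_of_superlevel (f := fun y => v y - Λ' * ‖y - x₀‖)
      (S := univ) isClosed_univ (by fun_prop) (mem_univ x₀) x₀ (2 * B / Λ') (by
        intro x _ hx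
        simp only [sub_self, norm_zero, mul_zero, sub_zero] at hx
        rw [le_div_iff₀ hΛ', dist_eq_norm]
        have := abs_le.1 (hB x); have := abs_le.1 (hB x₀)
        linarith)
    have hmy := hm y (mem_univ _)
    have hmne : m ≠ x₀ := by
      rintro rfl
      simp only [sub_self, norm_zero, mul_zero, sub_zero] at hmy
      linarith
    have hmpos : 0 < ‖m - x₀‖ := norm_pos_iff.2 (sub_ne_zero.2 hmne)
    have hcd : ContDiffAt ℝ 1 (fun y : E n => Λ' * ‖y - x₀‖) m :=
      contDiffAt_const.mul ((contDiffAt_id.sub contDiffAt_const).norm ℝ (sub_ne_zero.2 hmne))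
    have := h _ m _ hcd (hasGradientAt_const_mul Λ' (hasGradientAt_norm_sub hmne))
      (Eventually.of_forall fun x => hm x (mem_univ _))
    rw [norm_smul, norm_smul, norm_inv, norm_norm, inv_mul_cancel₀ hmpos.ne', mul_one,
      Real.norm_of_nonneg hΛ'.le] at this
    linarith
  rw [abs_le]
  have h1 := key x y
  have h2 := key y x
  rw [norm_sub_rev] at h2
  constructor <;> linarith

/-- A bound on a continuous `g` at the points where `v` is touched from above holds everywhere. -/
theorem le_of_le_touching {v g : E n → ℝ} (hc : Continuous v) {B : ℝ} (hB : ∀ ξ, |v ξ| ≤ B)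
    (hg : Continuous g) {C : ℝ}
    (h : ∀ (φ : E n → ℝ) (ξ p : E n), ContDiffAt ℝ 1 φ ξ → HasGradientAt φ p ξ →
      IsLocalMax (fun η => v η - φ η) ξ → g ξ ≤ C) (ξ₀ : E n) : g ξ₀ ≤ C := by
  by_contra! hcon
  obtain ⟨ρ, hρ, hball⟩ := Metric.eventually_nhds_iff_ball.1
    (hg.continuousAt.eventually (lt_mem_nhds hcon))
  have hB0 : 0 ≤ B := (abs_nonneg _).trans (hB ξ₀)
  -- The paraboloid is so steep that `v`, whose oscillation is at most `2B`, can only be touched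
  -- within distance `ρ` of `ξ₀`.
  set c : ℝ := ρ ^ 2 / (2 * (4 * (B + 1))) with hcdef
  have hcpos : 0 < c := by positivity
  have hbd : ∀ x, v ξ₀ ≤ v x - ‖x - ξ₀‖ ^ 2 / (2 * c) → ‖x - ξ₀‖ < ρ := by
    intro x hx
    have h1 := abs_le.1 (hB x); have h2 := abs_le.1 (hB ξ₀)
    have h3 : ‖x - ξ₀‖ ^ 2 / (2 * c) ≤ 2 * B := by linarith
    rw [div_le_iff₀ (by positivity)] at h3
    have h4 : 2 * B * (2 * c) < ρ ^ 2 := by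
      rw [hcdef]
      have : 2 * B * (2 * (ρ ^ 2 / (2 * (4 * (B + 1))))) = ρ ^ 2 * (B / (2 * (B + 1))) := by
        field_simp; ring
      rw [this]
      have : B / (2 * (B + 1)) < 1 := by rw [div_lt_one (by positivity)]; linarith
      have hρ2 : 0 < ρ ^ 2 := by positivity
      nlinarith
    exact lt_of_pow_lt_pow_left₀ 2 hρ.le (h3.trans_lt h4)
  obtain ⟨m, -, hm⟩ := exists_max_of_superlevel (f := fun y => v y - ‖y - ξ₀‖ ^ 2 / (2 * c))
    (S := univ) isClosed_univ (by fun_prop) (mem_univ ξ₀) ξ₀ ρ (by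
      intro x _ hx
      rw [dist_eq_norm]
      exact (hbd x (by simpa using hx)).le)
  have hm0 := hm ξ₀ (mem_univ _)
  have h1 := hbd m (by simpa using hm0)
  have h2 := hball m (by simpa [dist_eq_norm] using h1)
  have h3 := h _ m _ (contDiff_half_sq c ξ₀).contDiffAt (hasGradientAt_half_sq c ξ₀ m)
    (Eventually.of_forall fun x => hm x (mem_univ _))
  linarith

end Touching

/-! ### Discounted systems -/

section Discount

variable {n : ℕ}

/-- `w` is a viscosity subsolution of `K_i(ξ, Dw_i) + λ w_i + w_i - w_j = 0`. -/
def IsDiscountSub (lam : ℝ) (K : Fin 2 → E n → E n → ℝ) (w : Fin 2 → E n → ℝ) : Prop :=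
  ∀ i j, i ≠ j → IsViscSub (fun ξ p => K i ξ p + lam * w i ξ + (w i ξ - w j ξ)) (w i)

/-- `w` is a viscosity supersolution of `K_i(ξ, Dw_i) + λ w_i + w_i - w_j = 0`. -/
def IsDiscountSuper (lam : ℝ) (K : Fin 2 → E n → E n → ℝ) (w : Fin 2 → E n → ℝ) : Prop :=
  ∀ i j, i ≠ j → IsViscSuper (fun ξ p => K i ξ p + lam * w i ξ + (w i ξ - w j ξ)) (w i)

/-- Where `w i` is touched from above, the equation bounds `w i - w j` by `-K - λ w i ≤ m + M`;
`le_of_le_touching` extends this to all points. -/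
theorem abs_sub_le_of_discountSub {lam : ℝ} {K : Fin 2 → E n → E n → ℝ} {w : Fin 2 → E n → ℝ}
    (hw : IsDiscountSub lam K w) (hc : ∀ i, Continuous (w i)) {B : ℝ} (hB : ∀ i ξ, |w i ξ| ≤ B)
    {M m : ℝ} (hM : ∀ i ξ, |lam * w i ξ| ≤ M) (hm : ∀ i ξ p, -m ≤ K i ξ p) {i j : Fin 2}
    (hij : i ≠ j) (ξ : E n) : |w i ξ - w j ξ| ≤ M + m := by
  have key : ∀ i j : Fin 2, i ≠ j → ∀ ξ, w i ξ - w j ξ ≤ M + m := fun i j hij ξ =>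
    le_of_le_touching (v := w i) (g := fun ξ => w i ξ - w j ξ) (hc i) (hB i)
      ((hc i).sub (hc j)) (fun φ η p hφ hp hmax => by
        have h1 := (hw i j hij).le hφ hp hmax
        have h2 := hm i η p
        have h3 := abs_le.1 (hM i η)
        linarith) ξ
  rw [abs_le]
  constructor <;> linarith [key i j hij ξ, key j i hij.symm ξ]

/-- At a touching point the equation gives `K ≤ -λ w i - (w i - w j) ≤ M + (M + m)`. This excludes
gradients beyond the threshold `Λ`. -/
theorem lipschitz_of_discountSub {lam : ℝ} {K : Fin 2 → E n → E n → ℝ} {w : Fin 2 → E n → ℝ}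
    (hw : IsDiscountSub lam K w) (hc : ∀ i, Continuous (w i)) {B : ℝ} (hB : ∀ i ξ, |w i ξ| ≤ B)
    {M m Λ : ℝ} (hΛ : 0 ≤ Λ) (hM : ∀ i ξ, |lam * w i ξ| ≤ M) (hm : ∀ i ξ p, -m ≤ K i ξ p)
    (hK : ∀ i ξ p, Λ < ‖p‖ → 2 * M + m < K i ξ p) (i : Fin 2) (x y : E n) :
    |w i x - w i y| ≤ Λ * ‖x - y‖ := by
  obtain ⟨j, hij⟩ := exists_ne i
  refine lipschitz_of_touching (hc i) (hB i) hΛ (fun φ η p hφ hp hmax => ?_) x y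
  have h1 := (hw i j hij.symm).le hφ hp hmax
  have h2 := abs_le.1 (abs_sub_le_of_discountSub hw hc hB hM hm hij.symm η)
  have h3 := abs_le.1 (hM i η)
  by_contra! hcon
  have h4 := hK i η p hcon
  linarith

/-- The upper envelope of a family of subsolutions is a subsolution. -/
theorem discountSub_of_sup {lam : ℝ} (hlam : 0 ≤ lam) {K : Fin 2 → E n → E n → ℝ}
    (hK : ∀ i, Continuous (fun z : E n × E n => K i z.1 z.2)) {S : Set (Fin 2 → E n → ℝ)}
    {v : Fin 2 → E n → ℝ} (hv : ∀ i, Continuous (v i)) (hSc : ∀ w ∈ S, ∀ i, Continuous (w i))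
    (hS : ∀ w ∈ S, IsDiscountSub lam K w) (hle : ∀ w ∈ S, ∀ i ξ, w i ξ ≤ v i ξ)
    (happ : ∀ i ξ δ, 0 < δ → ∃ w ∈ S, v i ξ - δ ≤ w i ξ) : IsDiscountSub lam K v := by
  intro i j hij φ ξ₀ hφ hmax
  by_contra! hcon
  have hcont : Continuous (fun z : (E n × E n) × ℝ =>
      K i z.1.1 z.1.2 + (lam + 1) * z.2 - v j z.1.1) :=
    (((hK i).comp continuous_fst).add (continuous_const.mul continuous_snd)).sub
      ((hv j).comp (continuous_fst.comp continuous_fst))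
  have hpos : 0 < K i ξ₀ (gradient φ ξ₀) + (lam + 1) * v i ξ₀ - v j ξ₀ := by
    linarith
  obtain ⟨r₀, hr₀, hball⟩ := Metric.eventually_nhds_iff_ball.1
    (hcont.continuousAt.eventually (lt_mem_nhds (a := 0)
      (b := (fun z : (E n × E n) × ℝ => K i z.1.1 z.1.2 + (lam + 1) * z.2 - v j z.1.1)
        ((ξ₀, gradient φ ξ₀), v i ξ₀)) hpos))
  obtain ⟨ε, hε, ρ, hρ, h⟩ := exists_touching_nearby hφ hmax (half_pos hr₀)
  obtain ⟨w, hwS, hw⟩ := happ i ξ₀ ε hε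
  obtain ⟨ξ, ψ, p, hψ, hp, hm, h1, h2, h3⟩ := h (w i) (hSc w hwS i) hw
    (fun η _ => (hle w hwS i η).trans (by linarith))
  have h4 := (hS w hwS i j hij).le hψ hp hm
  have h5 := hball ((ξ, p), v i ξ₀ - r₀ / 2) (by
    rw [Metric.mem_ball, Prod.dist_eq, Prod.dist_eq, dist_eq_norm, dist_eq_norm, Real.dist_eq]
    refine max_lt (max_lt ?_ ?_) ?_
    · simpa using h1.trans (by linarith)
    · simpa using h2.trans (by linarith)
    · simp only [sub_sub_cancel_left, abs_neg]
      rw [abs_of_pos (by linarith)]; linarith)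
  -- The coupling is monotone: replacing `w j` by the larger `v j` only lowers the left side of the
  -- equation for component `i`.
  have h6 := hle w hwS j ξ
  simp only at h4 h5
  nlinarith

theorem discountSub_max {lam : ℝ} (hlam : 0 ≤ lam) {K : Fin 2 → E n → E n → ℝ}
    (hK : ∀ i, Continuous (fun z : E n × E n => K i z.1 z.2)) {w w' : Fin 2 → E n → ℝ}
    (hc : ∀ i, Continuous (w i)) (hc' : ∀ i, Continuous (w' i)) (hw : IsDiscountSub lam K w)
    (hw' : IsDiscountSub lam K w') : IsDiscountSub lam K (fun i ξ => max (w i ξ) (w' i ξ)) := by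
  refine discountSub_of_sup hlam hK (S := {w, w'}) (fun i => (hc i).max (hc' i)) ?_ ?_ ?_ ?_
  · rintro _ (rfl | rfl) <;> assumption
  · rintro _ (rfl | rfl) <;> assumption
  · rintro _ (rfl | rfl) i ξ
    · exact le_max_left _ _
    · exact le_max_right _ _
  · intro i ξ δ hδ
    rcases le_total (w i ξ) (w' i ξ) with h | h
    · exact ⟨w', by simp, by simp only [max_eq_right h]; linarith⟩
    · exact ⟨w, by simp, by simp only [max_eq_left h]; linarith⟩

theorem discountSub_sub_const {lam : ℝ} (hlam : 0 < lam) {K K' : Fin 2 → E n → E n → ℝ} {D : ℝ}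
    (hD : ∀ i ξ p, K' i ξ p ≤ K i ξ p + D) {w : Fin 2 → E n → ℝ} (hw : IsDiscountSub lam K w) :
    IsDiscountSub lam K' (fun i ξ => w i ξ - D / lam) := by
  intro i j hij φ ξ hφ hmax
  have h := hw i j hij φ ξ hφ (by
    have := hmax.add (isLocalMax_const (b := D / lam))
    refine this.congr (Eventually.of_forall fun y => ?_)
    simp only; ring)
  have h1 := hD i ξ (gradient φ ξ)
  have h2 : lam * (D / lam) = D := by field_simp
  simp only at h ⊢
  rw [mul_sub, h2]
  linarith

theorem discountSub_const {lam : ℝ} (hlam : 0 < lam) {K : Fin 2 → E n → E n → ℝ} {M : ℝ}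
    (hM : ∀ i ξ, K i ξ 0 ≤ M) : IsDiscountSub lam K (fun _ _ => -(M / lam)) := by
  intro i j _ φ ξ hφ hmax
  have h0 : gradient φ ξ = 0 := by
    have := gradient_eq_zero_of_isLocalMax hmax
      (hasGradientAt_sub (hasGradientAt_const ξ (-(M / lam))) (hasGradientAt_of_contDiffAt hφ))
    simpa using this
  have h2 : lam * (M / lam) = M := by field_simp
  have := hM i ξ
  rw [h0]
  simp only [mul_neg, h2]
  linarith

theorem discountSub_translate {lam : ℝ} {K : Fin 2 → E n → E n → ℝ} {a : E n}
    (hK : ∀ i ξ p, K i (ξ + a) p = K i ξ p) {w : Fin 2 → E n → ℝ} (hw : IsDiscountSub lam K w) :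
    IsDiscountSub lam K (fun i ξ => w i (ξ + a)) := by
  intro i j hij φ ξ hφ hmax
  have hsub : ContDiffAt ℝ 1 (fun η : E n => η - a) (ξ + a) := by fun_prop
  have hφ' : ContDiffAt ℝ 1 (fun η => φ (η - a)) (ξ + a) :=
    ContDiffAt.comp (g := φ) (ξ + a) (by simpa using hφ) hsub
  have hg : HasGradientAt (fun η => φ (η - a)) (gradient φ ξ) (ξ + a) := by
    rw [hasGradientAt_iff_innerSL]
    have h1 : HasFDerivAt φ (innerSL ℝ (gradient φ ξ)) (ξ + a - a) := by
      rw [add_sub_cancel_right, ← hasGradientAt_iff_innerSL]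
      exact hasGradientAt_of_contDiffAt hφ
    exact h1.comp (ξ + a) ((hasFDerivAt_id (ξ + a)).sub_const a)
  have hm : IsLocalMax (fun η => w i η - φ (η - a)) (ξ + a) := by
    have ht : Tendsto (fun η : E n => η - a) (𝓝 (ξ + a)) (𝓝 ξ) := by
      have : Continuous (fun η : E n => η - a) := by fun_prop
      simpa using this.tendsto (ξ + a)
    have := ht.eventually hmax
    filter_upwards [this] with η hη
    simpa using hη
  have := (hw i j hij).le hφ' hg hm
  simpa [hK] using this

end Discount

/-! ### Perron's method -/

section Perron

variable {n : ℕ}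

/-- The continuous subsolutions `w` with `|λ w| ≤ M`. -/
def perronClass (lam : ℝ) (K : Fin 2 → E n → E n → ℝ) (M : ℝ) : Set (Fin 2 → E n → ℝ) :=
  {w | (∀ i, Continuous (w i)) ∧ (∀ i ξ, |lam * w i ξ| ≤ M) ∧ IsDiscountSub lam K w}

/-- The largest subsolution `w` with `|λ w| ≤ M`. -/
noncomputable def perron (lam : ℝ) (K : Fin 2 → E n → E n → ℝ) (M : ℝ) (i : Fin 2) (ξ : E n) : ℝ :=
  sSup ((fun w : Fin 2 → E n → ℝ => w i ξ) '' perronClass lam K M)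

variable {lam : ℝ} {K : Fin 2 → E n → E n → ℝ} {M : ℝ}

theorem abs_le_of_mem_perronClass (hlam : 0 < lam) {w : Fin 2 → E n → ℝ}
    (hw : w ∈ perronClass lam K M) (i : Fin 2) (ξ : E n) : |w i ξ| ≤ M / lam := by
  have := hw.2.1 i ξ
  rw [abs_mul, abs_of_pos hlam] at this
  rw [le_div_iff₀ hlam]
  linarith

theorem const_mem_perronClass (hlam : 0 < lam) (hM0 : 0 ≤ M) (hM : ∀ i ξ, K i ξ 0 ≤ M) :
    (fun _ _ => -(M / lam)) ∈ perronClass lam K M := by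
  refine ⟨fun _ => continuous_const, fun i ξ => ?_, discountSub_const hlam hM⟩
  have h2 : lam * (M / lam) = M := by field_simp
  rw [mul_neg, h2, abs_neg, abs_of_nonneg hM0]

theorem le_perron (hlam : 0 < lam) {w : Fin 2 → E n → ℝ} (hw : w ∈ perronClass lam K M)
    (i : Fin 2) (ξ : E n) : w i ξ ≤ perron lam K M i ξ := by
  refine le_csSup ⟨M / lam, ?_⟩ ⟨w, hw, rfl⟩
  rintro _ ⟨w', hw', rfl⟩
  exact (abs_le.1 (abs_le_of_mem_perronClass hlam hw' i ξ)).2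

theorem exists_lt_of_lt_perron (hlam : 0 < lam) (hM0 : 0 ≤ M) (hM : ∀ i ξ, K i ξ 0 ≤ M)
    (i : Fin 2) (ξ : E n) {δ : ℝ} (hδ : 0 < δ) :
    ∃ w ∈ perronClass lam K M, perron lam K M i ξ - δ < w i ξ := by
  obtain ⟨_, ⟨w, hw, rfl⟩, h⟩ := exists_lt_of_lt_csSup
    (⟨_, mem_image_of_mem _ (const_mem_perronClass hlam hM0 hM)⟩ :
      ((fun w : Fin 2 → E n → ℝ => w i ξ) '' perronClass lam K M).Nonempty)
    (sub_lt_self (perron lam K M i ξ) hδ)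
  exact ⟨w, hw, h⟩

theorem abs_lam_mul_perron_le (hlam : 0 < lam) (hM0 : 0 ≤ M) (hM : ∀ i ξ, K i ξ 0 ≤ M)
    (i : Fin 2) (ξ : E n) : |lam * perron lam K M i ξ| ≤ M := by
  have h2 : lam * (M / lam) = M := by field_simp
  rw [abs_le]
  constructor
  · have := le_perron hlam (const_mem_perronClass hlam hM0 hM) i ξ
    have := mul_le_mul_of_nonneg_left this hlam.le
    linarith
  · have : perron lam K M i ξ ≤ M / lam := by
      refine csSup_le ⟨_, mem_image_of_mem _ (const_mem_perronClass hlam hM0 hM)⟩ ?_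
      rintro _ ⟨w', hw', rfl⟩
      exact (abs_le.1 (abs_le_of_mem_perronClass hlam hw' i ξ)).2
    have := mul_le_mul_of_nonneg_left this hlam.le
    linarith

/-- All members of the class have the same Lipschitz constant, and a supremum inherits it. Hence no
semicontinuous envelopes are needed. -/
theorem perron_lipschitz (hlam : 0 < lam) (hM0 : 0 ≤ M) (hM : ∀ i ξ, K i ξ 0 ≤ M) {m Λ : ℝ}
    (hΛ : 0 ≤ Λ) (hm : ∀ i ξ p, -m ≤ K i ξ p) (hK : ∀ i ξ p, Λ < ‖p‖ → 2 * M + m < K i ξ p)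
    (i : Fin 2) (x y : E n) : |perron lam K M i x - perron lam K M i y| ≤ Λ * ‖x - y‖ := by
  have key : ∀ x y, perron lam K M i x - perron lam K M i y ≤ Λ * ‖x - y‖ := by
    intro x y
    refine le_of_forall_pos_le_add fun δ hδ => ?_
    obtain ⟨w, hw, h⟩ := exists_lt_of_lt_perron hlam hM0 hM i x hδ
    have h1 := lipschitz_of_discountSub hw.2.2 hw.1 (abs_le_of_mem_perronClass hlam hw) hΛ
      hw.2.1 hm hK i x y
    have h2 := le_perron hlam hw i y
    linarith [abs_le.1 h1]
  have h1 := key x y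
  have h2 := key y x
  rw [norm_sub_rev] at h2
  rw [abs_le]
  constructor <;> linarith

theorem continuous_of_lipschitz {v : E n → ℝ} {Λ : ℝ}
    (h : ∀ x y, |v x - v y| ≤ Λ * ‖x - y‖) : Continuous v := by
  have : LipschitzWith (Real.toNNReal Λ) v := LipschitzWith.of_dist_le_mul fun x y => by
    rw [Real.dist_eq, dist_eq_norm]
    exact (h x y).trans (mul_le_mul_of_nonneg_right (Real.le_coe_toNNReal Λ) (norm_nonneg _))
  exact this.continuous

theorem perron_sub (hlam : 0 < lam) (hM0 : 0 ≤ M) (hM : ∀ i ξ, K i ξ 0 ≤ M)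
    (hKc : ∀ i, Continuous (fun z : E n × E n => K i z.1 z.2))
    (hc : ∀ i, Continuous (perron lam K M i)) : IsDiscountSub lam K (perron lam K M) :=
  discountSub_of_sup hlam.le hKc hc (fun _ hw => hw.1) (fun _ hw => hw.2.2)
    (fun _ hw => le_perron hlam hw) fun i ξ _ hδ =>
      let ⟨w, hw, h⟩ := exists_lt_of_lt_perron hlam hM0 hM i ξ hδ
      ⟨w, hw, h.le⟩

theorem perron_periodic (hlam : 0 < lam) (hM0 : 0 ≤ M) (hM : ∀ i ξ, K i ξ 0 ≤ M)
    (hp : ∀ i, PeriodicHamiltonian (K i)) (i : Fin 2) (ξ : E n) (z : Fin n → ℤ) :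
    perron lam K M i (ξ + intVec z) = perron lam K M i ξ := by
  have htr : ∀ (z : Fin n → ℤ), ∀ w ∈ perronClass lam K M,
      (fun i ξ => w i (ξ + intVec z)) ∈ perronClass lam K M := fun z w hw =>
    ⟨fun i => (hw.1 i).comp (by fun_prop), fun i ξ => hw.2.1 i _,
      discountSub_translate (fun i ξ p => hp i ξ p z) hw.2.2⟩
  have key : ∀ (z : Fin n → ℤ) ξ, perron lam K M i (ξ + intVec z) ≤ perron lam K M i ξ := by
    intro z ξ
    refine le_of_forall_pos_le_add fun δ hδ => ?_
    obtain ⟨w, hw, h⟩ := exists_lt_of_lt_perron hlam hM0 hM i (ξ + intVec z) hδ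
    have := le_perron hlam (htr z w hw) i ξ
    linarith
  refine le_antisymm (key z ξ) ?_
  have h := key (-z) (ξ + intVec z)
  have e : ξ + intVec z + intVec (-z) = ξ := by
    have : intVec z + intVec (-z) = 0 := by
      ext k; simp [intVec]
    rw [add_assoc, this, add_zero]
  rwa [e] at h

/-- A subsolution for `K` lowered by `D / λ` is one for `K'`. It may leave the class from below, so
it is replaced by its maximum with the constant subsolution `-M/λ`. -/
theorem perron_le_add {K' : Fin 2 → E n → E n → ℝ} (hlam : 0 < lam) (hM0 : 0 ≤ M)
    (hM : ∀ i ξ, K i ξ 0 ≤ M) (hM' : ∀ i ξ, K' i ξ 0 ≤ M)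
    (hKc' : ∀ i, Continuous (fun z : E n × E n => K' i z.1 z.2)) {D : ℝ} (hD0 : 0 ≤ D)
    (hD : ∀ i ξ p, K' i ξ p ≤ K i ξ p + D) (i : Fin 2) (ξ : E n) :
    perron lam K M i ξ ≤ perron lam K' M i ξ + D / lam := by
  refine le_of_forall_pos_le_add fun δ hδ => ?_
  obtain ⟨w, hw, h⟩ := exists_lt_of_lt_perron hlam hM0 hM i ξ hδ
  have hmem : (fun i ξ => max (w i ξ - D / lam) (-(M / lam))) ∈ perronClass lam K' M := by
    refine ⟨fun i => ((hw.1 i).sub continuous_const).max continuous_const, fun i ξ => ?_,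
      discountSub_max hlam.le hKc' (fun i => (hw.1 i).sub continuous_const)
        (fun _ => continuous_const) (discountSub_sub_const hlam hD hw.2.2)
        (discountSub_const hlam hM')⟩
    have h1 := abs_le.1 (abs_le_of_mem_perronClass hlam hw i ξ)
    have h2 : 0 ≤ D / lam := by positivity
    have h3 : 0 ≤ M / lam := by positivity
    rw [abs_mul, abs_of_pos hlam, mul_comm, ← le_div_iff₀ hlam, abs_le]
    exact ⟨le_max_right _ _, max_le (by linarith) (by linarith)⟩
  have h1 := le_perron hlam hmem i ξ
  have h2 := le_max_left (w i ξ - D / lam) (-(M / lam))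
  linarith

/-- If the supersolution inequality failed at `ξ₀`, component `i` could be raised near `ξ₀` by a
small bump and still be a subsolution in the class, against maximality. -/
theorem perron_super (hlam : 0 < lam) (hM0 : 0 ≤ M) (hM : ∀ i ξ, |K i ξ 0| ≤ M)
    (hKc : ∀ i, Continuous (fun z : E n × E n => K i z.1 z.2))
    (hc : ∀ i, Continuous (perron lam K M i)) : IsDiscountSuper lam K (perron lam K M) := by
  have hM1 : ∀ i ξ, K i ξ 0 ≤ M := fun i ξ => (abs_le.1 (hM i ξ)).2
  set v := perron lam K M with hv
  have hvM : ∀ i ξ, |lam * v i ξ| ≤ M := abs_lam_mul_perron_le hlam hM0 hM1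
  have hvsub : IsDiscountSub lam K v := perron_sub hlam hM0 hM1 hKc hc
  intro i j hij φ ξ₀ hφ hmin
  by_contra! hcon
  -- The bump must not violate `λ w ≤ M`. If equality held, `v i ξ₀` would be the maximum of both
  -- components, so the test gradient would vanish, and `K i ξ₀ 0 ≥ -M` would give the supersolution
  -- inequality after all.
  have hlt : lam * v i ξ₀ < M := by
    refine lt_of_le_of_ne (abs_le.1 (hvM i ξ₀)).2 fun heq => ?_
    have hle : ∀ k ξ, v k ξ ≤ v i ξ₀ := fun k ξ => by
      have := (abs_le.1 (hvM k ξ)).2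
      rw [← heq] at this
      exact le_of_mul_le_mul_left this hlam
    have hmax : IsLocalMax φ ξ₀ := by
      filter_upwards [hmin] with η hη
      have := hle i η
      linarith
    have h0 := gradient_eq_zero_of_isLocalMax hmax (hasGradientAt_of_contDiffAt hφ)
    rw [h0] at hcon
    have h1 := (abs_le.1 (hM i ξ₀)).1
    have h2 := hle j ξ₀
    linarith
  set c₀ := v i ξ₀ - φ ξ₀ with hc₀
  have hG : ContinuousAt (fun z : E n × ℝ =>
      K i z.1 (gradient φ z.1 - (2 : ℝ) • (z.1 - ξ₀)) + (lam + 1) * (φ z.1 + c₀ + z.2)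
        - v j z.1) (ξ₀, 0) := by
    have h1 : ContinuousAt (fun z : E n × ℝ => gradient φ z.1) (ξ₀, 0) :=
      ContinuousAt.comp (g := gradient φ) (continuousAt_gradient hφ) continuousAt_fst
    have h2 : ContinuousAt (fun z : E n × ℝ => φ z.1) (ξ₀, 0) :=
      ContinuousAt.comp (g := φ) hφ.continuousAt continuousAt_fst
    have h3 : ContinuousAt (fun z : E n × ℝ => v j z.1) (ξ₀, 0) :=
      ((hc j).comp continuous_fst).continuousAt
    have h4 : ContinuousAt (fun z : E n × ℝ =>
        (z.1, gradient φ z.1 - (2 : ℝ) • (z.1 - ξ₀))) (ξ₀, 0) :=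
      continuousAt_fst.prodMk (h1.sub (by fun_prop))
    have h5 := ContinuousAt.comp (g := fun z : E n × E n => K i z.1 z.2)
      (hKc i).continuousAt h4
    exact (h5.add (continuousAt_const.mul ((h2.add continuousAt_const).add
      continuousAt_snd))).sub h3
  have hGneg : ∀ᶠ z : E n × ℝ in 𝓝 (ξ₀, 0),
      K i z.1 (gradient φ z.1 - (2 : ℝ) • (z.1 - ξ₀)) + (lam + 1) * (φ z.1 + c₀ + z.2)
        - v j z.1 < 0 := by
    refine hG.eventually (gt_mem_nhds ?_)
    simp only [sub_self, smul_zero, sub_zero, add_zero, hc₀]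
    linarith
  have hMlt : ∀ᶠ z : E n × ℝ in 𝓝 (ξ₀, 0), lam * (φ z.1 + c₀ + z.2) < M := by
    have h2 : ContinuousAt (fun z : E n × ℝ => φ z.1) (ξ₀, 0) :=
      ContinuousAt.comp (g := φ) hφ.continuousAt continuousAt_fst
    have h3 : ContinuousAt (fun z : E n × ℝ => lam * (φ z.1 + c₀ + z.2)) (ξ₀, 0) :=
      continuousAt_const.mul ((h2.add continuousAt_const).add continuousAt_snd)
    refine h3.eventually (gt_mem_nhds ?_)
    simpa [hc₀] using hlt
  have hfst : ∀ᶠ z : E n × ℝ in 𝓝 (ξ₀, 0),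
      ContDiffAt ℝ 1 φ z.1 ∧ φ z.1 + c₀ ≤ v i z.1 := by
    have : ∀ᶠ ξ in 𝓝 ξ₀, ContDiffAt ℝ 1 φ ξ ∧ φ ξ + c₀ ≤ v i ξ := by
      filter_upwards [hφ.eventually (by simp), hmin] with ξ h1 h2
      exact ⟨h1, by linarith⟩
    exact (continuous_fst.tendsto (ξ₀, (0 : ℝ))).eventually this
  obtain ⟨r, hr, hball⟩ := Metric.eventually_nhds_iff_ball.1 (hGneg.and (hMlt.and hfst))
  -- With `δ ≤ (r/2)²` the bump is not above `v i` outside the ball of radius `r / 2`, so the two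
  -- definitions of `b` agree on an annulus.
  set δ := min ((r / 2) ^ 2) (r / 2) with hδdef
  have hδ : 0 < δ := by positivity
  have hδr : δ < r := (min_le_right _ _).trans_lt (by linarith)
  have hfacts : ∀ ξ, ‖ξ - ξ₀‖ < r →
      (K i ξ (gradient φ ξ - (2 : ℝ) • (ξ - ξ₀)) + (lam + 1) * (φ ξ + c₀ + δ) - v j ξ < 0) ∧
      lam * (φ ξ + c₀ + δ) < M ∧ ContDiffAt ℝ 1 φ ξ ∧ φ ξ + c₀ ≤ v i ξ := fun ξ hξ =>
    hball (ξ, δ) (by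
      rw [Metric.mem_ball, Prod.dist_eq, dist_eq_norm, Real.dist_eq]
      refine max_lt hξ ?_
      simp only [sub_zero]
      rwa [abs_of_pos hδ])
  set Ψ : E n → ℝ := fun ξ => φ ξ + c₀ + δ - ‖ξ - ξ₀‖ ^ 2 with hΨ
  set b : E n → ℝ := fun ξ => if ‖ξ - ξ₀‖ < r then max (v i ξ) (Ψ ξ) else v i ξ with hb
  have hvb : ∀ ξ, v i ξ ≤ b ξ := fun ξ => by
    simp only [hb]; split_ifs
    · exact le_max_left _ _
    · exact le_rfl
  have hbfar : ∀ ξ, r / 2 ≤ ‖ξ - ξ₀‖ → b ξ = v i ξ := fun ξ hξ => by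
    simp only [hb]; split_ifs with h
    · refine max_eq_left ?_
      have h1 := (hfacts ξ h).2.2.2
      have h2 : δ ≤ (r / 2) ^ 2 := min_le_left _ _
      have h3 : (r / 2) ^ 2 ≤ ‖ξ - ξ₀‖ ^ 2 := by gcongr
      simp only [hΨ]; linarith
    · rfl
  have hopen : IsOpen {ξ : E n | ‖ξ - ξ₀‖ < r} := isOpen_lt (by fun_prop) continuous_const
  have hbcont : Continuous b := by
    rw [continuous_iff_continuousAt]
    intro ξ
    by_cases h : ‖ξ - ξ₀‖ < r
    · have hΨc : ContinuousAt Ψ ξ :=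
        (((hfacts ξ h).2.2.1.continuousAt.add continuousAt_const).add continuousAt_const).sub
          (by fun_prop)
      refine ContinuousAt.congr (f := fun η => max (v i η) (Ψ η))
        (Tendsto.max (hc i).continuousAt hΨc) ?_
      filter_upwards [hopen.mem_nhds h] with η hη
      simp only [hb]
      rw [if_pos hη]
    · have hopen' : IsOpen {ξ : E n | r / 2 < ‖ξ - ξ₀‖} :=
        isOpen_lt continuous_const (by fun_prop)
      refine ((hc i).continuousAt (x := ξ)).congr ?_
      filter_upwards [hopen'.mem_nhds (show r / 2 < ‖ξ - ξ₀‖ by linarith)] with η hη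
      exact (hbfar η (le_of_lt hη)).symm
  have hbcase : ∀ ξ, b ξ = v i ξ ∨ (‖ξ - ξ₀‖ < r ∧ b ξ = Ψ ξ) := fun ξ => by
    by_cases h : ‖ξ - ξ₀‖ < r
    · rcases le_total (Ψ ξ) (v i ξ) with h1 | h1
      · left; simp only [hb]; rw [if_pos h, max_eq_left h1]
      · right; refine ⟨h, ?_⟩; simp only [hb]; rw [if_pos h, max_eq_right h1]
    · left; simp only [hb]; rw [if_neg h]
  set w : Fin 2 → E n → ℝ := Function.update v i b with hw
  have hwi : w i = b := by simp [hw]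
  have hwk : ∀ k, k ≠ i → w k = v k := fun k hk => by simp [hw, hk]
  have hvw : ∀ k ξ, v k ξ ≤ w k ξ := fun k ξ => by
    by_cases hk : k = i
    · subst hk; rw [hwi]; exact hvb ξ
    · rw [hwk k hk]
  have hmem : w ∈ perronClass lam K M := by
    refine ⟨fun k => ?_, fun k ξ => ?_, fun k l hkl => ?_⟩
    · by_cases hk : k = i
      · subst hk; rw [hwi]; exact hbcont
      · rw [hwk k hk]; exact hc k
    · by_cases hk : k = i
      · subst hk
        rw [hwi]
        rcases hbcase ξ with h | ⟨h, h'⟩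
        · rw [h]; exact hvM k ξ
        · have h1 := (abs_le.1 (hvM k ξ)).1
          have h2 := mul_le_mul_of_nonneg_left (hvb ξ) hlam.le
          have h3 := (hfacts ξ h).2.1
          have h4 : Ψ ξ ≤ φ ξ + c₀ + δ := by
            simp only [hΨ]; nlinarith [sq_nonneg ‖ξ - ξ₀‖]
          have h5 := mul_le_mul_of_nonneg_left h4 hlam.le
          rw [abs_le]
          constructor
          · linarith
          · rw [h']; linarith
      · rw [hwk k hk]; exact hvM k ξ
    · intro χ ξ hχ hmax
      -- Wherever `w k = v k`, a test function for `w k` also tests `v k`, and raising the other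
      -- component only helps.
      have hcase : w k ξ = v k ξ → K k ξ (gradient χ ξ) + lam * w k ξ + (w k ξ - w l ξ) ≤ 0 := by
        intro heq
        have hm : IsLocalMax (fun η => v k η - χ η) ξ := by
          filter_upwards [hmax] with η hη
          have := hvw k η
          linarith
        have h1 := hvsub k l hkl χ ξ hχ hm
        have h2 := hvw l ξ
        simp only at h1
        rw [heq]; linarith
      by_cases hk : k = i
      · subst hk
        rcases hbcase ξ with h | ⟨h, h'⟩
        · exact hcase (by rw [hwi, h])
        · have hl : l = j := by omega
          subst hl
          have hf := hfacts ξ h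
          have hm : IsLocalMax (fun η => Ψ η - χ η) ξ := by
            filter_upwards [hmax, hopen.mem_nhds h] with η hη hηr
            rw [hwi, h'] at hη
            have : Ψ η ≤ b η := by
              simp only [hb]; rw [if_pos hηr]; exact le_max_right _ _
            linarith
          have hgΨ : HasGradientAt Ψ (gradient φ ξ - (2 : ℝ) • (ξ - ξ₀)) ξ := by
            have h1 := hasGradientAt_add (hasGradientAt_add
              (hasGradientAt_of_contDiffAt hf.2.2.1) (hasGradientAt_const ξ c₀))
              (hasGradientAt_const ξ δ)
            simp only [add_zero] at h1
            exact hasGradientAt_sub h1 (hasGradientAt_norm_sub_sq ξ₀ ξ)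
          have h0 := gradient_eq_zero_of_isLocalMax hm
            (hasGradientAt_sub hgΨ (hasGradientAt_of_contDiffAt hχ))
          rw [← sub_eq_zero.1 h0, hwi, hwk l hkl.symm]
          simp only
          rw [h']
          have h4 : Ψ ξ ≤ φ ξ + c₀ + δ := by
            simp only [hΨ]; nlinarith [sq_nonneg ‖ξ - ξ₀‖]
          have h5 := mul_le_mul_of_nonneg_left h4 hlam.le
          have h6 := hf.1
          linarith
      · exact hcase (by rw [hwk k hk])
  have h1 := le_perron hlam hmem i ξ₀
  rw [hwi] at h1
  have h2 : Ψ ξ₀ ≤ b ξ₀ := by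
    simp only [hb]; rw [if_pos (by simpa using hr)]; exact le_max_right _ _
  simp only [hΨ, hc₀, sub_self, norm_zero] at h2
  have : perron lam K M i ξ₀ = v i ξ₀ := rfl
  linarith

end Perron

/-! ### The cell problem -/

section Cell

variable {n : ℕ}

theorem le_of_sq_div_le {d γ Λ : ℝ} (hd : 0 ≤ d) (hγ : 0 < γ) (hΛ : 0 ≤ Λ)
    (h : d ^ 2 / (2 * γ) ≤ Λ * d) : d ≤ 2 * γ * Λ := by
  rcases hd.eq_or_lt with rfl | hd
  · positivity
  · rw [div_le_iff₀ (by positivity)] at h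
    have : d * d ≤ (2 * γ * Λ) * d := by nlinarith
    exact le_of_mul_le_mul_right this hd

/-- Comparison of the constants of periodic sub- and supersolutions of the cell problem. -/
theorem ergodic_le {K : Fin 2 → E n → E n → ℝ} (hUC : ∀ i, UniformContInX (K i))
    {a b : Fin 2 → E n → ℝ} (hac : ∀ i, Continuous (a i)) (hbc : ∀ i, Continuous (b i))
    (hap : ∀ i (ξ : E n) (z : Fin n → ℤ), a i (ξ + intVec z) = a i ξ)
    (hbp : ∀ i (ξ : E n) (z : Fin n → ℤ), b i (ξ + intVec z) = b i ξ)
    {Λ : ℝ} (hΛ : 0 ≤ Λ) (hLip : ∀ i x y, |a i x - a i y| ≤ Λ * ‖x - y‖) {c₁ c₂ : ℝ}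
    (hsub : ∀ i j, i ≠ j → IsViscSub (fun ξ p => K i ξ p + a i ξ - a j ξ - c₁) (a i))
    (hsup : ∀ i j, i ≠ j → IsViscSuper (fun ξ p => K i ξ p + b i ξ - b j ξ - c₂) (b i)) :
    c₂ ≤ c₁ := by
  by_contra! hlt
  -- The positive gap `c₂ - c₁` is the tolerance for the change of `K` between the doubled points.
  -- It plays the role of the missing discount term.
  choose δ' hδ' hUC' using fun i => hUC i (2 * Λ) (c₂ - c₁) (by linarith)
  obtain ⟨i₀, hi₀⟩ := Finite.exists_min δ'
  set δ := δ' i₀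
  have hδ : 0 < δ := hδ' i₀
  set γ := δ / (2 * (Λ + 1)) with hγdef
  have hγ : 0 < γ := by positivity
  have hγδ : 2 * γ * Λ < δ := by
    have : 2 * γ * (Λ + 1) = δ := by rw [hγdef]; field_simp
    nlinarith
  choose Ba hBa0 hBa using fun i => exists_bound_of_periodic_fun (hac i) (hap i)
  choose Bb hBb0 hBb using fun i => exists_bound_of_periodic_fun (hbc i) (hbp i)
  set B := Ba 0 + Ba 1 + Bb 0 + Bb 1 with hBdef
  have hB : ∀ i x y, |a i x - b i y| ≤ B := by
    intro i x y
    refine (abs_sub _ _).trans ?_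
    have h1 := hBa i x
    have h2 := hBb i y
    have := hBa0 0; have := hBa0 1; have := hBb0 0; have := hBb0 1
    fin_cases i <;> simp at h1 h2 ⊢ <;> linarith
  have hB0 : 0 ≤ B := (abs_nonneg _).trans (hB 0 0 0)
  set f : Fin 2 → E n × E n → ℝ := fun i z => a i z.1 - b i z.2 - ‖z.1 - z.2‖ ^ 2 / (2 * γ)
    with hf
  have hfc : ∀ i, Continuous (f i) := fun i =>
    (((hac i).comp continuous_fst).sub ((hbc i).comp continuous_snd)).sub (by fun_prop)
  obtain ⟨i, ⟨x, y⟩, hS, hmax₀⟩ := exists_family_max (f := f)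
    (S := Metric.closedBall (0 : E n) √n ×ˢ univ)
    (Metric.isClosed_closedBall.prod isClosed_univ) (fun i => (hfc i).continuousOn) (i₀ := 0)
    (x₀ := (0, 0)) ⟨by simp, mem_univ _⟩ (0, 0) (√n + √(2 * B * (2 * γ))) (by
      rintro i ⟨x, y⟩ ⟨hx, -⟩ hle
      simp only [hf, sub_self, norm_zero] at hle
      have h1 := abs_le.1 (hB 0 0 0)
      have h2 := abs_le.1 (hB i x y)
      have hx' : ‖x‖ ≤ √n := by simpa using hx
      have h3 : ‖x - y‖ ^ 2 / (2 * γ) ≤ 2 * B := by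
        norm_num at hle
        linarith
      have h4 : ‖x - y‖ ≤ √(2 * B * (2 * γ)) :=
        Real.le_sqrt_of_sq_le ((div_le_iff₀ (by positivity)).1 h3)
      rw [Prod.dist_eq]
      simp only [dist_zero_right]
      refine max_le (hx'.trans (by linarith [Real.sqrt_nonneg (2 * B * (2 * γ))])) ?_
      have : y = x - (x - y) := by abel
      rw [this]
      exact (norm_sub_le _ _).trans (by linarith))
  -- Only `x` was confined to a ball; translating both points by the same integer vector makes the
  -- maximum global.
  have hmax : ∀ j z, f j z ≤ f i (x, y) := by
    rintro j ⟨x', y'⟩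
    obtain ⟨z, hz⟩ := exists_norm_add_intVec_le x'
    have h1 := hmax₀ j (x' + intVec z, y' + intVec z) ⟨by simpa using hz, mem_univ _⟩
    simpa [hf, hap, hbp] using h1
  obtain ⟨j, hij⟩ := exists_ne i
  have hxy : ‖x - y‖ ≤ 2 * γ * Λ := by
    have h1 := hmax i (y, y)
    simp only [hf, sub_self, norm_zero] at h1
    norm_num at h1
    have h2 := abs_le.1 (hLip i x y)
    exact le_of_sq_div_le (norm_nonneg _) hγ hΛ (by linarith)
  have hs := (hsub i j hij.symm).le (contDiff_half_sq γ y).contDiffAt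
    (hasGradientAt_half_sq γ y x) (Eventually.of_forall fun x' => by
      have := hmax i (x', y)
      simp only [hf] at this ⊢
      linarith)
  have hp : HasGradientAt (fun y' => -(‖y' - x‖ ^ 2 / (2 * γ))) (γ⁻¹ • (x - y)) y := by
    have := hasGradientAt_neg (hasGradientAt_half_sq γ x y)
    rwa [← smul_neg, neg_sub] at this
  have hs' := (hsup i j hij.symm).le (contDiff_half_sq γ x).neg.contDiffAt hp
    (Eventually.of_forall fun y' => by
      have := hmax i (x, y')
      simp only [hf] at this ⊢
      rw [norm_sub_rev x y', norm_sub_rev x y] at this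
      linarith)
  have hpn : ‖γ⁻¹ • (x - y)‖ ≤ 2 * Λ := by
    rw [norm_smul, norm_inv, Real.norm_of_nonneg hγ.le, inv_mul_le_iff₀ hγ]
    linarith
  have hu := hUC' i x y _ hpn (hxy.trans_lt (hγδ.trans_le (hi₀ i)))
  have hj := hmax j (x, y)
  simp only [hf] at hj
  have := abs_lt.1 hu
  linarith

theorem uniformContInX_shift {H : E n → E n → ℝ} (hH : UniformContInX H) (P : E n) :
    UniformContInX (fun ξ p => H ξ (P + p)) := by
  intro R τ hτ
  obtain ⟨δ, hδ, h⟩ := hH (‖P‖ + R) τ hτ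
  exact ⟨δ, hδ, fun ξ η p hp hξη => h ξ η _ ((norm_add_le _ _).trans (by linarith)) hξη⟩

/-- The coupling is bounded by periodicity and continuity, so the equation bounds `H i ξ (P + p)` at
touching points, and coercivity then bounds `p`. -/
theorem IsCellSolution.exists_lipschitz {H : Fin 2 → E n → E n → ℝ}
    (hA1 : ∀ i, UniformlyCoercive (H i)) {P : E n} {c : ℝ} {v : Fin 2 → E n → ℝ}
    (hv : IsCellSolution H P c v) : ∃ Λ, 0 ≤ Λ ∧ ∀ i x y, |v i x - v i y| ≤ Λ * ‖x - y‖ := by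
  choose B hB0 hB using fun i => exists_bound_of_periodic_fun (hv.continuous i) (hv.periodic i)
  choose r hr using fun i => hA1 i (c + B 0 + B 1 + 1)
  refine ⟨max (r 0) (r 1) ⊔ 0 + ‖P‖, by positivity, fun i => ?_⟩
  obtain ⟨j, hij⟩ := exists_ne i
  refine lipschitz_of_touching (hv.continuous i) (hB i) (by positivity)
    fun φ ξ p hφ hp hmax => ?_
  have h1 := (hv.sub i j hij.symm).le hφ hp hmax
  by_contra! hcon
  have hri : r i ≤ max (r 0) (r 1) := by
    fin_cases i
    · exact le_max_left _ _
    · exact le_max_right _ _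
  have h2 : r i ≤ ‖P + p‖ := by
    have : ‖p‖ ≤ ‖P + p‖ + ‖P‖ := by
      have e : p = (P + p) - P := by abel
      calc ‖p‖ = ‖(P + p) - P‖ := by rw [← e]
        _ ≤ _ := norm_sub_le _ _
    have := le_max_left (max (r 0) (r 1)) 0
    linarith
  have h3 := hr i ξ _ h2
  have h4 := abs_le.1 (hB i ξ)
  have h5 := abs_le.1 (hB j ξ)
  have h6 : B i + B j = B 0 + B 1 := by
    fin_cases i <;> fin_cases j <;> simp_all [add_comm]
  linarith

/-- Pointwise convergence of equi-Lipschitz functions is locally uniform. -/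
theorem eventually_abs_sub_le_of_lipschitz {ι : Type*} {l : Filter ι} {a : ι → E n → ℝ}
    {a₀ : E n → ℝ} {Λ : ℝ} (hΛ : 0 ≤ Λ)
    (hL : ∀ᶠ k in l, ∀ x y, |a k x - a k y| ≤ Λ * ‖x - y‖)
    (hL₀ : ∀ x y, |a₀ x - a₀ y| ≤ Λ * ‖x - y‖)
    (h : ∀ x, Tendsto (fun k => a k x) l (𝓝 (a₀ x))) (ξ₀ : E n) (ρ : ℝ) {τ : ℝ} (hτ : 0 < τ) :
    ∀ᶠ k in l, ∀ ξ ∈ Metric.closedBall ξ₀ ρ, |a k ξ - a₀ ξ| ≤ τ := by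
  set s := τ / (3 * (Λ + 1)) with hs
  have hspos : 0 < s := by positivity
  have hsΛ : Λ * s ≤ τ / 3 := by
    have : (Λ + 1) * s = τ / 3 := by rw [hs]; field_simp
    nlinarith
  obtain ⟨t, htf, ht⟩ := Metric.totallyBounded_iff.1
    (isCompact_closedBall ξ₀ ρ).totallyBounded s hspos
  have hev : ∀ᶠ k in l, ∀ y ∈ t, |a k y - a₀ y| < τ / 3 := by
    rw [htf.eventually_all]
    intro y _
    have := (h y).eventually (Metric.ball_mem_nhds _ (show 0 < τ / 3 by positivity))
    filter_upwards [this] with k hk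
    simpa [Real.dist_eq] using hk
  filter_upwards [hL, hev] with k hk1 hk2 ξ hξ
  obtain ⟨y, hy, hξy⟩ := mem_iUnion₂.1 (ht hξ)
  rw [Metric.mem_ball, dist_eq_norm] at hξy
  have h1 := abs_le.1 (hk1 ξ y)
  have h2 := abs_le.1 (hL₀ ξ y)
  have h3 := abs_lt.1 (hk2 y hy)
  have h4 : Λ * ‖ξ - y‖ ≤ Λ * s := by gcongr
  rw [abs_le]
  constructor <;> linarith

/-- Stability of viscosity subsolutions under limits of equi-Lipschitz functions. -/
theorem viscSub_of_tendsto {ι : Type*} {l : Filter ι} [l.NeBot] {K : E n → E n → ℝ}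
    (hK : Continuous (fun z : E n × E n => K z.1 z.2)) {a g : ι → E n → ℝ} {a₀ g₀ : E n → ℝ}
    {Λ : ℝ} (hΛ : 0 ≤ Λ) (hL : ∀ᶠ k in l, ∀ x y, |a k x - a k y| ≤ Λ * ‖x - y‖)
    (hL₀ : ∀ x y, |a₀ x - a₀ y| ≤ Λ * ‖x - y‖)
    (hg : ∀ᶠ k in l, ∀ x y, |g k x - g k y| ≤ Λ * ‖x - y‖)
    (ha : ∀ x, Tendsto (fun k => a k x) l (𝓝 (a₀ x)))
    (hg₀ : ∀ x, Tendsto (fun k => g k x) l (𝓝 (g₀ x)))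
    (hsub : ∀ᶠ k in l, IsViscSub (fun ξ p => K ξ p + g k ξ) (a k)) :
    IsViscSub (fun ξ p => K ξ p + g₀ ξ) a₀ := by
  intro φ ξ₀ hφ hmax
  by_contra! hcon
  have hcont : Continuous (fun z : (E n × E n) × ℝ => K z.1.1 z.1.2 + z.2) :=
    (hK.comp continuous_fst).add continuous_snd
  obtain ⟨r₀, hr₀, hball⟩ := Metric.eventually_nhds_iff_ball.1
    (hcont.continuousAt.eventually (lt_mem_nhds (a := 0)
      (b := (fun z : (E n × E n) × ℝ => K z.1.1 z.1.2 + z.2)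
        ((ξ₀, gradient φ ξ₀), g₀ ξ₀)) hcon))
  set r := r₀ / (2 * (Λ + 1)) with hr
  have hrpos : 0 < r := by positivity
  have hr1 : (Λ + 1) * r = r₀ / 2 := by rw [hr]; field_simp
  have hrr : r ≤ r₀ / 2 := by nlinarith
  have hΛr : Λ * r ≤ r₀ / 2 := by nlinarith
  obtain ⟨ε, hε, ρ, hρ, h⟩ := exists_touching_nearby hφ hmax hrpos
  have e1 := eventually_abs_sub_le_of_lipschitz hΛ hL hL₀ ha ξ₀ ρ hε
  have e2 := (hg₀ ξ₀).eventually (Metric.ball_mem_nhds _ (half_pos hr₀))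
  obtain ⟨k, k1, k2, k3, k4, k5⟩ := (e1.and (e2.and (hL.and (hg.and hsub)))).exists
  obtain ⟨ξ, ψ, p, hψ, hp, hm, h1, h2, -⟩ := h (a k) (continuous_of_lipschitz k3)
    (by have := abs_le.1 (k1 ξ₀ (Metric.mem_closedBall_self hρ.le)); linarith)
    (fun η hη => by have := abs_le.1 (k1 η hη); linarith)
  have h4 := k5.le hψ hp hm
  have h5 := hball ((ξ, p), g k ξ) (by
    rw [Metric.mem_ball, Prod.dist_eq, Prod.dist_eq, dist_eq_norm, dist_eq_norm, Real.dist_eq]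
    refine max_lt (max_lt ?_ ?_) ?_
    · simpa using h1.trans_le (by linarith)
    · simpa using h2.trans_le (by linarith)
    · have j1 := k4 ξ ξ₀
      have j2 : |g k ξ₀ - g₀ ξ₀| < r₀ / 2 := by simpa [Real.dist_eq] using k2
      have j3 : Λ * ‖ξ - ξ₀‖ ≤ Λ * r := by gcongr
      have := abs_sub_le (g k ξ) (g k ξ₀) (g₀ ξ₀)
      simp only
      linarith)
  simp only at h4 h5
  linarith

theorem viscSuper_of_tendsto {ι : Type*} {l : Filter ι} [l.NeBot] {K : E n → E n → ℝ}
    (hK : Continuous (fun z : E n × E n => K z.1 z.2)) {a g : ι → E n → ℝ} {a₀ g₀ : E n → ℝ}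
    {Λ : ℝ} (hΛ : 0 ≤ Λ) (hL : ∀ᶠ k in l, ∀ x y, |a k x - a k y| ≤ Λ * ‖x - y‖)
    (hL₀ : ∀ x y, |a₀ x - a₀ y| ≤ Λ * ‖x - y‖)
    (hg : ∀ᶠ k in l, ∀ x y, |g k x - g k y| ≤ Λ * ‖x - y‖)
    (ha : ∀ x, Tendsto (fun k => a k x) l (𝓝 (a₀ x)))
    (hg₀ : ∀ x, Tendsto (fun k => g k x) l (𝓝 (g₀ x)))
    (hsup : ∀ᶠ k in l, IsViscSuper (fun ξ p => K ξ p + g k ξ) (a k)) :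
    IsViscSuper (fun ξ p => K ξ p + g₀ ξ) a₀ := by
  have hneg : ∀ s t : ℝ, |-s - -t| = |s - t| := fun s t => by
    rw [← abs_neg]; congr 1; ring
  have h := viscSub_of_tendsto (l := l) (K := fun ξ p => -K ξ (-p)) (a := fun k ξ => -a k ξ)
    (g := fun k ξ => -g k ξ) (a₀ := fun ξ => -a₀ ξ) (g₀ := fun ξ => -g₀ ξ)
    (hK.comp (continuous_fst.prodMk continuous_snd.neg)).neg hΛ
    (by simpa only [hneg] using hL) (by simpa only [hneg] using hL₀)
    (by simpa only [hneg] using hg) (fun x => (ha x).neg) (fun x => (hg₀ x).neg)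
    (hsup.mono fun k hk => by
      have := hk.neg
      simp only [neg_add] at this
      exact this)
  have := h.neg
  simpa only [neg_add, neg_neg] using this

end Cell

/-! ### Correctors and the effective Hamiltonian -/

section Effective

variable {n : ℕ}

/-- The largest solution of the discounted cell problem at `P`. -/
noncomputable def corrector (H : Fin 2 → E n → E n → ℝ) (M lam : ℝ) (i : Fin 2) (P ξ : E n) : ℝ :=
  perron lam (fun i ξ p => H i ξ (P + p)) M i ξ

/-- The constants in the a priori estimates for the cell problem at `‖P‖ ≤ A`. -/
structure CellBounds (H : Fin 2 → E n → E n → ℝ) (A M m Λ : ℝ) : Prop where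
  M_nonneg : 0 ≤ M
  m_nonneg : 0 ≤ m
  Λ_nonneg : 0 ≤ Λ
  abs_le : ∀ P, ‖P‖ ≤ A → ∀ i ξ, |H i ξ P| ≤ M
  lower : ∀ i ξ p, -m ≤ H i ξ p
  coercive : ∀ P, ‖P‖ ≤ A → ∀ i ξ p, Λ < ‖p‖ → 2 * M + m < H i ξ (P + p)

theorem exists_cellBounds {H : Fin 2 → E n → E n → ℝ}
    (hHc : ∀ i, Continuous (fun z : E n × E n => H i z.1 z.2))
    (hA1 : ∀ i, UniformlyCoercive (H i)) (hA2 : ∀ i, PeriodicHamiltonian (H i)) (A : ℝ) :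
    ∃ M m Λ, CellBounds H A M m Λ := by
  choose M hM0 hM using fun i => exists_bound_of_periodic (hHc i) (hA2 i) A
  choose r hr using fun i => hA1 i 0
  choose m hm0 hm using fun i => exists_bound_of_periodic (hHc i) (hA2 i) (r i)
  have hM1 : ∀ i, M i ≤ M 0 + M 1 := fun i => by
    have := hM0 0; have := hM0 1
    fin_cases i <;> simp <;> linarith
  have hm1 : ∀ i, m i ≤ m 0 + m 1 := fun i => by
    have := hm0 0; have := hm0 1
    fin_cases i <;> simp <;> linarith
  choose R hR using fun i => hA1 i (2 * (M 0 + M 1) + (m 0 + m 1) + 1)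
  have hR1 : ∀ i, R i ≤ |R 0| + |R 1| := fun i => by
    have := abs_nonneg (R 0); have := abs_nonneg (R 1)
    have := le_abs_self (R 0); have := le_abs_self (R 1)
    fin_cases i <;> simp <;> linarith
  refine ⟨M 0 + M 1, m 0 + m 1, |R 0| + |R 1| + |A|,
    add_nonneg (hM0 0).le (hM0 1).le, add_nonneg (hm0 0).le (hm0 1).le, by positivity,
    fun P hP i ξ => (hM i ξ P hP).trans (hM1 i), fun i ξ p => ?_, fun P hP i ξ p hp => ?_⟩
  · rcases le_total (r i) ‖p‖ with h | h
    · have := hr i ξ p h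
      have := (hm0 i).le.trans (hm1 i)
      linarith
    · have := (abs_le.1 (hm i ξ p h)).1
      have := hm1 i
      linarith
  · have h1 : ‖p‖ ≤ ‖P + p‖ + ‖P‖ := by
      have e : p = (P + p) - P := by abel
      calc ‖p‖ = ‖(P + p) - P‖ := by rw [← e]
        _ ≤ _ := norm_sub_le _ _
    have h2 := hR i ξ (P + p) (by linarith [hR1 i, le_abs_self A])
    linarith

variable {H : Fin 2 → E n → E n → ℝ} {A M m Λ lam : ℝ}

theorem continuous_shift (hHc : ∀ i, Continuous (fun z : E n × E n => H i z.1 z.2)) (P : E n)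
    (i : Fin 2) : Continuous (fun z : E n × E n => H i z.1 (P + z.2)) :=
  (hHc i).comp (continuous_fst.prodMk (continuous_const.add continuous_snd))

theorem CellBounds.abs_zero_le (hb : CellBounds H A M m Λ) {P : E n} (hP : ‖P‖ ≤ A) (i : Fin 2)
    (ξ : E n) : |H i ξ (P + 0)| ≤ M := by
  rw [add_zero]; exact hb.abs_le P hP i ξ

theorem corrector_lipschitz (hb : CellBounds H A M m Λ) (hlam : 0 < lam) {P : E n}
    (hP : ‖P‖ ≤ A) (i : Fin 2) (x y : E n) :
    |corrector H M lam i P x - corrector H M lam i P y| ≤ Λ * ‖x - y‖ :=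
  perron_lipschitz hlam hb.M_nonneg (fun i ξ => (abs_le.1 (hb.abs_zero_le hP i ξ)).2)
    hb.Λ_nonneg (fun i ξ p => hb.lower i ξ (P + p)) (hb.coercive P hP) i x y

theorem abs_lam_mul_corrector_le (hb : CellBounds H A M m Λ) (hlam : 0 < lam) {P : E n}
    (hP : ‖P‖ ≤ A) (i : Fin 2) (ξ : E n) : |lam * corrector H M lam i P ξ| ≤ M :=
  abs_lam_mul_perron_le hlam hb.M_nonneg (fun i ξ => (abs_le.1 (hb.abs_zero_le hP i ξ)).2) i ξ

theorem corrector_sub (hHc : ∀ i, Continuous (fun z : E n × E n => H i z.1 z.2))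
    (hb : CellBounds H A M m Λ) (hlam : 0 < lam) {P : E n} (hP : ‖P‖ ≤ A) :
    IsDiscountSub lam (fun i ξ p => H i ξ (P + p)) (fun i => corrector H M lam i P) :=
  perron_sub hlam hb.M_nonneg (fun i ξ => (abs_le.1 (hb.abs_zero_le hP i ξ)).2)
    (continuous_shift hHc P) (fun i => continuous_of_lipschitz (corrector_lipschitz hb hlam hP i))

theorem corrector_super (hHc : ∀ i, Continuous (fun z : E n × E n => H i z.1 z.2))
    (hb : CellBounds H A M m Λ) (hlam : 0 < lam) {P : E n} (hP : ‖P‖ ≤ A) :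
    IsDiscountSuper lam (fun i ξ p => H i ξ (P + p)) (fun i => corrector H M lam i P) :=
  perron_super hlam hb.M_nonneg (hb.abs_zero_le hP)
    (continuous_shift hHc P) (fun i => continuous_of_lipschitz (corrector_lipschitz hb hlam hP i))

theorem corrector_periodic (hA2 : ∀ i, PeriodicHamiltonian (H i)) (hb : CellBounds H A M m Λ)
    (hlam : 0 < lam) {P : E n} (hP : ‖P‖ ≤ A) (i : Fin 2) (ξ : E n) (z : Fin n → ℤ) :
    corrector H M lam i P (ξ + intVec z) = corrector H M lam i P ξ :=
  perron_periodic hlam hb.M_nonneg (fun i ξ => (abs_le.1 (hb.abs_zero_le hP i ξ)).2)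
    (fun i ξ p z => hA2 i ξ (P + p) z) i ξ z

/-- Changing `P` changes the Hamiltonian by at most `L ‖P - Q‖`, and `perron_le_add` divides this by
the discount. No such bound is available for solutions of the undiscounted problem. -/
theorem corrector_lipschitz_param (hHc : ∀ i, Continuous (fun z : E n × E n => H i z.1 z.2))
    {L : ℝ} (hL0 : 0 ≤ L) (hL : ∀ i (ξ p q : E n), |H i ξ p - H i ξ q| ≤ L * ‖p - q‖)
    (hb : CellBounds H A M m Λ) (hlam : 0 < lam) {P Q : E n} (hP : ‖P‖ ≤ A) (hQ : ‖Q‖ ≤ A)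
    (i : Fin 2) (ξ : E n) :
    |corrector H M lam i P ξ - corrector H M lam i Q ξ| ≤ L / lam * ‖P - Q‖ := by
  have key : ∀ P Q : E n, ‖P‖ ≤ A → ‖Q‖ ≤ A →
      corrector H M lam i P ξ - corrector H M lam i Q ξ ≤ L / lam * ‖P - Q‖ := by
    intro P Q hP hQ
    have := perron_le_add (K := fun i ξ p => H i ξ (P + p)) (K' := fun i ξ p => H i ξ (Q + p))
      (D := L * ‖P - Q‖) hlam hb.M_nonneg
      (fun i ξ => (abs_le.1 (hb.abs_zero_le hP i ξ)).2)
      (fun i ξ => (abs_le.1 (hb.abs_zero_le hQ i ξ)).2) (continuous_shift hHc Q) (by positivity)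
      (fun i ξ p => by
        have h := abs_le.1 (hL i ξ (P + p) (Q + p))
        rw [add_sub_add_right_eq_sub] at h
        linarith) i ξ
    have e : L * ‖P - Q‖ / lam = L / lam * ‖P - Q‖ := by ring
    unfold corrector
    linarith
  have h1 := key P Q hP hQ
  have h2 := key Q P hQ hP
  rw [norm_sub_rev] at h2
  rw [abs_le]
  constructor <;> linarith

theorem abs_corrector_sub_le (hHc : ∀ i, Continuous (fun z : E n × E n => H i z.1 z.2))
    (hb : CellBounds H A M m Λ) (hlam : 0 < lam) {P : E n} (hP : ‖P‖ ≤ A) (i k : Fin 2)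
    (ξ : E n) : |corrector H M lam i P ξ - corrector H M lam k P ξ| ≤ M + m := by
  rcases eq_or_ne i k with rfl | hik
  · simpa using add_nonneg hb.M_nonneg hb.m_nonneg
  · refine abs_sub_le_of_discountSub (corrector_sub hHc hb hlam hP)
      (fun i => continuous_of_lipschitz (corrector_lipschitz hb hlam hP i)) (B := M / lam)
      (fun i ξ => ?_) (abs_lam_mul_corrector_le hb hlam hP)
      (fun i ξ p => hb.lower i ξ (P + p)) hik ξ
    have := abs_lam_mul_corrector_le hb hlam hP i ξ
    rw [abs_mul, abs_of_pos hlam] at this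
    rw [le_div_iff₀ hlam]
    linarith

/-- Periodicity moves both points into the ball of radius `√n`. The Lipschitz bound covers the
change of point and `M + m` the change of component, so the bound does not involve `lam`. -/
theorem corrector_oscillation_le (hHc : ∀ i, Continuous (fun z : E n × E n => H i z.1 z.2))
    (hA2 : ∀ i, PeriodicHamiltonian (H i))
    (hb : CellBounds H A M m Λ) (hlam : 0 < lam) {P : E n} (hP : ‖P‖ ≤ A) (i k : Fin 2)
    (ξ η : E n) :
    |corrector H M lam i P ξ - corrector H M lam k P η| ≤ Λ * (2 * √n) + (M + m) := by
  obtain ⟨z, hz⟩ := exists_norm_add_intVec_le ξ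
  obtain ⟨z', hz'⟩ := exists_norm_add_intVec_le η
  rw [← corrector_periodic hA2 hb hlam hP i ξ z, ← corrector_periodic hA2 hb hlam hP k η z']
  have h1 := corrector_lipschitz hb hlam hP i (ξ + intVec z) (η + intVec z')
  have h2 := abs_corrector_sub_le hHc hb hlam hP i k (η + intVec z')
  have h3 : ‖(ξ + intVec z) - (η + intVec z')‖ ≤ 2 * √n :=
    (norm_sub_le _ _).trans (by linarith)
  have h4 := mul_le_mul_of_nonneg_left h3 hb.Λ_nonneg
  refine (abs_sub_le _ (corrector H M lam i P (η + intVec z')) _).trans ?_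
  linarith

theorem exists_tendsto_ultrafilter {ι : Type*} (l : Ultrafilter ι) {f : ι → ℝ} {B : ℝ}
    (h : ∀ᶠ k in (l : Filter ι), |f k| ≤ B) : ∃ x, Tendsto f l (𝓝 x) := by
  obtain ⟨x, -, hx⟩ := (isCompact_Icc (a := -B) (b := B)).ultrafilter_le_nhds (l.map f) (by
    rw [le_principal_iff]
    exact h.mono fun k hk => abs_le.1 hk)
  exact ⟨x, hx⟩

/-- Existence for the cell problem, by letting the discount tend to zero. -/
theorem exists_cellSolution (hHc : ∀ i, Continuous (fun z : E n × E n => H i z.1 z.2))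
    (hA1 : ∀ i, UniformlyCoercive (H i)) (hA2 : ∀ i, PeriodicHamiltonian (H i)) (P : E n) :
    ∃ (c : ℝ) (v : Fin 2 → E n → ℝ), IsCellSolution H P c v := by
  obtain ⟨M, m, Λ, hb⟩ := exists_cellBounds hHc hA1 hA2 ‖P‖
  have hP : ‖P‖ ≤ ‖P‖ := le_rfl
  -- Along an ultrafilter converging to `0⁺` every bounded family converges, so no subsequence has
  -- to be extracted. The equi-Lipschitz bounds make the convergence locally uniform.
  set l : Ultrafilter ℝ := Ultrafilter.of (𝓝[>] (0 : ℝ)) with hl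
  have hle : (l : Filter ℝ) ≤ 𝓝[>] (0 : ℝ) := Ultrafilter.of_le _
  have hpos : ∀ᶠ lam in (l : Filter ℝ), 0 < lam := hle self_mem_nhdsWithin
  have hone : ∀ᶠ lam in (l : Filter ℝ), lam < 1 :=
    hle (mem_nhdsWithin_of_mem_nhds (gt_mem_nhds one_pos))
  have hzero : Tendsto (fun lam : ℝ => lam) l (𝓝 0) := hle.trans nhdsWithin_le_nhds
  set D := Λ * (2 * √n) + (M + m) with hD
  set w : ℝ → Fin 2 → E n → ℝ := fun lam i ξ =>
    corrector H M lam i P ξ - corrector H M lam 0 P 0 with hw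
  have hwD : ∀ i ξ, ∀ᶠ lam in (l : Filter ℝ), |w lam i ξ| ≤ D := fun i ξ =>
    hpos.mono fun lam hlam => corrector_oscillation_le hHc hA2 hb hlam hP i 0 ξ 0
  choose v hv using fun i ξ => exists_tendsto_ultrafilter l (hwD i ξ)
  obtain ⟨c', hc'⟩ := exists_tendsto_ultrafilter l (f := fun lam => lam * corrector H M lam 0 P 0)
    (B := M) (hpos.mono fun lam hlam => abs_lam_mul_corrector_le hb hlam hP 0 0)
  -- Since `w` stays bounded, `λ` times the corrector has the same limit for every component and
  -- point; `-c'` is the constant of the cell problem.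
  have hlamv : ∀ i ξ, Tendsto (fun lam => lam * corrector H M lam i P ξ) l (𝓝 c') := by
    intro i ξ
    have h1 := (hzero.mul (hv i ξ)).add hc'
    simp only [zero_mul, zero_add] at h1
    refine h1.congr fun lam => ?_
    simp only [hw]; ring
  have hwL : ∀ i, ∀ᶠ lam in (l : Filter ℝ), ∀ x y, |w lam i x - w lam i y| ≤ Λ * ‖x - y‖ :=
    fun i => hpos.mono fun lam hlam x y => by
      simpa [hw] using corrector_lipschitz hb hlam hP i x y
  have hvL : ∀ i x y, |v i x - v i y| ≤ Λ * ‖x - y‖ := fun i x y =>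
    le_of_tendsto ((hv i x).sub (hv i y)).abs ((hwL i).mono fun lam h => h x y)
  have hΛ3 : 0 ≤ 3 * Λ := by linarith [hb.Λ_nonneg]
  have hmono : ∀ x y : E n, Λ * ‖x - y‖ ≤ 3 * Λ * ‖x - y‖ := fun x y => by
    have := mul_nonneg hb.Λ_nonneg (norm_nonneg (x - y))
    linarith
  set g : Fin 2 → Fin 2 → ℝ → E n → ℝ := fun i j lam ξ =>
    lam * corrector H M lam i P ξ + (corrector H M lam i P ξ - corrector H M lam j P ξ) with hg
  have hgL : ∀ i j, ∀ᶠ lam in (l : Filter ℝ),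
      ∀ x y, |g i j lam x - g i j lam y| ≤ 3 * Λ * ‖x - y‖ := fun i j => by
    filter_upwards [hpos, hone] with lam hlam hlam1 x y
    have h1 := abs_le.1 (corrector_lipschitz hb hlam hP i x y)
    have h2 := abs_le.1 (corrector_lipschitz hb hlam hP j x y)
    have h3 : |lam * (corrector H M lam i P x - corrector H M lam i P y)| ≤ Λ * ‖x - y‖ := by
      rw [abs_mul, abs_of_pos hlam]
      exact (mul_le_of_le_one_left (abs_nonneg _) hlam1.le).trans
        (corrector_lipschitz hb hlam hP i x y)
    have h4 := abs_le.1 h3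
    simp only [hg]
    rw [abs_le]
    constructor <;> linarith
  have hg₀ : ∀ i j ξ, Tendsto (fun lam => g i j lam ξ) l (𝓝 (c' + (v i ξ - v j ξ))) := by
    intro i j ξ
    refine ((hlamv i ξ).add ((hv i ξ).sub (hv j ξ))).congr fun lam => ?_
    simp only [hg, hw]; ring
  refine ⟨-c', v, fun i => continuous_of_lipschitz (hvL i), fun i ξ z => ?_, fun i j hij => ?_,
    fun i j hij => ?_⟩
  · refine tendsto_nhds_unique (hv i (ξ + intVec z)) ((hv i ξ).congr' ?_)
    filter_upwards [hpos] with lam hlam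
    simp only [hw, corrector_periodic hA2 hb hlam hP]
  · have h := viscSub_of_tendsto (l := (l : Filter ℝ)) (K := fun ξ p => H i ξ (P + p))
      (a := fun lam => w lam i) (g := g i j)
      (a₀ := v i) (g₀ := fun ξ => c' + (v i ξ - v j ξ)) (continuous_shift hHc P i) hΛ3
      ((hwL i).mono fun lam h x y => (h x y).trans (hmono x y))
      (fun x y => (hvL i x y).trans (hmono x y)) (hgL i j) (hv i) (hg₀ i j)
      (hpos.mono fun lam hlam φ ξ hφ hmax => by
        have := corrector_sub hHc hb hlam hP i j hij φ ξ hφ (by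
          filter_upwards [hmax] with η hη
          simp only [hw] at hη
          linarith)
        simp only [hg] at this ⊢
        linarith)
    convert h using 3
    ring
  · have h := viscSuper_of_tendsto (l := (l : Filter ℝ)) (K := fun ξ p => H i ξ (P + p))
      (a := fun lam => w lam i) (g := g i j)
      (a₀ := v i) (g₀ := fun ξ => c' + (v i ξ - v j ξ)) (continuous_shift hHc P i) hΛ3
      ((hwL i).mono fun lam h x y => (h x y).trans (hmono x y))
      (fun x y => (hvL i x y).trans (hmono x y)) (hgL i j) (hv i) (hg₀ i j)
      (hpos.mono fun lam hlam φ ξ hφ hmin => by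
        have := corrector_super hHc hb hlam hP i j hij φ ξ hφ (by
          filter_upwards [hmin] with η hη
          simp only [hw] at hη
          linarith)
        simp only [hg] at this ⊢
        linarith)
    convert h using 3
    ring

theorem effectiveHamiltonian_spec (hHc : ∀ i, Continuous (fun z : E n × E n => H i z.1 z.2))
    (hA1 : ∀ i, UniformlyCoercive (H i)) (hA2 : ∀ i, PeriodicHamiltonian (H i)) (P : E n) :
    ∃ v : Fin 2 → E n → ℝ, IsCellSolution H P (effectiveHamiltonian H P) v :=
  Classical.epsilon_spec (p := fun c : ℝ => ∃ v : Fin 2 → E n → ℝ, IsCellSolution H P c v)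
    (exists_cellSolution hHc hA1 hA2 P)

theorem abs_effectiveHamiltonian_sub_le
    (hHc : ∀ i, Continuous (fun z : E n × E n => H i z.1 z.2))
    (hA1 : ∀ i, UniformlyCoercive (H i)) (hA2 : ∀ i, PeriodicHamiltonian (H i)) {L : ℝ}
    (hL : ∀ i (ξ p q : E n), |H i ξ p - H i ξ q| ≤ L * ‖p - q‖) (P Q : E n) :
    |effectiveHamiltonian H P - effectiveHamiltonian H Q| ≤ L * ‖P - Q‖ := by
  have key : ∀ P Q : E n, effectiveHamiltonian H Q ≤ effectiveHamiltonian H P + L * ‖P - Q‖ := by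
    intro P Q
    obtain ⟨v, hv⟩ := effectiveHamiltonian_spec hHc hA1 hA2 P
    obtain ⟨w, hw⟩ := effectiveHamiltonian_spec hHc hA1 hA2 Q
    obtain ⟨Λ, hΛ, hvL⟩ := hv.exists_lipschitz hA1
    refine ergodic_le (K := fun i ξ p => H i ξ (Q + p))
      (fun i => uniformContInX_shift (uniformContInX_of_periodic (hHc i) (hA2 i)) Q)
      hv.continuous hw.continuous hv.periodic hw.periodic hΛ hvL ?_ hw.super
    intro i j hij φ ξ hφ hmax
    have h1 := hv.sub i j hij φ ξ hφ hmax
    have h2 := abs_le.1 (hL i ξ (P + gradient φ ξ) (Q + gradient φ ξ))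
    rw [add_sub_add_right_eq_sub] at h2
    simp only at h1 ⊢
    linarith
  have h1 := key P Q
  have h2 := key Q P
  rw [norm_sub_rev] at h2
  rw [abs_le]
  constructor <;> linarith

/-- On replacing `λ v` by its value at the single point `(i, ξ)`, the oscillation bound makes `v` a
sub- and a supersolution of the cell problem with constants `-λ v i ξ ± D λ`. Comparison with an
exact solution by `ergodic_le` gives both inequalities. -/
theorem abs_lam_mul_corrector_add_le
    (hHc : ∀ i, Continuous (fun z : E n × E n => H i z.1 z.2))
    (hA1 : ∀ i, UniformlyCoercive (H i)) (hA2 : ∀ i, PeriodicHamiltonian (H i))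
    (hb : CellBounds H A M m Λ) (hlam : 0 < lam) {P : E n} (hP : ‖P‖ ≤ A) (i : Fin 2)
    (ξ : E n) :
    |lam * corrector H M lam i P ξ + effectiveHamiltonian H P|
      ≤ (Λ * (2 * √n) + (M + m)) * lam := by
  set D := Λ * (2 * √n) + (M + m) with hD
  set v : Fin 2 → E n → ℝ := fun i ξ => corrector H M lam i P ξ with hv
  obtain ⟨w, hw⟩ := effectiveHamiltonian_spec hHc hA1 hA2 P
  obtain ⟨Λ', hΛ', hwL⟩ := hw.exists_lipschitz hA1
  have hUC := fun i => uniformContInX_shift (uniformContInX_of_periodic (hHc i) (hA2 i)) P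
  have hvL := corrector_lipschitz hb hlam hP
  have hosc : ∀ k η, |lam * v i ξ - lam * v k η| ≤ D * lam := fun k η => by
    have := corrector_oscillation_le hHc hA2 hb hlam hP i k ξ η
    rw [← mul_sub, abs_mul, abs_of_pos hlam, mul_comm]
    exact mul_le_mul_of_nonneg_right this hlam.le
  have hup : effectiveHamiltonian H P ≤ -(lam * v i ξ) + D * lam := by
    refine ergodic_le (K := fun i ξ p => H i ξ (P + p)) (a := v) hUC
      (fun i => continuous_of_lipschitz (hvL i)) hw.continuous
      (corrector_periodic hA2 hb hlam hP) hw.periodic hb.Λ_nonneg hvL ?_ hw.super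
    intro k l hkl φ η hφ hmax
    have h1 := corrector_sub hHc hb hlam hP k l hkl φ η hφ hmax
    have h2 := abs_le.1 (hosc k η)
    simp only [hv] at h1 h2 ⊢
    linarith
  have hlow : -(lam * v i ξ) - D * lam ≤ effectiveHamiltonian H P := by
    refine ergodic_le (K := fun i ξ p => H i ξ (P + p)) (b := v) hUC hw.continuous
      (fun i => continuous_of_lipschitz (hvL i)) hw.periodic
      (corrector_periodic hA2 hb hlam hP) hΛ' hwL hw.sub ?_
    intro k l hkl φ η hφ hmin
    have h1 := corrector_super hHc hb hlam hP k l hkl φ η hφ hmin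
    have h2 := abs_le.1 (hosc k η)
    simp only [hv] at h1 h2 ⊢
    linarith
  simp only [hv] at hup hlow
  rw [abs_le]
  constructor <;> linarith

end Effective

/-! ### Finite speed of propagation and growth -/

section Growth

variable {n : ℕ}

theorem nonpos_of_nonpos_Ico {T : ℝ} (hT : 0 < T) {f : ℝ → ℝ} (hf : ContinuousOn f (Icc 0 T))
    (h : ∀ t ∈ Ico 0 T, f t ≤ 0) {t : ℝ} (ht : t ∈ Icc 0 T) : f t ≤ 0 :=
  ContinuousWithinAt.closure_le (s := Ico 0 T) (by rwa [closure_Ico hT.ne])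
    ((hf t ht).mono Ico_subset_Icc_self) continuousWithinAt_const h

theorem exists_mul_pow_lt {q M δ : ℝ} (hq0 : 0 ≤ q) (hq : q < 1) (hδ : 0 < δ) :
    ∀ᶠ k : ℕ in atTop, M * q ^ k < δ := by
  have h := (tendsto_pow_atTop_nhds_zero_of_lt_one hq0 hq).const_mul M
  rw [mul_zero] at h
  exact h.eventually (gt_mem_nhds hδ)

theorem hasDerivAt_mul_div_pow (M T : ℝ) (k : ℕ) (t : ℝ) :
    HasDerivAt (fun s : ℝ => M * (s / T) ^ k) (M * (k * (t / T) ^ (k - 1) * (1 / T))) t :=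
  ((((hasDerivAt_id t).div_const T).pow k)).const_mul M

/-- A subsolution of the system stays below `g + K t` if it starts below `g`; no growth condition
is needed, as the Hamiltonians are Lipschitz in the gradient. -/
theorem le_add_mul_of_systemSub {G : Fin 2 → E n → E n → ℝ} {Λ ε T : ℝ} (hΛ : 0 ≤ Λ)
    (hG : ∀ i (x p q : E n), |G i x p - G i x q| ≤ Λ * ‖p - q‖) (hε : 0 < ε) (hT : 0 < T)
    {w : Fin 2 → E n → ℝ → ℝ}
    (hwc : ∀ i, ContinuousOn (fun z : E n × ℝ => w i z.1 z.2) (univ ×ˢ Icc 0 T))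
    (hsub : ∀ i j, i ≠ j →
      IsEvolViscSub T (fun x t p => G i x p + (w i x t - w j x t) / ε) (w i))
    {g : E n → ℝ} (hg : ContDiff ℝ 1 g) {K : ℝ} (hK : ∀ i x, -K ≤ G i x (gradient g x))
    (h0 : ∀ i x, w i x 0 ≤ g x) (i : Fin 2) (x : E n) {t : ℝ} (ht : t ∈ Icc 0 T) :
    w i x t ≤ g x + K * t := by
  suffices h : ∀ i₀ x₀, ∀ t₀ ∈ Ico 0 T, w i₀ x₀ t₀ - (g x₀ + K * t₀) ≤ 0 by
    have hc : ContinuousOn (fun s => w i x s - (g x + K * s)) (Icc 0 T) := by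
      refine ContinuousOn.sub ?_ (by fun_prop)
      exact (hwc i).comp (f := fun s : ℝ => (x, s)) (by fun_prop) (fun s hs => ⟨mem_univ _, hs⟩)
    have := nonpos_of_nonpos_Ico hT hc (h i x) ht
    linarith
  intro i₀ x₀ t₀ ht₀
  by_contra! hμ
  set μ := w i₀ x₀ t₀ - (g x₀ + K * t₀) with hμdef
  set σ := μ / (4 * T) with hσdef
  have hσ : 0 < σ := by positivity
  -- This radius exceeds `1 + Λ t₀`, the value of `a` at the base point.
  set R := 2 + Λ * T with hR
  have hRpos : 0 < R := by positivity
  set S : Set (E n × ℝ) := Metric.closedBall x₀ R ×ˢ Icc 0 T with hS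
  have hScpt : IsCompact S := (isCompact_closedBall _ _).prod isCompact_Icc
  have hSsub : S ⊆ univ ×ˢ Icc 0 T := prod_mono (subset_univ _) le_rfl
  have hdc : ∀ i, ContinuousOn (fun z : E n × ℝ => w i z.1 z.2 - (g z.1 + K * z.2)) S := fun i =>
    ((hwc i).mono hSsub).sub
      (((hg.continuous.comp continuous_fst).add (by fun_prop)).continuousOn)
  choose B hB using fun i => hScpt.exists_bound_of_continuousOn (hdc i)
  set M := |B 0| + |B 1| with hM
  have hM0 : 0 ≤ M := by positivity
  have hBM : ∀ i, ∀ z ∈ S, w i z.1 z.2 - (g z.1 + K * z.2) ≤ M := fun i z hz => by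
    have h1 := (le_abs_self _).trans (hB i z hz)
    refine h1.trans ?_
    have := abs_nonneg (B 0); have := abs_nonneg (B 1)
    have := le_abs_self (B 0); have := le_abs_self (B 1)
    fin_cases i <;> simp [hM] <;> linarith
  -- For large `k` both penalties are negligible at `(x₀, t₀)`, although they are at least `M` on
  -- the lateral boundary and at time `T`. This excludes maxima there.
  obtain ⟨k, hk1, hk2⟩ := ((exists_mul_pow_lt (q := (1 + Λ * t₀) / R) (M := M)
      (δ := μ / 4) (div_nonneg (by have := mul_nonneg hΛ ht₀.1; linarith) hRpos.le)
      ((div_lt_one hRpos).2 (by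
        have := mul_le_mul_of_nonneg_left ht₀.2.le hΛ
        linarith)) (by linarith)).and
    (exists_mul_pow_lt (q := t₀ / T) (M := M) (δ := μ / 4) (div_nonneg ht₀.1 hT.le)
      ((div_lt_one hT).2 ht₀.2) (by linarith))).exists
  -- Along `a` the time derivative is `Λ` and the gradient has norm at most 1. The time derivative
  -- of the penalty therefore pays for the change of `G` caused by its gradient: this is finite
  -- speed of propagation.
  set a : E n × ℝ → ℝ := fun z => smoothDist 1 x₀ z.1 + Λ * z.2 with ha
  set φ : E n × ℝ → ℝ := fun z =>
    (g z.1 + (K + σ) * z.2) + M * (a z / R) ^ k + M * (z.2 / T) ^ k with hφ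
  have hacd : ContDiff ℝ 1 a :=
    ((contDiff_smoothDist one_pos x₀).comp contDiff_fst).add (contDiff_const.mul contDiff_snd)
  have hφcd : ContDiff ℝ 1 φ :=
    (((hg.comp contDiff_fst).add (contDiff_const.mul contDiff_snd)).add
      (contDiff_const.mul ((hacd.div_const R).pow k))).add
      (contDiff_const.mul ((contDiff_snd.div_const T).pow k))
  have hmem₀ : (x₀, t₀) ∈ S := ⟨Metric.mem_closedBall_self hRpos.le, Ico_subset_Icc_self ht₀⟩
  obtain ⟨i, ⟨x, t⟩, hmS, hmax⟩ := exists_family_max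
    (f := fun i (z : E n × ℝ) => w i z.1 z.2 - φ z) hScpt.isClosed
    (fun i => ((hwc i).mono hSsub).sub hφcd.continuous.continuousOn) (i₀ := i₀) hmem₀
    (x₀, t₀) (Metric.diam S) (fun i z hz _ =>
      Metric.dist_le_diam_of_mem hScpt.isBounded hz hmem₀)
  have hval : 0 < w i x t - φ (x, t) := by
    refine lt_of_lt_of_le ?_ (hmax i₀ (x₀, t₀) hmem₀)
    have h1 : a (x₀, t₀) = 1 + Λ * t₀ := by simp only [ha, smoothDist_self one_pos]
    have h2 : σ * t₀ ≤ μ / 4 := by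
      have h3 := mul_le_mul_of_nonneg_left ht₀.2.le hσ.le
      have h4 : σ * T = μ / 4 := by rw [hσdef]; field_simp
      linarith
    simp only [hφ, h1]
    linarith
  have hxR : ‖x - x₀‖ ≤ R := by simpa [dist_eq_norm] using hmS.1
  have htI : t ∈ Icc 0 T := hmS.2
  have ha0 : 0 ≤ a (x, t) :=
    add_nonneg (smoothDist_pos one_pos x₀ x).le (mul_nonneg hΛ htI.1)
  have hpen1 : 0 ≤ M * (a (x, t) / R) ^ k := by positivity
  have hpen2 : 0 ≤ M * (t / T) ^ k := mul_nonneg hM0 (pow_nonneg (div_nonneg htI.1 hT.le) k)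
  have hσt : 0 ≤ σ * t := mul_nonneg hσ.le htI.1
  have hup := hBM i (x, t) hmS
  simp only [hφ] at hval
  simp only at hup
  have ht0 : t ≠ 0 := by
    rintro rfl
    have := h0 i x
    linarith
  have htT : t ≠ T := by
    rintro rfl
    rw [div_self hT.ne', one_pow] at hval
    linarith
  have hxlt : ‖x - x₀‖ < R := by
    refine lt_of_le_of_ne hxR fun heq => ?_
    have h1 : R ≤ a (x, t) := by
      have := norm_sub_le_smoothDist 1 x₀ x
      have := mul_nonneg hΛ htI.1
      simp only [ha]; linarith
    have h2 : 1 ≤ (a (x, t) / R) ^ k := one_le_pow₀ ((one_le_div hRpos).2 h1)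
    have h3 := mul_le_mul_of_nonneg_left h2 hM0
    linarith
  have htpos : 0 < t := lt_of_le_of_ne htI.1 ht0.symm
  have htlt : t < T := lt_of_le_of_ne htI.2 htT
  have hnhds : S ∈ 𝓝 (x, t) :=
    prod_mem_nhds (Metric.closedBall_mem_nhds_of_mem (by simpa [dist_eq_norm] using hxlt))
      (Icc_mem_nhds htpos htlt)
  obtain ⟨j, hij⟩ := exists_ne i
  set e : E n := (smoothDist 1 x₀ x)⁻¹ • (x - x₀) with he
  set c : ℝ := M * (k * (a (x, t) / R) ^ (k - 1) * (1 / R)) with hc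
  have hc0 : 0 ≤ c := by positivity
  have hgrad : HasGradientAt (fun y => φ (y, t)) (gradient g x + c • e) x := by
    have h1 : HasGradientAt (fun y => a (y, t)) e x := by
      simpa using hasGradientAt_add (hasGradientAt_smoothDist one_pos x₀ x)
        (hasGradientAt_const x (Λ * t))
    have h2 := HasDerivAt.comp_hasGradientAt' (hasDerivAt_mul_div_pow M R k (a (x, t))) h1
    have h3 := hasGradientAt_add (hasGradientAt_add (hasGradientAt_add
      (hasGradientAt_of_contDiffAt hg.contDiffAt) (hasGradientAt_const x ((K + σ) * t))) h2)
      (hasGradientAt_const x (M * (t / T) ^ k))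
    simpa only [add_zero] using h3
  have hder : HasDerivAt (fun s => φ (x, s))
      ((K + σ) + c * Λ + M * (k * (t / T) ^ (k - 1) * (1 / T))) t := by
    have h1 : HasDerivAt (fun s => a (x, s)) Λ t := by
      have := ((hasDerivAt_id t).const_mul Λ).const_add (smoothDist 1 x₀ x)
      rw [mul_one] at this
      exact this
    have h2 := (hasDerivAt_mul_div_pow M R k (a (x, t))).comp t h1
    have h3 : HasDerivAt (fun s => g x + (K + σ) * s) (K + σ) t := by
      simpa using ((hasDerivAt_id t).const_mul (K + σ)).const_add (g x)
    exact (h3.add h2).add (hasDerivAt_mul_div_pow M T k t)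
  have hv := (hsub i j hij.symm).le htpos htlt hφcd.contDiffAt hgrad hder (by
    filter_upwards [hnhds] with z hz
    exact hmax i z hz)
  have hj := hmax j (x, t) hmS
  have hcoup : 0 ≤ (w i x t - w j x t) / ε :=
    div_nonneg (by simp only at hj; linarith) hε.le
  have hlip := (abs_le.1 (hG i x (gradient g x + c • e) (gradient g x))).1
  have hen : ‖gradient g x + c • e - gradient g x‖ ≤ c := by
    rw [add_sub_cancel_left, norm_smul, Real.norm_of_nonneg hc0]
    exact mul_le_of_le_one_right hc0 (norm_inv_smoothDist_smul_le one_pos x₀ x)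
  have hlip' := mul_le_mul_of_nonneg_left hen hΛ
  have hKx := hK i x
  have hlast : 0 ≤ M * (k * (t / T) ^ (k - 1) * (1 / T)) := by
    have := div_nonneg htI.1 hT.le
    positivity
  linarith

end Growth

/-! ### The doubling argument -/

section Doubling

variable {n : ℕ}

/-- The penalization in the doubling argument, in the position `x`, `y` of the two solutions, the
fast variable `ξ` and the copy `d` of `x - y` in the slope of the corrector. -/
noncomputable def penalty (ε η A γ α σ δ B T : ℝ) (k : ℕ) (x y ξ d : E n) (t s : ℝ) : ℝ :=
  ‖x - ε • ξ‖ ^ 2 / (2 * (ε * γ)) + A * smoothDist η y x + ‖x - (y + d)‖ ^ 2 / (2 * γ)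
    + (t - s) ^ 2 / (2 * α) + σ * t + δ * smoothDist 1 0 y + B * (t / T) ^ k + B * (s / T) ^ k

theorem fast_penalty_eq {ε : ℝ} (hε : 0 < ε) (γ : ℝ) (x ξ : E n) :
    ‖x - ε • ξ‖ ^ 2 / (2 * (ε * γ)) = ε * (‖ξ - ε⁻¹ • x‖ ^ 2 / (2 * γ)) := by
  have h : x - ε • ξ = -(ε • (ξ - ε⁻¹ • x)) := by
    rw [smul_sub, smul_smul, mul_inv_cancel₀ hε.ne', one_smul]; abel
  rw [h, norm_neg, norm_smul, Real.norm_of_nonneg hε.le]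
  rcases eq_or_ne γ 0 with rfl | hγ
  · simp
  · field_simp

theorem le_add_one_of_sq_le {r b : ℝ} (h : r ^ 2 ≤ b) : r ≤ b + 1 := by
  nlinarith [sq_nonneg (r - 1)]

theorem mul_div_pow_nonneg {B T : ℝ} (hB : 0 ≤ B) (hT : 0 < T) (k : ℕ) {t : ℝ} (ht : 0 ≤ t) :
    0 ≤ B * (t / T) ^ k :=
  mul_nonneg hB (pow_nonneg (div_nonneg ht hT.le) k)

/-- Existence of a maximum point for the doubled functional. -/
theorem exists_doubling_max {ε η A γ α σ δ B T L : ℝ} {k : ℕ} (hε : 0 < ε)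
    (hA : A = L + 1) (hL : 0 ≤ L) (hγ : 0 < γ) (hα : 0 < α) (hσ : 0 ≤ σ) (hδ : 0 < δ)
    (hB : 0 ≤ B) (hT : 0 < T) {w : Fin 2 → E n → ℝ → ℝ} {u : E n → ℝ → ℝ}
    {V : Fin 2 → E n → E n → ℝ}
    (hwc : ∀ i, ContinuousOn (fun z : E n × ℝ => w i z.1 z.2) (univ ×ˢ Icc 0 T))
    (huc : ContinuousOn (fun z : E n × ℝ => u z.1 z.2) (univ ×ˢ Icc 0 T))
    (hVc : ∀ i, Continuous (fun z : E n × E n => V i z.1 z.2))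
    (hbd : ∀ i (x y d ξ : E n), ∀ t ∈ Icc 0 T, ∀ s ∈ Icc 0 T,
      w i x t - u y s - ε * V i d ξ ≤ B + L * ‖x - y‖)
    {i₀ : Fin 2} {x₀ y₀ ξ₀ d₀ : E n} {t₀ s₀ : ℝ} (ht₀ : t₀ ∈ Icc 0 T) (hs₀ : s₀ ∈ Icc 0 T)
    (hpos : 0 < w i₀ x₀ t₀ - u y₀ s₀ - ε * V i₀ d₀ ξ₀
      - penalty ε η A γ α σ δ B T k x₀ y₀ ξ₀ d₀ t₀ s₀) :
    ∃ i x y ξ d t s, t ∈ Icc 0 T ∧ s ∈ Icc 0 T ∧ ∀ j (x' y' ξ' d' : E n), ∀ t' ∈ Icc 0 T,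
      ∀ s' ∈ Icc 0 T,
      w j x' t' - u y' s' - ε * V j d' ξ' - penalty ε η A γ α σ δ B T k x' y' ξ' d' t' s'
      ≤ w i x t - u y s - ε * V i d ξ - penalty ε η A γ α σ δ B T k x y ξ d t s := by
  set S : Set (E n × E n × E n × E n × ℝ × ℝ) :=
    {z | z.2.2.2.2.1 ∈ Icc 0 T ∧ z.2.2.2.2.2 ∈ Icc 0 T} with hS
  have hSc : IsClosed S := by
    refine IsClosed.inter (isClosed_Icc.preimage ?_) (isClosed_Icc.preimage ?_) <;> fun_prop
  set f : Fin 2 → E n × E n × E n × E n × ℝ × ℝ → ℝ := fun i z =>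
    w i z.1 z.2.2.2.2.1 - u z.2.1 z.2.2.2.2.2 - ε * V i z.2.2.2.1 z.2.2.1
      - penalty ε η A γ α σ δ B T k z.1 z.2.1 z.2.2.1 z.2.2.2.1 z.2.2.2.2.1 z.2.2.2.2.2 with hf
  have hfc : ∀ i, ContinuousOn (f i) S := by
    intro i
    have h1 : ContinuousOn (fun z : E n × E n × E n × E n × ℝ × ℝ => w i z.1 z.2.2.2.2.1) S :=
      (hwc i).comp (f := fun z : E n × E n × E n × E n × ℝ × ℝ => (z.1, z.2.2.2.2.1))
        (by fun_prop) (fun z hz => ⟨mem_univ _, hz.1⟩)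
    have h2 : ContinuousOn (fun z : E n × E n × E n × E n × ℝ × ℝ => u z.2.1 z.2.2.2.2.2) S :=
      huc.comp (f := fun z : E n × E n × E n × E n × ℝ × ℝ => (z.2.1, z.2.2.2.2.2))
        (by fun_prop) (fun z hz => ⟨mem_univ _, hz.2⟩)
    have h3 : Continuous (fun z : E n × E n × E n × E n × ℝ × ℝ => V i z.2.2.2.1 z.2.2.1) :=
      (hVc i).comp (f := fun z : E n × E n × E n × E n × ℝ × ℝ => (z.2.2.2.1, z.2.2.1))
        (by fun_prop)
    refine ((h1.sub h2).sub (continuous_const.mul h3).continuousOn).sub ?_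
    unfold penalty smoothDist
    fun_prop
  set Rx := B / δ + B with hRx
  set Rξ := ε⁻¹ * Rx + (B * (2 * (ε * γ)) / ε ^ 2 + 1) with hRξ
  set Rd := B + (B * (2 * γ) + 1) with hRd
  have hRx0 : 0 ≤ Rx := by positivity
  have hRξ0 : 0 ≤ Rξ := by positivity
  have hRd0 : 0 ≤ Rd := by positivity
  obtain ⟨i, ⟨x, y, ξ, d, t, s⟩, hm, hmax⟩ := exists_family_max (f := f) hSc hfc (i₀ := i₀)
    (x₀ := (x₀, y₀, ξ₀, d₀, t₀, s₀)) ⟨ht₀, hs₀⟩ 0 (Rx + Rξ + Rd + T) (by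
      rintro i ⟨x, y, ξ, d, t, s⟩ ⟨ht, hs⟩ hle
      have hpos' : 0 < f i (x, y, ξ, d, t, s) := lt_of_lt_of_le hpos hle
      simp only [hf, penalty] at hpos' ht hs
      have h1 := hbd i x y d ξ t ht s hs
      have n1 : 0 ≤ ‖x - ε • ξ‖ ^ 2 / (2 * (ε * γ)) := by positivity
      have n2 : (L + 1) * ‖x - y‖ ≤ A * smoothDist η y x := by
        rw [hA]; exact mul_le_mul_of_nonneg_left (norm_sub_le_smoothDist η y x) (by linarith)
      have n3 : 0 ≤ ‖x - (y + d)‖ ^ 2 / (2 * γ) := by positivity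
      have n4 : 0 ≤ (t - s) ^ 2 / (2 * α) := by positivity
      have n5 : 0 ≤ σ * t := mul_nonneg hσ ht.1
      have n6 : δ * ‖y‖ ≤ δ * smoothDist 1 0 y := by
        have := norm_sub_le_smoothDist 1 0 y
        rw [sub_zero] at this
        exact mul_le_mul_of_nonneg_left this hδ.le
      have n7 := mul_div_pow_nonneg hB hT k ht.1
      have n8 := mul_div_pow_nonneg hB hT k hs.1
      have n9 := norm_nonneg (x - y)
      have n10 := mul_nonneg hδ.le (norm_nonneg y)
      have b1 : ‖x - y‖ ≤ B := by linarith
      have b2 : ‖y‖ ≤ B / δ := by rw [le_div_iff₀ hδ]; linarith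
      have b3 : ‖x - (y + d)‖ ≤ B * (2 * γ) + 1 := by
        have : ‖x - (y + d)‖ ^ 2 / (2 * γ) ≤ B := by linarith
        exact le_add_one_of_sq_le ((div_le_iff₀ (by positivity)).1 this)
      have b4 : ‖ξ - ε⁻¹ • x‖ ≤ B * (2 * (ε * γ)) / ε ^ 2 + 1 := by
        have h2 : ‖x - ε • ξ‖ ^ 2 / (2 * (ε * γ)) ≤ B := by linarith
        rw [fast_penalty_eq hε] at h2
        refine le_add_one_of_sq_le ?_
        have h3 : ‖ξ - ε⁻¹ • x‖ ^ 2 = ε * (‖ξ - ε⁻¹ • x‖ ^ 2 / (2 * γ)) * (2 * (ε * γ) / ε ^ 2) := by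
          field_simp
        rw [h3, mul_div_assoc B]
        exact mul_le_mul_of_nonneg_right h2 (by positivity)
      have b5 : ‖x‖ ≤ Rx := by
        have e : x = y + (x - y) := by abel
        rw [e]; exact (norm_add_le _ _).trans (by linarith)
      have b6 : ‖ξ‖ ≤ Rξ := by
        have e : ξ = ε⁻¹ • x + (ξ - ε⁻¹ • x) := by abel
        rw [e]
        refine (norm_add_le _ _).trans (add_le_add ?_ b4)
        rw [norm_smul, norm_inv, Real.norm_of_nonneg hε.le]
        gcongr
      have b7 : ‖d‖ ≤ Rd := by
        have e : d = (x - y) - (x - (y + d)) := by abel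
        calc ‖d‖ = ‖(x - y) - (x - (y + d))‖ := by rw [← e]
          _ ≤ _ := (norm_sub_le _ _).trans (by linarith)
      have b8 : ‖t‖ ≤ T := by rw [Real.norm_of_nonneg ht.1]; exact ht.2
      have b9 : ‖s‖ ≤ T := by rw [Real.norm_of_nonneg hs.1]; exact hs.2
      rw [dist_zero_right]
      simp only [Prod.norm_mk, max_le_iff]
      refine ⟨?_, ?_, ?_, ?_, ?_, ?_⟩ <;> linarith)
  exact ⟨i, x, y, ξ, d, t, s, hm.1, hm.2, fun j x' y' ξ' d' t' ht' s' hs' =>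
    hmax j (x', y', ξ', d', t', s') ⟨ht', hs'⟩⟩

theorem mul_sub_sq_div_le {K α r : ℝ} (hα : 0 < α) :
    K * r - r ^ 2 / (2 * α) ≤ K ^ 2 * α / 2 := by
  have h : K ^ 2 * α / 2 - (K * r - r ^ 2 / (2 * α)) = (K * α - r) ^ 2 / (2 * α) := by
    field_simp; ring
  have : 0 ≤ (K * α - r) ^ 2 / (2 * α) := by positivity
  linarith

set_option maxHeartbeats 2000000 in
/-- The estimate of a subsolution of the system by a supersolution of the effective equation, in
terms of approximate correctors `v`. -/
theorem systemSub_sub_effectiveSuper_le {H : Fin 2 → E n → E n → ℝ} {Hb : E n → ℝ} {CH : ℝ}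
    (hCH : 0 ≤ CH) (hH : ∀ i (ξ p q : E n), |H i ξ p - H i ξ q| ≤ CH * ‖p - q‖)
    (hHb : ∀ p q, |Hb p - Hb q| ≤ CH * ‖p - q‖) (hUC : ∀ i, UniformContInX (H i))
    {A Λ M D lam ε η T K L : ℝ} (hε : 0 < ε) (hlam : 0 < lam) (hη : 0 < η) (hT : 0 < T)
    (hΛ : 0 ≤ Λ) (hM : 0 ≤ M) (hD : 0 ≤ D) (hK : 0 ≤ K) (hL : 0 ≤ L) (hA : A = L + 1)
    {v : Fin 2 → E n → E n → ℝ}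
    (hvL : ∀ P, ‖P‖ ≤ A → ∀ i x y, |v i P x - v i P y| ≤ Λ * ‖x - y‖)
    (hvM : ∀ P, ‖P‖ ≤ A → ∀ i ξ, |lam * v i P ξ| ≤ M)
    (hvP : ∀ P Q, ‖P‖ ≤ A → ‖Q‖ ≤ A → ∀ i ξ, |v i P ξ - v i Q ξ| ≤ CH / lam * ‖P - Q‖)
    (hvH : ∀ P, ‖P‖ ≤ A → ∀ i ξ, lam * v i P ξ + Hb P ≤ D * lam)
    (hvs : ∀ P, ‖P‖ ≤ A → IsDiscountSuper lam (fun i ξ p => H i ξ (P + p)) (fun i => v i P))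
    {w : Fin 2 → E n → ℝ → ℝ} {u : E n → ℝ → ℝ} {g : E n → ℝ}
    (hwc : ∀ i, ContinuousOn (fun z : E n × ℝ => w i z.1 z.2) (univ ×ˢ Icc 0 T))
    (hsub : ∀ i j, i ≠ j →
      IsEvolViscSub T (fun x t p => H i (ε⁻¹ • x) p + (w i x t - w j x t) / ε) (w i))
    (huc : ContinuousOn (fun z : E n × ℝ => u z.1 z.2) (univ ×ˢ Icc 0 T))
    (hsup : IsEvolViscSuper T (fun _ _ p => Hb p) u)
    (hgL : ∀ x y, |g x - g y| ≤ L * ‖x - y‖)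
    (hwg : ∀ i x, ∀ t ∈ Icc 0 T, w i x t ≤ g x + K * t)
    (hug : ∀ x, ∀ t ∈ Icc 0 T, g x - K * t ≤ u x t) (i : Fin 2) (x : E n) {t : ℝ}
    (ht : t ∈ Icc 0 T) :
    w i x t - u x t ≤ A * η + 2 * (ε * (M / lam))
      + (D * lam + 4 * CH * (ε * (CH / lam * (2 * A / η)))) * T := by
  -- A Lipschitz constant of `d ↦ ε v(slope A η d, ξ)`: dependence on `P` times that of the slope on
  -- `d`.
  set κ := ε * (CH / lam * (2 * A / η)) with hκdef
  set Q := A * η + 2 * (ε * (M / lam)) + (D * lam + 4 * CH * κ) * T with hQ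
  suffices h : ∀ i₀ x₀, ∀ t₀ ∈ Ico 0 T, w i₀ x₀ t₀ - u x₀ t₀ - Q ≤ 0 by
    have hmap : MapsTo (fun s : ℝ => (x, s)) (Icc 0 T) (univ ×ˢ Icc 0 T) :=
      fun s hs => ⟨mem_univ _, hs⟩
    have hc : ContinuousOn (fun s => w i x s - u x s - Q) (Icc 0 T) :=
      (((hwc i).comp (f := fun s : ℝ => (x, s)) (by fun_prop) hmap).sub
        (huc.comp (f := fun s : ℝ => (x, s)) (by fun_prop) hmap)).sub continuousOn_const
    have := nonpos_of_nonpos_Ico hT hc (h i x) ht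
    linarith
  clear ht t x i
  intro i₀ x₀ t₀ ht₀
  by_contra! hμ
  set μ := w i₀ x₀ t₀ - u x₀ t₀ - Q with hμdef
  have hA1 : 0 < A := by linarith
  have hκ : 0 ≤ κ := by positivity
  have hN : ∀ d : E n, ‖slope A η d‖ ≤ A := norm_slope_le hA1.le hη
  -- the parameters of the doubling
  set σ₁ := μ / (8 * T) with hσ₁
  have hσ₁0 : 0 < σ₁ := by positivity
  -- The time slope exceeds by `σ₁` the errors that remain when all auxiliary parameters tend to
  -- zero; the contradiction comes from this excess.
  set σ := D * lam + 4 * CH * κ + σ₁ with hσdef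
  have hσ : 0 ≤ σ := by positivity
  set τ := σ₁ / (2 * (3 * CH + 1)) with hτdef
  have hτ : 0 < τ := by positivity
  have hτσ : (3 * CH + 1) * τ = σ₁ / 2 := by rw [hτdef]; field_simp
  set δ := min τ (μ / (8 * smoothDist 1 0 x₀)) with hδdef
  have hsd : 0 < smoothDist 1 0 x₀ := smoothDist_pos one_pos 0 x₀
  have hδ : 0 < δ := by positivity
  have hδτ : δ ≤ τ := min_le_left _ _
  have hδμ : δ * smoothDist 1 0 x₀ ≤ μ / 8 := by
    have h1 : δ ≤ μ / (8 * smoothDist 1 0 x₀) := min_le_right _ _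
    have h2 := mul_le_mul_of_nonneg_right h1 hsd.le
    have h3 : μ / (8 * smoothDist 1 0 x₀) * smoothDist 1 0 x₀ = μ / 8 := by field_simp
    linarith
  set α := μ / (4 * (K ^ 2 + 1)) with hαdef
  have hα : 0 < α := by positivity
  have hαμ : K ^ 2 * α / 2 ≤ μ / 8 := by
    have h1 : (K ^ 2 + 1) * α = μ / 4 := by rw [hαdef]; field_simp
    nlinarith
  choose δ' hδ' hUC' using fun i => hUC i (A + 2 * Λ) τ hτ
  obtain ⟨i₁, hi₁⟩ := Finite.exists_min δ'
  -- The auxiliary gradients `r` and `ρ` below are bounded by `2Λ` and `2κ` whatever `γ` is. So `γ`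
  -- may be taken small enough for the continuity in `ξ` and for the slope at `d` to be close to the
  -- slope at `x - y`.
  set γ := min (δ' i₁ / (2 * (Λ + 1))) (τ / (2 * A / η * (2 * κ) + 1)) with hγdef
  have hδ'1 := hδ' i₁
  have hγ : 0 < γ := by positivity
  have hγδ : 2 * γ * Λ < δ' i₁ := by
    have h1 : γ ≤ δ' i₁ / (2 * (Λ + 1)) := min_le_left _ _
    rw [le_div_iff₀ (by positivity)] at h1
    nlinarith
  have hγτ : 2 * A / η * (2 * γ * κ) ≤ τ := by
    have h1 : γ ≤ τ / (2 * A / η * (2 * κ) + 1) := min_le_right _ _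
    rw [le_div_iff₀ (by positivity)] at h1
    nlinarith
  set Bv := ε * (M / lam) with hBv
  have hBv0 : 0 ≤ Bv := by positivity
  have hvB : ∀ i d ξ, |ε * v i (slope A η d) ξ| ≤ Bv := fun i d ξ => by
    have h1 := hvM _ (hN d) i ξ
    rw [abs_mul, abs_of_pos hlam] at h1
    rw [abs_mul, abs_of_pos hε]
    refine mul_le_mul_of_nonneg_left ?_ hε.le
    rw [le_div_iff₀ hlam]; linarith
  -- This bounds the unpenalised functional up to `L ‖x - y‖`. As the weight of the barriers `(t /
  -- T) ^ k` and `(s / T) ^ k`, it excludes maxima at the final time.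
  set B := 2 * (K * T) + Bv with hB
  have hB0 : 0 ≤ B := by positivity
  obtain ⟨k, hk⟩ := (exists_mul_pow_lt (q := t₀ / T) (M := B) (δ := μ / 16)
    (div_nonneg ht₀.1 hT.le) ((div_lt_one hT).2 ht₀.2) (by positivity)).exists
  set V : Fin 2 → E n → E n → ℝ := fun i d ξ => v i (slope A η d) ξ with hV
  have hVd : ∀ i d d' ξ, |V i d ξ - V i d' ξ| ≤ CH / lam * (2 * A / η) * ‖d - d'‖ := by
    intro i d d' ξ
    refine (hvP _ _ (hN d) (hN d') i ξ).trans ?_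
    rw [mul_assoc]
    exact mul_le_mul_of_nonneg_left (norm_slope_sub_le hA1.le hη d d') (by positivity)
  have hVc : ∀ i, Continuous (fun z : E n × E n => V i z.1 z.2) := by
    intro i
    have hc0 : 0 ≤ CH / lam * (2 * A / η) := by positivity
    refine (LipschitzWith.of_dist_le_mul (K := Real.toNNReal (CH / lam * (2 * A / η) + Λ))
      fun z z' => ?_).continuous
    rw [Real.coe_toNNReal _ (by positivity), Real.dist_eq]
    have h1 := hVd i z.1 z'.1 z.2
    have h2 := hvL _ (hN z'.1) i z.2 z'.2
    have h3 : ‖z.1 - z'.1‖ ≤ dist z z' := by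
      rw [← dist_eq_norm, Prod.dist_eq]; exact le_max_left _ _
    have h4 : ‖z.2 - z'.2‖ ≤ dist z z' := by
      rw [← dist_eq_norm, Prod.dist_eq]; exact le_max_right _ _
    have h5 := mul_le_mul_of_nonneg_left h3 hc0
    have h6 := mul_le_mul_of_nonneg_left h4 hΛ
    refine (abs_sub_le _ (V i z'.1 z.2) _).trans ?_
    simp only [hV] at h1 ⊢
    linarith
  have hwu : ∀ i (x y : E n), ∀ t ∈ Icc 0 T, ∀ s ∈ Icc 0 T,
      w i x t - u y s ≤ K * t + K * s + L * ‖x - y‖ := fun i x y t ht s hs => by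
    have h1 := hwg i x t ht
    have h2 := hug y s hs
    have h3 := abs_le.1 (hgL x y)
    linarith
  have hbd : ∀ i (x y d ξ : E n), ∀ t ∈ Icc 0 T, ∀ s ∈ Icc 0 T,
      w i x t - u y s - ε * V i d ξ ≤ B + L * ‖x - y‖ := fun i x y d ξ t ht s hs => by
    have h1 := hwu i x y t ht s hs
    have h2 := abs_le.1 (hvB i d ξ)
    have h3 := mul_le_mul_of_nonneg_left ht.2 hK
    have h4 := mul_le_mul_of_nonneg_left hs.2 hK
    simp only [hV, hB]
    linarith
  -- Of the excess `μ`, the terms with `σ₁` and `δ` and the two time barriers together each use at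
  -- most `μ / 8`. One of the two copies of `Bv` in `Q` pays for the corrector here, the other at
  -- the maximum point.
  have htarget : Bv + 5 * μ / 8 ≤ w i₀ x₀ t₀ - u x₀ t₀ - ε * V i₀ 0 (ε⁻¹ • x₀)
      - penalty ε η A γ α σ δ B T k x₀ x₀ (ε⁻¹ • x₀) 0 t₀ t₀ := by
    have h1 := abs_le.1 (hvB i₀ 0 (ε⁻¹ • x₀))
    have h2 : σ * t₀ ≤ (D * lam + 4 * CH * κ) * T + μ / 8 := by
      have h3 := mul_le_mul_of_nonneg_left ht₀.2.le hσ
      have h4 : σ₁ * T = μ / 8 := by rw [hσ₁]; field_simp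
      have h5 : σ * T = (D * lam + 4 * CH * κ) * T + μ / 8 := by rw [hσdef, add_mul _ σ₁, h4]
      linarith
    simp only [penalty, smul_smul, mul_inv_cancel₀ hε.ne', one_smul, smoothDist_self hη,
      add_zero, sub_self, norm_zero, hV]
    norm_num
    linarith
  obtain ⟨i, x, y, ξ, d, t, s, ht, hs, hmax⟩ := exists_doubling_max (k := k) (η := η) hε hA hL hγ
    hα hσ hδ hB0 hT hwc huc hVc hbd (i₀ := i₀) (Ico_subset_Icc_self ht₀)
    (Ico_subset_Icc_self ht₀) (lt_of_lt_of_le (by positivity) htarget)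
  have hval := htarget.trans (hmax i₀ x₀ x₀ (ε⁻¹ • x₀) 0 t₀ (Ico_subset_Icc_self ht₀) t₀
    (Ico_subset_Icc_self ht₀))
  have n1 : 0 ≤ ‖x - ε • ξ‖ ^ 2 / (2 * (ε * γ)) := by positivity
  have n2 : (L + 1) * ‖x - y‖ ≤ A * smoothDist η y x := by
    rw [hA]; exact mul_le_mul_of_nonneg_left (norm_sub_le_smoothDist η y x) (by linarith)
  have n3 : 0 ≤ ‖x - (y + d)‖ ^ 2 / (2 * γ) := by positivity
  have n4 : 0 ≤ (t - s) ^ 2 / (2 * α) := by positivity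
  have n5 : 0 ≤ σ * t := mul_nonneg hσ ht.1
  have n6 : 0 ≤ δ * smoothDist 1 0 y := mul_nonneg hδ.le (smoothDist_pos one_pos 0 y).le
  have n7 := mul_div_pow_nonneg hB0 hT k ht.1
  have n8 := mul_div_pow_nonneg hB0 hT k hs.1
  have n9 := norm_nonneg (x - y)
  have hvBm := abs_le.1 (hvB i d ξ)
  have hwum := hwu i x y t ht s hs
  have hbdm := hbd i x y d ξ t ht s hs
  simp only [penalty, hV] at hval hbdm
  -- the maximum point is interior in time
  have ht0 : 0 < t := by
    refine lt_of_le_of_ne ht.1 fun h => ?_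
    subst h
    have h1 := mul_sub_sq_div_le (K := K) (r := s) hα
    have h2 : (0 - s) ^ 2 = s ^ 2 := by ring
    rw [h2] at hval
    linarith
  have hs0 : 0 < s := by
    refine lt_of_le_of_ne hs.1 fun h => ?_
    subst h
    have h1 := mul_sub_sq_div_le (K := K) (r := t) hα
    rw [sub_zero] at hval
    linarith
  have htT : t < T := by
    refine lt_of_le_of_ne ht.2 fun h => ?_
    rw [h, div_self hT.ne', one_pow] at hval
    rw [h] at n4 n5 hbdm
    linarith
  have hsT : s < T := by
    refine lt_of_le_of_ne hs.2 fun h => ?_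
    rw [h, div_self hT.ne', one_pow] at hval
    rw [h] at n4 hbdm
    linarith
  -- distances at the maximum point
  have hξx : ‖ξ - ε⁻¹ • x‖ ≤ 2 * γ * Λ := by
    refine le_of_sq_div_le (norm_nonneg _) hγ hΛ ?_
    have h1 := hmax i x y (ε⁻¹ • x) d t ht s hs
    simp only [penalty, hV, fast_penalty_eq hε, sub_self, norm_zero] at h1
    norm_num at h1
    have h2 := abs_le.1 (hvL _ (hN d) i (ε⁻¹ • x) ξ)
    rw [norm_sub_rev] at h2
    have h3 : ε * (‖ξ - ε⁻¹ • x‖ ^ 2 / (2 * γ))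
        ≤ ε * (v i (slope A η d) (ε⁻¹ • x) - v i (slope A η d) ξ) := by linarith
    have h4 := le_of_mul_le_mul_left h3 hε
    linarith
  -- Moving `d` alone to `x - y` removes this penalty and costs at most `κ` times the distance. This
  -- separate copy is needed since `v` is only Lipschitz in `P` and cannot be differentiated there.
  have hdxy : ‖x - (y + d)‖ ≤ 2 * γ * κ := by
    refine le_of_sq_div_le (norm_nonneg _) hγ hκ ?_
    have h1 := hmax i x y ξ (x - y) t ht s hs
    simp only [penalty, add_sub_cancel, sub_self, norm_zero] at h1
    norm_num at h1
    have h2 := hVd i (x - y) d ξ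
    have e : x - y - d = x - (y + d) := by abel
    rw [e] at h2
    have h3 := mul_le_mul_of_nonneg_left (abs_le.1 h2).2 hε.le
    rw [hκdef]
    linarith
  set ρ : E n := γ⁻¹ • (x - (y + d)) with hρ
  set r : E n := γ⁻¹ • (ε⁻¹ • x - ξ) with hr
  have hρn : ‖ρ‖ ≤ 2 * κ := by
    rw [hρ, norm_smul, norm_inv, Real.norm_of_nonneg hγ.le, inv_mul_le_iff₀ hγ]
    linarith
  have hrn : ‖r‖ ≤ 2 * Λ := by
    rw [hr, norm_smul, norm_inv, Real.norm_of_nonneg hγ.le, inv_mul_le_iff₀ hγ, norm_sub_rev]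
    linarith
  obtain ⟨j, hij⟩ := exists_ne i
  -- the inequality for the corrector
  have hcell : 0 ≤ H i ξ (slope A η d + r) + lam * v i (slope A η d) ξ
      + (v i (slope A η d) ξ - v j (slope A η d) ξ) := by
    have hp : HasGradientAt (fun ξ' => -(‖ξ' - ε⁻¹ • x‖ ^ 2 / (2 * γ))) r ξ := by
      have := hasGradientAt_neg (hasGradientAt_half_sq γ (ε⁻¹ • x) ξ)
      rwa [← smul_neg, neg_sub] at this
    refine (hvs _ (hN d) i j hij.symm).le (contDiff_half_sq γ (ε⁻¹ • x)).neg.contDiffAt hp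
      (Eventually.of_forall fun ξ' => ?_)
    have h1 := hmax i x y ξ' d t ht s hs
    simp only [penalty, hV, fast_penalty_eq hε] at h1
    simp only
    have h3 : ε * (v i (slope A η d) ξ + ‖ξ - ε⁻¹ • x‖ ^ 2 / (2 * γ))
        ≤ ε * (v i (slope A η d) ξ' + ‖ξ' - ε⁻¹ • x‖ ^ 2 / (2 * γ)) := by linarith
    have h4 := le_of_mul_le_mul_left h3 hε
    linarith
  -- the inequality for the system
  have hsl : A • ((smoothDist η y x)⁻¹ • (x - y)) = slope A η (x - y) := by
    simp [slope, smoothDist]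
  -- The factor `ε` in the fast penalty makes its gradient in `x` equal to the gradient `r` that
  -- tests the corrector in `ξ`.
  have hr' : (ε * γ)⁻¹ • (x - ε • ξ) = r := by
    rw [hr, smul_sub, smul_sub, smul_smul, smul_smul, mul_inv, mul_comm ε⁻¹, mul_assoc,
      inv_mul_cancel₀ hε.ne', mul_one]
  have hw1 : ((t - s) / α + σ + B * (k * (t / T) ^ (k - 1) * (1 / T)))
      + (H i (ε⁻¹ • x) (r + slope A η (x - y) + ρ) + (w i x t - w j x t) / ε) ≤ 0 := by
    set φx : E n → ℝ := fun x' => ‖x' - ε • ξ‖ ^ 2 / (2 * (ε * γ)) + A * smoothDist η y x'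
      + ‖x' - (y + d)‖ ^ 2 / (2 * γ) with hφx
    set φt : ℝ → ℝ := fun t' => (t' - s) ^ 2 / (2 * α) + σ * t' + B * (t' / T) ^ k with hφt
    have hxcd : ContDiff ℝ 1 φx :=
      ((contDiff_half_sq _ _).add (contDiff_const.mul (contDiff_smoothDist hη y))).add
        (contDiff_half_sq _ _)
    have htcd : ContDiff ℝ 1 φt := by
      simp only [hφt]; fun_prop
    have hgx : HasGradientAt φx (r + slope A η (x - y) + ρ) x := by
      have h1 := hasGradientAt_add (hasGradientAt_add (hasGradientAt_half_sq (ε * γ) (ε • ξ) x)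
        (hasGradientAt_const_mul A (hasGradientAt_smoothDist hη y x)))
        (hasGradientAt_half_sq γ (y + d) x)
      rwa [hsl, hr'] at h1
    have hdt : HasDerivAt φt ((t - s) / α + σ + B * (k * (t / T) ^ (k - 1) * (1 / T))) t := by
      have h1 : HasDerivAt (fun t' : ℝ => (t' - s) ^ 2 / (2 * α)) ((t - s) / α) t := by
        have h : HasDerivAt (fun t' : ℝ => (t' - s) ^ 2 / (2 * α))
            (((2 : ℕ) * (t - s) ^ (2 - 1) * 1) / (2 * α)) t :=
          (((hasDerivAt_id t).sub_const s).pow 2).div_const (2 * α)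
        convert h using 1
        norm_num
        field_simp
      have h2 : HasDerivAt (fun t' : ℝ => σ * t') σ t := by
        simpa using (hasDerivAt_id t).const_mul σ
      exact (h1.add h2).add (hasDerivAt_mul_div_pow B T k t)
    refine (hsub i j hij.symm).le (φ := fun z => φx z.1 + φt z.2) ht0 htT
      ((hxcd.comp contDiff_fst).add (htcd.comp contDiff_snd)).contDiffAt
      (by simpa using hasGradientAt_add hgx (hasGradientAt_const x (φt t)))
      (hdt.const_add (φx x)) ?_
    have hnh : (univ : Set (E n)) ×ˢ Icc 0 T ∈ 𝓝 (x, t) :=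
      prod_mem_nhds univ_mem (Icc_mem_nhds ht0 htT)
    filter_upwards [hnh] with z hz
    have h1 := hmax i z.1 y ξ d z.2 hz.2 s hs
    simp only [penalty] at h1
    simp only [hφx, hφt]
    linarith
  -- the inequality for the limit equation
  set e : E n := (smoothDist 1 0 y)⁻¹ • (y - 0) with he
  have hen : ‖e‖ ≤ 1 := norm_inv_smoothDist_smul_le one_pos 0 y
  have hu1 : 0 ≤ ((t - s) / α - B * (k * (s / T) ^ (k - 1) * (1 / T)))
      + Hb (slope A η (x - y) + ρ - δ • e) := by
    set φy : E n → ℝ := fun y' => -(A * smoothDist η x y' + ‖y' - (x - d)‖ ^ 2 / (2 * γ)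
      + δ * smoothDist 1 0 y') with hφy
    set φs : ℝ → ℝ := fun s' => -((t - s') ^ 2 / (2 * α) + B * (s' / T) ^ k) with hφs
    have hycd : ContDiff ℝ 1 φy :=
      (((contDiff_const.mul (contDiff_smoothDist hη x)).add (contDiff_half_sq _ _)).add
        (contDiff_const.mul (contDiff_smoothDist one_pos 0))).neg
    have hscd : ContDiff ℝ 1 φs := by
      simp only [hφs]; fun_prop
    have hgy : HasGradientAt φy (slope A η (x - y) + ρ - δ • e) y := by
      have h1 := hasGradientAt_neg (hasGradientAt_add (hasGradientAt_add
        (hasGradientAt_const_mul A (hasGradientAt_smoothDist hη x y))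
        (hasGradientAt_half_sq γ (x - d) y))
        (hasGradientAt_const_mul δ (hasGradientAt_smoothDist one_pos 0 y)))
      have e1 : A • ((smoothDist η x y)⁻¹ • (y - x)) = -slope A η (x - y) := by
        rw [← hsl, smoothDist_comm, ← smul_neg, ← smul_neg, neg_sub]
      have e2 : γ⁻¹ • (y - (x - d)) = -ρ := by
        rw [hρ, ← smul_neg]; congr 1; abel
      rw [e1, e2] at h1
      have e3 : -(-slope A η (x - y) + -ρ + δ • (smoothDist 1 0 y)⁻¹ • (y - 0))
          = slope A η (x - y) + ρ - δ • e := by rw [he]; abel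
      rwa [e3] at h1
    have hds : HasDerivAt φs ((t - s) / α - B * (k * (s / T) ^ (k - 1) * (1 / T))) s := by
      have h1 : HasDerivAt (fun s' : ℝ => (t - s') ^ 2 / (2 * α)) (-((t - s) / α)) s := by
        have h : HasDerivAt (fun s' : ℝ => (t - s') ^ 2 / (2 * α))
            (((2 : ℕ) * (t - s) ^ (2 - 1) * -1) / (2 * α)) s :=
          (((hasDerivAt_id s).const_sub t).pow 2).div_const (2 * α)
        convert h using 1
        norm_num
        field_simp
      have h2 := (h1.add (hasDerivAt_mul_div_pow B T k s)).neg
      have e1 : (t - s) / α - B * (k * (s / T) ^ (k - 1) * (1 / T))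
          = -(-((t - s) / α) + B * (k * (s / T) ^ (k - 1) * (1 / T))) := by ring
      rw [e1]
      exact h2
    refine hsup.le (φ := fun z => φy z.1 + φs z.2) hs0 hsT
      ((hycd.comp contDiff_fst).add (hscd.comp contDiff_snd)).contDiffAt
      (by simpa using hasGradientAt_add hgy (hasGradientAt_const y (φs s)))
      (hds.const_add (φy y)) ?_
    have hnh : (univ : Set (E n)) ×ˢ Icc 0 T ∈ 𝓝 (y, s) :=
      prod_mem_nhds univ_mem (Icc_mem_nhds hs0 hsT)
    filter_upwards [hnh] with z hz
    have h1 := hmax i x z.1 ξ d t ht z.2 hz.2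
    have e1 : ∀ y' : E n, ‖x - (y' + d)‖ = ‖y' - (x - d)‖ := fun y' => by
      rw [← norm_neg]; congr 1; abel
    simp only [penalty, e1, smoothDist_comm η _ x] at h1
    simp only [hφy, hφs]
    linarith
  -- conclusion
  have hcoup : v i (slope A η d) ξ - v j (slope A η d) ξ ≤ (w i x t - w j x t) / ε := by
    have h1 := hmax j x y ξ d t ht s hs
    simp only [hV] at h1
    rw [le_div_iff₀ hε]
    linarith
  have hslope : ‖slope A η (x - y) - slope A η d‖ ≤ τ := by
    refine (norm_slope_sub_le hA1.le hη _ _).trans ?_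
    have e1 : x - y - d = x - (y + d) := by abel
    rw [e1]
    exact (mul_le_mul_of_nonneg_left hdxy (by positivity)).trans hγτ
  have hUCm : |H i (ε⁻¹ • x) (slope A η d + r) - H i ξ (slope A η d + r)| < τ :=
    hUC' i _ _ _ ((norm_add_le _ _).trans (add_le_add (hN d) hrn)) (by
      rw [norm_sub_rev]; exact hξx.trans_lt (hγδ.trans_le (hi₁ i)))
  have hHm : |H i (ε⁻¹ • x) (r + slope A η (x - y) + ρ) - H i (ε⁻¹ • x) (slope A η d + r)|
      ≤ CH * (τ + 2 * κ) := by
    refine (hH i _ _ _).trans (mul_le_mul_of_nonneg_left ?_ hCH)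
    have e1 : r + slope A η (x - y) + ρ - (slope A η d + r)
        = (slope A η (x - y) - slope A η d) + ρ := by abel
    rw [e1]
    exact (norm_add_le _ _).trans (add_le_add hslope hρn)
  have hHbm : |Hb (slope A η (x - y) + ρ - δ • e) - Hb (slope A η d)| ≤ CH * (τ + 2 * κ + τ) := by
    refine (hHb _ _).trans (mul_le_mul_of_nonneg_left ?_ hCH)
    have e1 : slope A η (x - y) + ρ - δ • e - slope A η d
        = (slope A η (x - y) - slope A η d) + ρ - δ • e := by abel
    rw [e1]
    refine (norm_sub_le _ _).trans (add_le_add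
      ((norm_add_le _ _).trans (add_le_add hslope hρn)) ?_)
    rw [norm_smul, Real.norm_of_nonneg hδ.le]
    exact (mul_le_of_le_one_right hδ.le hen).trans hδτ
  have hvHm := hvH _ (hN d) i ξ
  have p1 : 0 ≤ B * (k * (t / T) ^ (k - 1) * (1 / T)) := by
    have := div_nonneg ht.1 hT.le
    positivity
  have p2 : 0 ≤ B * (k * (s / T) ^ (k - 1) * (1 / T)) := by
    have := div_nonneg hs.1 hT.le
    positivity
  have q1 := abs_lt.1 hUCm
  have q2 := abs_le.1 hHm
  have q3 := abs_le.1 hHbm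
  -- Subtracting the inequalities cancels `(t - s) / α` and the coupling. `H` and `Hb` each
  -- contribute `2 CH κ`, and the errors in `τ` add up to `(3 CH + 1) τ = σ₁ / 2`, which is less
  -- than the reserve `σ₁`.
  have : σ ≤ D * lam + 4 * CH * κ + (3 * CH + 1) * τ := by linarith
  rw [hτσ] at this
  linarith

end Doubling

/-! ### The rate of convergence -/

section Rate

variable {n : ℕ}

/-- For every bound on `P` there are approximate correctors, supersolutions of the discounted cell
problem whose discounted values are close to `-Hb P`, with uniform estimates. -/
def HasSuperCorrectors (H : Fin 2 → E n → E n → ℝ) (Hb : E n → ℝ) (CH : ℝ) : Prop :=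
  ∀ A : ℝ, ∃ Λ M D : ℝ, 0 ≤ Λ ∧ 0 ≤ M ∧ 0 ≤ D ∧ ∀ lam, 0 < lam → ∃ v : Fin 2 → E n → E n → ℝ,
    (∀ P, ‖P‖ ≤ A → ∀ i x y, |v i P x - v i P y| ≤ Λ * ‖x - y‖) ∧
    (∀ P, ‖P‖ ≤ A → ∀ i ξ, |lam * v i P ξ| ≤ M) ∧
    (∀ P Q, ‖P‖ ≤ A → ‖Q‖ ≤ A → ∀ i ξ, |v i P ξ - v i Q ξ| ≤ CH / lam * ‖P - Q‖) ∧
    (∀ P, ‖P‖ ≤ A → ∀ i ξ, lam * v i P ξ + Hb P ≤ D * lam) ∧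
    (∀ P, ‖P‖ ≤ A → IsDiscountSuper lam (fun i ξ p => H i ξ (P + p)) (fun i => v i P))

theorem lipschitz_of_norm_gradient_le {f : E n → ℝ} (hf : ContDiff ℝ 1 f) {L : ℝ}
    (h : ∀ x, ‖gradient f x‖ ≤ L) (x y : E n) : |f x - f y| ≤ L * ‖x - y‖ := by
  have := (convex_univ (𝕜 := ℝ) (E := E n)).norm_image_sub_le_of_norm_fderiv_le (f := f) (C := L)
    (fun z _ => hf.differentiable one_ne_zero z) (fun z _ => by
      have := h z
      rwa [gradient, LinearIsometryEquiv.norm_map] at this) (mem_univ y) (mem_univ x)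
  simpa using this

theorem hasDerivAt_exp_layer (ε t : ℝ) :
    HasDerivAt (fun s => Real.exp (-(2 * s / ε))) (-(2 / ε) * Real.exp (-(2 * t / ε))) t := by
  have h1 : HasDerivAt (fun s => -(2 * s / ε)) (-(2 * 1 / ε)) t :=
    (((hasDerivAt_id t).const_mul 2).div_const ε).neg
  have h2 := h1.exp
  rw [mul_one] at h2
  rwa [mul_comm] at h2

theorem contDiff_exp_layer (ε : ℝ) : ContDiff ℝ 1 (fun s : ℝ => Real.exp (-(2 * s / ε))) := by
  fun_prop

/-- Subtracting the initial layer from a subsolution of the system leaves a subsolution. -/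
theorem systemSub_sub_layer {H : Fin 2 → E n → E n → ℝ} {CH : ℝ} (hCH : 0 ≤ CH)
    (hH : ∀ i (ξ p q : E n), |H i ξ p - H i ξ q| ≤ CH * ‖p - q‖) {T ε L : ℝ} (hε : 0 < ε)
    {q : Fin 2 → E n → ℝ} (hq : ∀ i, ContDiff ℝ 1 (q i)) (hqL : ∀ i x, ‖gradient (q i) x‖ ≤ L)
    (hqanti : ∀ i j, i ≠ j → ∀ x, q j x = -q i x) {uε : Fin 2 → E n → ℝ → ℝ}
    (hsub : ∀ i j, i ≠ j →
      IsEvolViscSub T (fun x t p => H i (ε⁻¹ • x) p + (uε i x t - uε j x t) / ε) (uε i))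
    {w : Fin 2 → E n → ℝ → ℝ}
    (hw : ∀ i x t, w i x t = uε i x t - q i x * Real.exp (-(2 * t / ε))
      - CH * L * ε / 2 * (1 - Real.exp (-(2 * t / ε)))) (i j : Fin 2) (hij : i ≠ j) :
    IsEvolViscSub T (fun x t p => H i (ε⁻¹ • x) p + (w i x t - w j x t) / ε) (w i) := by
  intro φ x t ht htT hφ hmax
  set E₁ : ℝ := Real.exp (-(2 * t / ε)) with hE₁
  have hE₁pos : 0 < E₁ := Real.exp_pos _
  set p := gradient (fun y => φ (y, t)) x with hp
  set b := deriv (fun s => φ (x, s)) t with hb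
  have hgφ : HasGradientAt (fun y => φ (y, t)) p x :=
    hasGradientAt_of_contDiffAt
      (ContDiffAt.comp (g := φ) (f := fun y : E n => (y, t)) x hφ (by fun_prop))
  have hdφ : HasDerivAt (fun s => φ (x, s)) b t :=
    ((ContDiffAt.comp (g := φ) (f := fun s : ℝ => (x, s)) t hφ
      (by fun_prop)).differentiableAt one_ne_zero).hasDerivAt
  have hgq := hasGradientAt_of_contDiffAt (hq i).contDiffAt (x := x)
  have h := (hsub i j hij).le (φ := fun z => φ z + q i z.1 * Real.exp (-(2 * z.2 / ε))
      + CH * L * ε / 2 * (1 - Real.exp (-(2 * z.2 / ε)))) (x := x) (t := t)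
    (p := p + E₁ • gradient (q i) x)
    (b := b + q i x * (-(2 / ε) * E₁) + CH * L * ε / 2 * (0 - -(2 / ε) * E₁)) ht htT
    (((hφ.add (((hq i).comp contDiff_fst).mul
      ((contDiff_exp_layer ε).comp contDiff_snd)).contDiffAt)).add
      (contDiff_const.mul (contDiff_const.sub
        ((contDiff_exp_layer ε).comp contDiff_snd))).contDiffAt) ?_ ?_ ?_
  -- The extra coupling `2 q i E₁ / ε` cancels the time derivative of the layer; the derivative `CH
  -- L E₁` of the last correction pays for the gradient of the layer inside `H`.
  · have e1 : uε i x t - uε j x t = (w i x t - w j x t) + 2 * (q i x * E₁) := by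
      rw [hw i, hw j, hqanti i j hij]; ring
    have h1 := (abs_le.1 (hH i (ε⁻¹ • x) (p + E₁ • gradient (q i) x) p)).1
    have h2 : ‖p + E₁ • gradient (q i) x - p‖ ≤ E₁ * L := by
      rw [add_sub_cancel_left, norm_smul, Real.norm_of_nonneg hE₁pos.le]
      exact mul_le_mul_of_nonneg_left (hqL i x) hE₁pos.le
    have h3 := mul_le_mul_of_nonneg_left h2 hCH
    have e2 : (uε i x t - uε j x t) / ε = (w i x t - w j x t) / ε + 2 / ε * (q i x * E₁) := by
      rw [e1]; ring
    have e3 : CH * L * ε / 2 * (0 - -(2 / ε) * E₁) = CH * (E₁ * L) := by field_simp; ring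
    rw [e2, e3] at h
    linarith
  · have h1 := hasGradientAt_add (hasGradientAt_add hgφ (hasGradientAt_const_mul E₁ hgq))
      (hasGradientAt_const x (CH * L * ε / 2 * (1 - E₁)))
    rw [add_zero] at h1
    simpa only [mul_comm E₁] using h1
  · exact (hdφ.add ((hasDerivAt_exp_layer ε t).const_mul (q i x))).add
      (((hasDerivAt_const t (1 : ℝ)).sub (hasDerivAt_exp_layer ε t)).const_mul _)
  · filter_upwards [hmax] with z hz
    rw [hw, hw] at hz
    linarith

/-- A supersolution of the effective equation stays above `g - K t` if it starts above `g`. -/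
theorem sub_mul_le_of_effectiveSuper {Hb : E n → ℝ} {CH T : ℝ} (hCH : 0 ≤ CH)
    (hHb : ∀ p q, |Hb p - Hb q| ≤ CH * ‖p - q‖) (hT : 0 < T) {u : E n → ℝ → ℝ}
    (huc : ContinuousOn (fun z : E n × ℝ => u z.1 z.2) (univ ×ˢ Icc 0 T))
    (hsup : IsEvolViscSuper T (fun _ _ p => Hb p) u) {g : E n → ℝ} (hg : ContDiff ℝ 1 g) {K : ℝ}
    (hK : ∀ x, Hb (gradient g x) ≤ K) (h0 : ∀ x, g x ≤ u x 0) (x : E n) {t : ℝ}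
    (ht : t ∈ Icc 0 T) : g x - K * t ≤ u x t := by
  -- The scalar equation is read as a system with two equal components, so the coupling vanishes and
  -- the value `ε = 1` is immaterial.
  have h := le_add_mul_of_systemSub (G := fun _ _ p => -Hb (-p)) (w := fun _ x t => -u x t)
    (g := fun x => -g x) (ε := 1) (K := K) hCH (fun _ _ p q => by
      have := hHb (-q) (-p)
      rw [show -Hb (-p) - -Hb (-q) = Hb (-q) - Hb (-p) by ring]
      rwa [show -q - -p = p - q by abel] at this) one_pos hT (fun _ => huc.neg)
    (fun _ _ _ => by simpa using hsup.neg) hg.neg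
    (fun _ x => by
      rw [gradient_neg', neg_neg]
      linarith [hK x]) (fun _ x => by linarith [h0 x]) 0 x ht
  linarith

theorem one_sub_exp_neg_le (s : ℝ) : 1 - Real.exp (-s) ≤ s := by
  have := Real.add_one_le_exp (-s)
  linarith

/-- The upper half of the estimate. -/
theorem exists_rate_upper {H : Fin 2 → E n → E n → ℝ} {Hb : E n → ℝ} {CH : ℝ}
    (hCH : 0 ≤ CH) (hH : ∀ i (ξ p q : E n), |H i ξ p - H i ξ q| ≤ CH * ‖p - q‖)
    (hHb : ∀ p q, |Hb p - Hb q| ≤ CH * ‖p - q‖) (hUC : ∀ i, UniformContInX (H i))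
    (hbdd : ∀ i R, ∃ K, 0 < K ∧ ∀ ξ p, ‖p‖ ≤ R → |H i ξ p| ≤ K)
    (hcorr : HasSuperCorrectors H Hb CH) {f : Fin 2 → E n → ℝ} (hf : ∀ i, ContDiff ℝ 1 (f i))
    {L : ℝ} (hDf : ∀ i x, ‖gradient (f i) x‖ ≤ L) {T : ℝ} (hT : 0 < T) :
    ∃ C : ℝ, 0 < C ∧ ∀ u : E n → ℝ → ℝ,
      ContinuousOn (fun z : E n × ℝ => u z.1 z.2) (univ ×ˢ Icc 0 T) →
      IsEvolViscSuper T (fun _ _ p => Hb p) u → (∀ x, u x 0 = (f 0 x + f 1 x) / 2) →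
      ∀ ε : ℝ, 0 < ε → ∀ uε : Fin 2 → E n → ℝ → ℝ,
      (∀ i, ContinuousOn (fun z : E n × ℝ => uε i z.1 z.2) (univ ×ˢ Icc 0 T)) →
      (∀ i j, i ≠ j →
        IsEvolViscSub T (fun x t p => H i (ε⁻¹ • x) p + (uε i x t - uε j x t) / ε) (uε i)) →
      (∀ i x, uε i x 0 = f i x) →
      ∀ i j : Fin 2, i ≠ j → ∀ x : E n, ∀ t ∈ Icc (0 : ℝ) T,
        uε i x t - matched f ε u i j x t ≤ C * ε ^ ((1 : ℝ) / 3) := by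
  have hL : 0 ≤ L := (norm_nonneg _).trans (hDf 0 0)
  choose K₀ hK₀ hK₀b using fun i => hbdd i L
  set K := K₀ 0 + K₀ 1 + (|Hb 0| + CH * L) with hKdef
  have hK : 0 ≤ K := by
    have := hK₀ 0; have := hK₀ 1
    positivity
  have hKH : ∀ i ξ p, ‖p‖ ≤ L → |H i ξ p| ≤ K := fun i ξ p hp => by
    refine (hK₀b i ξ p hp).trans ?_
    have h0 := hK₀ 0; have h1 := hK₀ 1
    have h2 : 0 ≤ |Hb 0| + CH * L := by positivity
    fin_cases i <;> simp [hKdef] <;> linarith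
  have hKHb : ∀ p, ‖p‖ ≤ L → Hb p ≤ K := fun p hp => by
    have h0 := hK₀ 0; have h1 := hK₀ 1
    have h2 := (abs_le.1 (hHb p 0)).2
    rw [sub_zero] at h2
    have h3 := mul_le_mul_of_nonneg_left hp hCH
    have h4 := le_abs_self (Hb 0)
    linarith
  obtain ⟨Λ, M, D, hΛ, hM, hD, hv⟩ := hcorr (L + 1)
  set A := L + 1 with hA
  have hA0 : 0 < A := by positivity
  set K₁ := CH * L with hK₁
  have hK₁0 : 0 ≤ K₁ := by positivity
  -- The coefficient of `e = ε^{1/3}` in the doubling estimate with `λ = η = e`, using `e² ≤ e` for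
  -- the corrector term.
  set C₁ := A + 2 * M + (D + 8 * CH ^ 2 * A) * T with hC₁
  have hC₁0 : 0 < C₁ := by positivity
  have hC₂0 : 0 ≤ K₁ / 2 := by positivity
  have hC₃0 : 0 ≤ (2 * K + K₁) * T := by positivity
  refine ⟨C₁ + K₁ / 2 + (2 * K + K₁) * T, by positivity, ?_⟩
  intro u huc hsup hu0 ε hε uε huεc hsub huε0 i j hij x t ht
  set g : E n → ℝ := fun x => (f 0 x + f 1 x) / 2 with hg
  have hgc : ContDiff ℝ 1 g := ((hf 0).add (hf 1)).div_const 2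
  have hgD : ∀ x, ‖gradient g x‖ ≤ L := fun x => by
    have h1 := hasGradientAt_const_mul (1 / 2) (hasGradientAt_add
      (hasGradientAt_of_contDiffAt (hf 0).contDiffAt (x := x))
      (hasGradientAt_of_contDiffAt (hf 1).contDiffAt (x := x)))
    have h2 : HasGradientAt g _ x := h1.congr_of_eventuallyEq
      (Eventually.of_forall fun y => by simp only [hg]; ring)
    rw [h2.gradient, norm_smul]
    have h3 := norm_add_le (gradient (f 0) x) (gradient (f 1) x)
    have := hDf 0 x; have := hDf 1 x
    norm_num
    linarith
  set q : Fin 2 → E n → ℝ := fun i x => (f i x - f (i + 1) x) / 2 with hq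
  have hqc : ∀ i, ContDiff ℝ 1 (q i) := fun i => ((hf i).sub (hf (i + 1))).div_const 2
  have hqD : ∀ i x, ‖gradient (q i) x‖ ≤ L := fun i x => by
    have h1 := hasGradientAt_const_mul (1 / 2) (hasGradientAt_sub
      (hasGradientAt_of_contDiffAt (hf i).contDiffAt (x := x))
      (hasGradientAt_of_contDiffAt (hf (i + 1)).contDiffAt (x := x)))
    have h2 : HasGradientAt (q i) _ x := h1.congr_of_eventuallyEq
      (Eventually.of_forall fun y => by simp only [hq]; ring)
    rw [h2.gradient, norm_smul]
    have h3 := norm_sub_le (gradient (f i) x) (gradient (f (i + 1)) x)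
    have := hDf i x; have := hDf (i + 1) x
    norm_num
    linarith
  have hother : ∀ i j : Fin 2, i ≠ j → j = i + 1 ∧ i = j + 1 := by decide
  have hqanti : ∀ i j, i ≠ j → ∀ x, q j x = -q i x := fun i j hij x => by
    obtain ⟨h1, h2⟩ := hother i j hij
    simp only [hq]
    rw [← h1, ← h2]; ring
  set w : Fin 2 → E n → ℝ → ℝ := fun i x t => uε i x t - q i x * Real.exp (-(2 * t / ε))
      - K₁ * ε / 2 * (1 - Real.exp (-(2 * t / ε))) with hw
  have hwc : ∀ i, ContinuousOn (fun z : E n × ℝ => w i z.1 z.2) (univ ×ˢ Icc 0 T) := fun i => by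
    have h1 : Continuous (fun z : E n × ℝ => q i z.1) := (hqc i).continuous.comp continuous_fst
    refine ((huεc i).sub (h1.mul (by fun_prop)).continuousOn).sub (by fun_prop)
  have hwsub := systemSub_sub_layer hCH hH hε hqc hqD hqanti hsub (w := w) (fun i x t => rfl)
  have hw0 : ∀ i x, w i x 0 = g x := fun i x => by
    have h2 : ∀ i : Fin 2, f i x + f (i + 1) x = f 0 x + f 1 x := by
      intro i; fin_cases i
      · rfl
      · simpa using add_comm (f 1 x) (f 0 x)
    have h3 := h2 i
    simp only [hw, hq, hg, huε0]
    norm_num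
    linarith
  have hwg : ∀ i x, ∀ t ∈ Icc 0 T, w i x t ≤ g x + K * t := fun i x t ht =>
    le_add_mul_of_systemSub (G := fun i x p => H i (ε⁻¹ • x) p) hCH
      (fun i x p q => hH i _ p q) hε hT hwc hwsub hgc
      (fun i x => (abs_le.1 (hKH i _ _ (hgD x))).1) (fun i x => (hw0 i x).le) i x ht
  have hug : ∀ x, ∀ t ∈ Icc 0 T, g x - K * t ≤ u x t := fun x t ht =>
    sub_mul_le_of_effectiveSuper hCH hHb hT huc hsup hgc (fun x => hKHb _ (hgD x))
      (fun x => (hu0 x).ge) x ht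
  have hm : uε i x t - matched f ε u i j x t
      = (w i x t - u x t) + K₁ * ε / 2 * (1 - Real.exp (-(2 * t / ε))) := by
    simp only [matched, hw, hq]
    rw [(hother i j hij).1]; ring
  rw [hm]
  set e := ε ^ ((1 : ℝ) / 3) with he
  have he0 : 0 < e := Real.rpow_pos_of_pos hε _
  have he3 : ε = e ^ 3 := by
    rw [he, ← Real.rpow_natCast, ← Real.rpow_mul hε.le]
    norm_num
  have hexp0 : 0 < Real.exp (-(2 * t / ε)) := Real.exp_pos _
  rcases le_total ε 1 with hε1 | hε1
  · have he1 : e ≤ 1 := Real.rpow_le_one hε.le hε1 (by norm_num)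
    have he2 : e ^ 2 ≤ e := by nlinarith
    have hεe : ε ≤ e := by rw [he3]; nlinarith [mul_pos he0 he0]
    obtain ⟨v, h1, h2, h3, h4, h5⟩ := hv e he0
    have hmain := systemSub_sub_effectiveSuper_le hCH hH hHb hUC hε he0 he0 hT hΛ hM hD hK hL hA
      h1 h2 h3 h4 h5 hwc hwsub huc hsup (lipschitz_of_norm_gradient_le hgc hgD) hwg hug i x ht
    have e1 : ε * (M / e) = M * e ^ 2 := by rw [he3]; field_simp
    have e2 : ε * (CH / e * (2 * A / e)) = 2 * CH * A * e := by rw [he3]; field_simp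
    rw [e1, e2] at hmain
    have h6 := mul_le_mul_of_nonneg_left he2 hM
    have h7 : K₁ * ε / 2 * (1 - Real.exp (-(2 * t / ε))) ≤ K₁ / 2 * e := by
      have h8 : K₁ * ε / 2 * (1 - Real.exp (-(2 * t / ε))) ≤ K₁ * ε / 2 * 1 :=
        mul_le_mul_of_nonneg_left (by linarith) (by positivity)
      have h9 := mul_le_mul_of_nonneg_left hεe hC₂0
      linarith
    have h10 : A * e + 2 * (M * e ^ 2) + (D * e + 4 * CH * (2 * CH * A * e)) * T ≤ C₁ * e := by
      rw [hC₁]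
      have : (A + 2 * M + (D + 8 * CH ^ 2 * A) * T) * e
          = A * e + 2 * (M * e) + (D * e + 4 * CH * (2 * CH * A * e)) * T := by ring
      linarith
    have h11 := mul_nonneg hC₃0 he0.le
    rw [add_mul, add_mul]
    linarith
  -- For `ε ≥ 1` both solutions stay within `K t` of `g`. Here `1 - exp(-s) ≤ s` is essential: it
  -- bounds the layer correction by `K₁ T`, whereas `K₁ ε / 2` alone grows faster than `ε^{1/3}`.
  · have he1 : 1 ≤ e := Real.one_le_rpow hε1 (by norm_num)
    have h1 := hwg i x t ht
    have h2 := hug x t ht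
    have h3 := mul_le_mul_of_nonneg_left ht.2 hK
    have h4 : K₁ * ε / 2 * (1 - Real.exp (-(2 * t / ε))) ≤ K₁ * T := by
      have h5 := mul_le_mul_of_nonneg_left (one_sub_exp_neg_le (2 * t / ε))
        (show 0 ≤ K₁ * ε / 2 by positivity)
      have h6 : K₁ * ε / 2 * (2 * t / ε) = K₁ * t := by field_simp
      have h7 := mul_le_mul_of_nonneg_left ht.2 hK₁0
      linarith
    have h5 := mul_le_mul_of_nonneg_left he1 hC₃0
    have h6 : 0 ≤ (C₁ + K₁ / 2) * e := by positivity
    rw [add_mul]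
    linarith

theorem hasSuperCorrectors_effectiveHamiltonian {H : Fin 2 → E n → E n → ℝ}
    (hHc : ∀ i, Continuous (fun z : E n × E n => H i z.1 z.2))
    (hA1 : ∀ i, UniformlyCoercive (H i)) (hA2 : ∀ i, PeriodicHamiltonian (H i)) {L : ℝ}
    (hL0 : 0 ≤ L) (hL : ∀ i (ξ p q : E n), |H i ξ p - H i ξ q| ≤ L * ‖p - q‖) :
    HasSuperCorrectors H (effectiveHamiltonian H) L := by
  intro A
  obtain ⟨M, m, Λ, hb⟩ := exists_cellBounds hHc hA1 hA2 A
  have := hb.Λ_nonneg; have := hb.M_nonneg; have := hb.m_nonneg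
  exact ⟨Λ, M, Λ * (2 * √n) + (M + m), hb.Λ_nonneg, hb.M_nonneg, by positivity, fun lam hlam =>
    ⟨corrector H M lam, fun P hP => corrector_lipschitz hb hlam hP,
      fun P hP => abs_lam_mul_corrector_le hb hlam hP,
      fun P Q hP hQ => corrector_lipschitz_param hHc hL0 hL hb hlam hP hQ,
      fun P hP i ξ => (abs_le.1 (abs_lam_mul_corrector_add_le hHc hA1 hA2 hb hlam hP i ξ)).2,
      fun P hP => corrector_super hHc hb hlam hP⟩⟩

/-- The dual Hamiltonian `-H(ξ, -p)`, which exchanges sub- and supersolutions. -/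
def dual (H : Fin 2 → E n → E n → ℝ) (i : Fin 2) (ξ p : E n) : ℝ := -H i ξ (-p)

/-- The negated corrector at `-P` serves, since the subsolution property of the corrector becomes
the supersolution property for the dual. Coercivity is used only for the original Hamiltonian. -/
theorem hasSuperCorrectors_dual {H : Fin 2 → E n → E n → ℝ}
    (hHc : ∀ i, Continuous (fun z : E n × E n => H i z.1 z.2))
    (hA1 : ∀ i, UniformlyCoercive (H i)) (hA2 : ∀ i, PeriodicHamiltonian (H i)) {L : ℝ}
    (hL0 : 0 ≤ L) (hL : ∀ i (ξ p q : E n), |H i ξ p - H i ξ q| ≤ L * ‖p - q‖) :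
    HasSuperCorrectors (dual H) (fun p => -effectiveHamiltonian H (-p)) L := by
  intro A
  obtain ⟨M, m, Λ, hb⟩ := exists_cellBounds hHc hA1 hA2 A
  have := hb.Λ_nonneg; have := hb.M_nonneg; have := hb.m_nonneg
  have hneg : ∀ s t : ℝ, |-s - -t| = |s - t| := fun s t => by
    rw [← abs_neg]; congr 1; ring
  have hP' : ∀ {P : E n}, ‖P‖ ≤ A → ‖-P‖ ≤ A := fun h => by rwa [norm_neg]
  refine ⟨Λ, M, Λ * (2 * √n) + (M + m), hb.Λ_nonneg, hb.M_nonneg, by positivity, fun lam hlam =>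
    ⟨fun i P ξ => -corrector H M lam i (-P) ξ, fun P hP i x y => ?_, fun P hP i ξ => ?_,
      fun P Q hP hQ i ξ => ?_, fun P hP i ξ => ?_, fun P hP i j hij => ?_⟩⟩
  · rw [hneg]; exact corrector_lipschitz hb hlam (hP' hP) i x y
  · rw [mul_neg, abs_neg]; exact abs_lam_mul_corrector_le hb hlam (hP' hP) i ξ
  · have h := corrector_lipschitz_param hHc hL0 hL hb hlam (hP' hP) (hP' hQ) i ξ
    rw [show -P - -Q = -(P - Q) by abel, norm_neg] at h
    rwa [hneg]
  · have := (abs_le.1 (abs_lam_mul_corrector_add_le hHc hA1 hA2 hb hlam (hP' hP) i ξ)).1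
    linarith
  · have h := (corrector_sub hHc hb hlam (hP' hP) i j hij).neg
    convert h using 3 with ξ p
    simp only [dual, neg_add]
    ring

end Rate

end WeaklyCoupledHJ

/-! ### The two-sided estimate -/

theorem theorem1p3 {n : ℕ}
    (H : Fin 2 → WeaklyCoupledHJ.E n → WeaklyCoupledHJ.E n → ℝ)
    (f : Fin 2 → WeaklyCoupledHJ.E n → ℝ)
    (hHcont : ∀ i, Continuous
      (fun z : WeaklyCoupledHJ.E n × WeaklyCoupledHJ.E n => H i z.1 z.2))
    (hA1 : ∀ i, WeaklyCoupledHJ.UniformlyCoercive (H i))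
    (hA2 : ∀ i, WeaklyCoupledHJ.PeriodicHamiltonian (H i))
    (hA3 : ∀ i, WeaklyCoupledHJ.UniformlyLipschitzInP (H i))
    (hf : ∀ i, ContDiff ℝ 1 (f i))
    (hDf : ∀ i, ∃ L : ℝ, ∀ x, ‖gradient (f i) x‖ ≤ L) :
    ∀ T : ℝ, 0 < T → ∃ C : ℝ, 0 < C ∧
      ∀ u : WeaklyCoupledHJ.E n → ℝ → ℝ,
        WeaklyCoupledHJ.IsCauchySolution (WeaklyCoupledHJ.effectiveHamiltonian H)
          (fun x => (f 0 x + f 1 x) / 2) T u →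
      ∀ ε : ℝ, 0 < ε →
      ∀ uε : Fin 2 → WeaklyCoupledHJ.E n → ℝ → ℝ,
        WeaklyCoupledHJ.IsSystemSolution H f T ε uε →
      ∀ i j : Fin 2, i ≠ j → ∀ x : WeaklyCoupledHJ.E n, ∀ t ∈ Set.Icc (0 : ℝ) T,
        |uε i x t - WeaklyCoupledHJ.matched f ε u i j x t| ≤ C * ε ^ ((1 : ℝ) / 3) := by
  open WeaklyCoupledHJ in
  intro T hT
  choose L hL0 hL using hA3
  choose Lf hLf using hDf
  have hCH : 0 ≤ L 0 + L 1 := (add_pos (hL0 0) (hL0 1)).le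
  have hH : ∀ i (ξ p q : E n), |H i ξ p - H i ξ q| ≤ (L 0 + L 1) * ‖p - q‖ := fun i ξ p q => by
    refine (hL i ξ p q).trans (mul_le_mul_of_nonneg_right ?_ (norm_nonneg _))
    have := hL0 0; have := hL0 1
    fin_cases i <;> simp <;> linarith
  have hDf' : ∀ i x, ‖gradient (f i) x‖ ≤ Lf 0 + Lf 1 := fun i x => by
    have h0 := (norm_nonneg _).trans (hLf 0 x)
    have h1 := (norm_nonneg _).trans (hLf 1 x)
    refine (hLf i x).trans ?_
    fin_cases i <;> simp <;> linarith
  have hHb := abs_effectiveHamiltonian_sub_le hHcont hA1 hA2 hH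
  have hUC := fun i => uniformContInX_of_periodic (hHcont i) (hA2 i)
  have hbdd := fun i R => exists_bound_of_periodic (hHcont i) (hA2 i) R
  have hneg : ∀ s t : ℝ, |-s - -t| = |s - t| := fun s t => by
    rw [← abs_neg]; congr 1; ring
  obtain ⟨C₁, hC₁, h₁⟩ := exists_rate_upper hCH hH hHb hUC hbdd
    (hasSuperCorrectors_effectiveHamiltonian hHcont hA1 hA2 hCH hH) hf hDf' hT
  -- The lower estimate is the upper one for `-u^ε`, `-u` and `-f` with the dual Hamiltonians; the
  -- matched function changes sign with its data.
  obtain ⟨C₂, hC₂, h₂⟩ := exists_rate_upper (H := dual H)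
    (Hb := fun p => -effectiveHamiltonian H (-p)) (f := fun i x => -f i x) hCH
    (fun i ξ p q => by
      rw [dual, dual, hneg]
      refine (hH i ξ (-p) (-q)).trans_eq ?_
      rw [show -p - -q = -(p - q) by abel, norm_neg])
    (fun p q => by
      rw [hneg]
      refine (hHb (-p) (-q)).trans_eq ?_
      rw [show -p - -q = -(p - q) by abel, norm_neg])
    (fun i R τ hτ => by
      obtain ⟨δ, hδ, h⟩ := hUC i R τ hτ
      refine ⟨δ, hδ, fun ξ η p hp hξη => ?_⟩
      rw [dual, dual, hneg]
      exact h ξ η (-p) (by rwa [norm_neg]) hξη)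
    (fun i R => by
      obtain ⟨K, hK, h⟩ := hbdd i R
      refine ⟨K, hK, fun ξ p hp => ?_⟩
      rw [dual, abs_neg]
      exact h ξ (-p) (by rwa [norm_neg]))
    (hasSuperCorrectors_dual hHcont hA1 hA2 hCH hH) (fun i => (hf i).neg)
    (fun i x => by rw [gradient_neg', norm_neg]; exact hDf' i x) hT
  refine ⟨C₁ + C₂, by positivity, fun u hu ε hε uε huε i j hij x t ht => ?_⟩
  have b₁ := h₁ u hu.continuousOn hu.super hu.initial ε hε uε huε.continuousOn huε.sub
    huε.initial i j hij x t ht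
  have b₂ := h₂ (fun x t => -u x t) hu.continuousOn.neg hu.sub.neg
    (fun x => by rw [hu.initial]; ring) ε hε (fun i x t => -uε i x t)
    (fun i => (huε.continuousOn i).neg)
    (fun i j hij => by
      have h := (huε.super i j hij).neg
      convert h using 4
      simp only [dual]
      ring)
    (fun i x => by rw [huε.initial]) i j hij x t ht
  have e : matched (fun i x => -f i x) ε (fun x t => -u x t) i j x t
      = -matched f ε u i j x t := by
    simp only [matched]; ring
  rw [e] at b₂
  have hε3 : 0 < ε ^ ((1 : ℝ) / 3) := Real.rpow_pos_of_pos hε _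
  have p₁ := mul_pos hC₁ hε3
  have p₂ := mul_pos hC₂ hε3
  rw [abs_le, add_mul]
  constructor <;> linarith
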